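/- Let $\beta>0$ and $\mu>0$, let $f_{\rm FD}(z)=\frac1{1+e^z}$, and let $-\Delta$ be the Laplacian on $L^2(\mathbb R^3)=L^2(\mathbb R^3;\mathbb C)$ with domain $H^2(\mathbb R^3)$, normed by $\|\varphi\|_{H^2}:=\|\varphi\|_{L^2}+\|\Delta\varphi\|_{L^2}$. For a bounded operator $A$ on $L^2(\mathbb R^3)$, the density $\operatorname{den}A$ is the locally integrable function $\rho$, if it exists, such that for every $\chi\in C_c^\infty(\mathbb R^3)$ the operator $\chi A$ is trace class with $\operatorname{Tr}(\chi A)=\int\chi\rho$. For $a>0$ and $0<\alpha<\pi/\beta$ let $\Gamma=\Gamma_{a,\alpha}$ be the boundary of the half-strip $\{\operatorname{Re}z>-a,\ |\operatorname{Im}z|<\alpha\}$, run from $+\infty+i\alpha$ via $-a+i\alpha$ and $-a-i\alpha$ to $+\infty-i\alpha$. For an operator $H$ whose spectrum lies inside $\Gamma$, put $f_{\rm FD}(\beta(H-\mu)):=\frac1{2\pi i}\int_\Gamma f_{\rm FD}(\beta(z-\mu))(z-H)^{-1}\,dz$. Then there is a bounded operator $M$ on $L^2(\mathbb R^3)$,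 independent of $a$ and $\alpha$, with the following properties. (1) For every $\varphi\in L^2(\mathbb R^3)$, $$M\varphi=-\operatorname{den}\,\frac1{2\pi i}\int_\Gamma f_{\rm FD}(\beta(z-\mu))\,(z+\Delta)^{-1}\varphi\,(z+\Delta)^{-1}\,dz ,$$ where $\varphi$ acts by multiplication, the operators $(z+\Delta)^{-1}\varphi(z+\Delta)^{-1}$, $z\in\Gamma$, are bounded, the integral converges absolutely in operator norm, and the density on the right exists and is the unique element of $L^2(\mathbb R^3)$ with the defining property. (2) $M$ is the linearization $d_\varphi\operatorname{den}f_{\rm FD}(\beta(-\Delta-\varphi-\mu))\big|_{\varphi=0}$: for all $\varphi$ in a neighbourhood of $0$ in $H^2(\mathbb R^3)$ (depending on $a,\alpha$) the spectra of $-\Delta-\varphi$ and $-\Delta$ lie inside $\Gamma$, the increment $\operatorname{den}\big[f_{\rm FD}(\beta(-\Delta-\varphi-\mu))-f_{\rm FD}(\beta(-\Delta-\mu))\big]$ exists in $L^2(\mathbb R^3)$, and it equals $M\varphi+o(\|\varphi\|_{H^2})$ in $L^2(\mathbb R^3)$ as $\varphi\to0$ in $H^2(\mathbb R^3)$. (3)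 On $L^2(\mathbb R^3)$, $$M=\frac1{8\pi^2}\,\frac1{|\nabla|}\int_0^\infty\ln\left(\left|\frac{\sqrt{4t}+|\nabla|}{\sqrt{4t}-|\nabla|}\right|\right)f_{\rm FD}(\beta(t-\mu))\,dt ,$$ that is, with $\hat g(k)=(2\pi)^{-3/2}\int g(x)e^{-ix\cdot k}\,dx$, for every $\varphi\in L^2(\mathbb R^3)$ and almost every $k\in\mathbb R^3$, $$\widehat{M\varphi}(k)=m(|k|)\,\hat\varphi(k),\qquad m(p)=\frac1{8\pi^2p}\int_0^\infty\ln\left|\frac{\sqrt{4t}+p}{\sqrt{4t}-p}\right|f_{\rm FD}(\beta(t-\mu))\,dt ,$$ where the last integral converges absolutely for every $p>0$. -/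

import Mathlib

open MeasureTheory Set Filter
open scoped FourierTransform SchwartzMap Laplacian ContDiff InnerProductSpace

noncomputable section

namespace REHF

/-- Physical space `ℝ³`. -/
abbrev E3 : Type := EuclideanSpace ℝ (Fin 3)

/-- The complex Hilbert space `L²(ℝ³)`. -/
abbrev L2 : Type := Lp (α := E3) ℂ 2 volume

/-! ### Unbounded operators on `L²(ℝ³)` -/

/-- The graph of the Laplacian on `L²(ℝ³)`: pairs `(u, v)` with `Δ u = v` in the sense of
(tempered) distributions. -/
def laplaceGraph : Submodule ℂ (L2 × L2) where
  carrier := {p | Δ (p.1 : 𝓢'(E3, ℂ)) = (p.2 : 𝓢'(E3, ℂ))}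
  zero_mem' := by
    have h0 : ((0 : L2) : 𝓢'(E3, ℂ)) = 0 := map_zero (Lp.toTemperedDistributionCLM ℂ volume 2)
    simp only [mem_ofPred_eq, Prod.fst_zero, Prod.snd_zero, h0]
    rw [← TemperedDistribution.laplacianCLM_apply, map_zero]
  add_mem' := by
    intro p q hp hq
    have hadd : ∀ u v : L2, ((u + v : L2) : 𝓢'(E3, ℂ)) = (u : 𝓢'(E3, ℂ)) + (v : 𝓢'(E3, ℂ)) :=
      fun u v => map_add (Lp.toTemperedDistributionCLM ℂ volume 2) u v
    simp only [mem_ofPred_eq] at hp hq ⊢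
    rw [Prod.fst_add, Prod.snd_add, hadd, hadd, ← hp, ← hq]
    simp only [← TemperedDistribution.laplacianCLM_apply, map_add]
  smul_mem' := by
    intro c p hp
    have hsmul : ∀ u : L2, ((c • u : L2) : 𝓢'(E3, ℂ)) = c • (u : 𝓢'(E3, ℂ)) :=
      fun u => map_smul (Lp.toTemperedDistributionCLM ℂ volume 2) c u
    simp only [mem_ofPred_eq] at hp ⊢
    rw [Prod.smul_fst, Prod.smul_snd, hsmul, hsmul, ← hp]
    simp only [← TemperedDistribution.laplacianCLM_apply, map_smul]

/-- The Laplacian `Δ` on `L²(ℝ³)`, with domain `{u ∈ L² : Δ u ∈ L²} = H²(ℝ³)`. -/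
def laplace : L2 →ₗ.[ℂ] L2 := laplaceGraph.toLinearPMap

theorem laplace_graph : laplace.graph = laplaceGraph := by
  refine Submodule.toLinearPMap_graph_eq _ ?_
  rintro ⟨u, v⟩ h hu
  obtain rfl : u = 0 := hu
  have h0 : ((0 : L2) : 𝓢'(E3, ℂ)) = 0 := map_zero (Lp.toTemperedDistributionCLM ℂ volume 2)
  have h' : Δ ((0 : L2) : 𝓢'(E3, ℂ)) = (v : 𝓢'(E3, ℂ)) := h
  rw [h0, ← TemperedDistribution.laplacianCLM_apply, map_zero] at h'
  have hv : v ∈ (Lp.toTemperedDistributionCLM (E := E3) ℂ volume 2).ker := h'.symm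
  rw [Lp.ker_toTemperedDistributionCLM_eq_bot] at hv
  exact hv

/-- The graph of the maximal operator of multiplication by `φ`. -/
def mulGraph (φ : L2) : Submodule ℂ (L2 × L2) where
  carrier := {p | (p.2 : E3 → ℂ) =ᵐ[volume] fun x => φ x * p.1 x}
  zero_mem' := by
    filter_upwards [Lp.coeFn_zero ℂ 2 (volume : Measure E3)] with x hx
    simp only [Prod.fst_zero, Prod.snd_zero, hx, Pi.zero_apply, mul_zero]
  add_mem' := by
    intro p q hp hq
    simp only [mem_ofPred_eq] at hp hq ⊢
    filter_upwards [hp, hq, Lp.coeFn_add p.1 q.1, Lp.coeFn_add p.2 q.2] with x h1 h2 h3 h4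
    simp only [Prod.fst_add, Prod.snd_add, h3, h4, Pi.add_apply, h1, h2, mul_add]
  smul_mem' := by
    intro c p hp
    simp only [mem_ofPred_eq] at hp ⊢
    filter_upwards [hp, Lp.coeFn_smul c p.1, Lp.coeFn_smul c p.2] with x h1 h2 h3
    simp only [Prod.smul_fst, Prod.smul_snd, h2, h3, Pi.smul_apply, h1, smul_eq_mul]
    ring

/-- Multiplication by `φ` on `L²(ℝ³)`, with its maximal domain `{u ∈ L² : φ u ∈ L²}`. -/
def mulOp (φ : L2) : L2 →ₗ.[ℂ] L2 := (mulGraph φ).toLinearPMap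

theorem mulOp_graph (φ : L2) : (mulOp φ).graph = mulGraph φ := by
  refine Submodule.toLinearPMap_graph_eq _ ?_
  rintro ⟨u, v⟩ h hu
  obtain rfl : u = 0 := hu
  have h' : (v : E3 → ℂ) =ᵐ[volume] fun x => φ x * (0 : L2) x := h
  change v = 0
  rw [Lp.eq_zero_iff_ae_eq_zero]
  filter_upwards [h'] with x h1
  simp [h1]

/-- The Schrödinger operator `-Δ - φ`. -/
def hamiltonian (φ : L2) : L2 →ₗ.[ℂ] L2 := -laplace - mulOp φ

/-- `R` is a bounded two-sided inverse `(z - H)⁻¹` of `z - H`. -/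
def IsResolventAt (H : L2 →ₗ.[ℂ] L2) (z : ℂ) (R : L2 →L[ℂ] L2) : Prop :=
  (∀ u : L2, ∃ h : R u ∈ H.domain, z • R u - H ⟨R u, h⟩ = u) ∧
    ∀ u : H.domain, R (z • (u : L2) - H u) = u

/-- The resolvent set of the unbounded operator `H`. -/
def resolventSetOf (H : L2 →ₗ.[ℂ] L2) : Set ℂ := {z | ∃ R, IsResolventAt H z R}

open scoped Classical in
/-- The resolvent `(z - H)⁻¹` (and `0` when `z` is not in the resolvent set). -/
def resolventOf (H : L2 →ₗ.[ℂ] L2) (z : ℂ) : L2 →L[ℂ] L2 :=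
  if h : ∃ R, IsResolventAt H z R then h.choose else 0

/-! ### Trace and density of an operator -/

/-- `T` is trace class with trace `τ`: for *every* orthonormal basis `(eᵢ)` the family
`⟨eᵢ, T eᵢ⟩` is (absolutely) summable, with sum `τ`. -/
def HasTrace (T : L2 →L[ℂ] L2) (τ : ℂ) : Prop :=
  ∀ (ι : Type) (e : HilbertBasis ι ℂ L2), HasSum (fun i => ⟪e i, T (e i)⟫_ℂ) τ

/-- `ρ` is the density `den A` of the operator `A` (formally `ρ(x) = A(x, x)`):
`Tr (χ A) = ∫ χ ρ` for all `χ ∈ C_c^∞(ℝ³)`. -/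
def HasDensity (A : L2 →L[ℂ] L2) (ρ : E3 → ℂ) : Prop :=
  LocallyIntegrable ρ volume ∧
    ∀ χ : E3 → ℂ, ContDiff ℝ ∞ χ → HasCompactSupport χ →
      ∃ T : L2 →L[ℂ] L2,
        (∀ u : L2, (T u : E3 → ℂ) =ᵐ[volume] fun x => χ x * A u x) ∧
          HasTrace T (∫ x, χ x * ρ x)

/-! ### The Fermi–Dirac function and the contour -/

/-- The Fermi–Dirac function `f_FD(z) = 1 / (1 + e^z)`. -/
def fermiDirac (z : ℂ) : ℂ := 1 / (1 + Complex.exp z)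

/-- The open half-strip `{Re z > -a, |Im z| < α}` bounded by the contour. -/
def halfStrip (a α : ℝ) : Set ℂ := {z | -a < z.re ∧ |z.im| < α}

/-- The contour `Γ`: the boundary of the half-strip. -/
def contour (a α : ℝ) : Set ℂ :=
  {z | (-a ≤ z.re ∧ |z.im| = α) ∨ (z.re = -a ∧ |z.im| ≤ α)}

/-- The integral `∫_Γ G(z) dz` converges absolutely with value `J`, where `Γ` runs
`+∞ + iα → -a + iα → -a - iα → +∞ - iα`. -/
def HasContourIntegral (a α : ℝ) (G : ℂ → L2 →L[ℂ] L2) (J : L2 →L[ℂ] L2) : Prop :=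
  IntegrableOn (fun t : ℝ => G (t + α * Complex.I)) (Ioi (-a)) ∧
  IntegrableOn (fun s : ℝ => G (-a + s * Complex.I)) (Ioc (-α) α) ∧
  IntegrableOn (fun t : ℝ => G (t - α * Complex.I)) (Ioi (-a)) ∧
  J = -(∫ t in Ioi (-a), G (t + α * Complex.I))
    - Complex.I • (∫ s in Ioc (-α) α, G (-a + s * Complex.I))
    + ∫ t in Ioi (-a), G (t - α * Complex.I)

/-- `A = f_FD(β(H - μ))` in the sense of the holomorphic functional calculus: the spectrum of `H`
lies inside `Γ` and `A = (1 / 2πi) ∫_Γ f_FD(β(z - μ)) (z - H)⁻¹ dz`. -/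
def IsFermiOperator (β μ a α : ℝ) (H : L2 →ₗ.[ℂ] L2) (A : L2 →L[ℂ] L2) : Prop :=
  (∀ z : ℂ, z ∉ halfStrip a α → z ∈ resolventSetOf H) ∧
    ∃ J : L2 →L[ℂ] L2,
      HasContourIntegral a α (fun z => fermiDirac (β * (z - μ)) • resolventOf H z) J ∧
        A = (2 * Real.pi * Complex.I)⁻¹ • J

/-- `T = (z + Δ)⁻¹ φ (z + Δ)⁻¹`, where `φ` acts by multiplication. -/
def IsSandwich (φ : L2) (z : ℂ) (T : L2 →L[ℂ] L2) : Prop :=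
  z ∈ resolventSetOf (-laplace) ∧
    ∀ u : L2, ∃ h : resolventOf (-laplace) z u ∈ (mulOp φ).domain,
      T u = resolventOf (-laplace) z (mulOp φ ⟨resolventOf (-laplace) z u, h⟩)

/-- `g = M φ`, that is,
`g = - den (1 / 2πi) ∫_Γ f_FD(β(z - μ)) (z + Δ)⁻¹ φ (z + Δ)⁻¹ dz`. -/
def IsLinearResponse (β μ a α : ℝ) (φ g : L2) : Prop :=
  ∃ (T : ℂ → L2 →L[ℂ] L2) (J : L2 →L[ℂ] L2),
    (∀ z ∈ contour a α, IsSandwich φ z (T z)) ∧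
      HasContourIntegral a α (fun z => fermiDirac (β * (z - μ)) • T z) J ∧
        HasDensity (-((2 * Real.pi * Complex.I)⁻¹ • J)) g

/-- The operator `M` is the Fréchet derivative at `φ = 0` of
`H²(ℝ³) ∋ φ ↦ den f_FD(β(-Δ - φ - μ))`. The density is linear in the operator, so the increment
of this map is the density of the difference of the two operators, and it is measured in `L²`.
The norm on `H²` is `‖φ‖ + ‖Δ φ‖`. -/
def IsLinearization (β μ a α : ℝ) (M : L2 →L[ℂ] L2) : Prop :=
  ∀ ε : ℝ, 0 < ε → ∃ δ : ℝ, 0 < δ ∧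
    ∀ φ : laplace.domain, ‖(φ : L2)‖ + ‖laplace φ‖ ≤ δ →
      ∃ (A A₀ : L2 →L[ℂ] L2) (ρ : L2),
        IsFermiOperator β μ a α (hamiltonian φ) A ∧
        IsFermiOperator β μ a α (hamiltonian 0) A₀ ∧
        HasDensity (A - A₀) ρ ∧
        ‖ρ - M φ‖ ≤ ε * (‖(φ : L2)‖ + ‖laplace φ‖)

/-- The integrand `ln |(√(4t) + p) / (√(4t) - p)| f_FD(β(t - μ))`. -/
def symbolIntegrand (β μ p t : ℝ) : ℝ :=
  Real.log |(√(4 * t) + p) / (√(4 * t) - p)| * (1 / (1 + Real.exp (β * (t - μ))))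

/-- The symbol `(1 / 8π² p) ∫₀^∞ ln |(√(4t) + p) / (√(4t) - p)| f_FD(β(t - μ)) dt`. -/
def symbol (β μ p : ℝ) : ℝ :=
  1 / (8 * Real.pi ^ 2 * p) * ∫ t in Ioi (0 : ℝ), symbolIntegrand β μ p t

end REHF

end

open MeasureTheory Set Filter
open scoped FourierTransform SchwartzMap Laplacian ContDiff InnerProductSpace

noncomputable section

namespace REHF

/-! ### The elementary integral that produces the logarithm -/

section

/-! On and outside `Γ` the point `z` stays at distance at least `δ = min a α` from `[0, ∞)`, and the
free resolvent `R = (z + Δ)⁻¹` is the Fourier multiplier `(z - |k|²)⁻¹`. In three dimensions this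
symbol is square integrable, with norm growing at most linearly in `z`. Hence `χ R` and `φ R` are
Hilbert–Schmidt for `χ, φ ∈ L²` (`hsBound_mulMult`), and `χ R V φ R` has a basis-independent trace
bounded by a constant times `‖χ‖ ‖V‖ ‖φ‖` and a quadratic polynomial in `‖z‖`. The Fermi function
decays exponentially along `Γ`, so the contour integral of these traces is a bounded functional of
`χ ∈ L²`, and Riesz representation yields a density in `L²` (`exists_density`).

For `V = 1` the density is computed on the Fourier side. The trace is a double integral over `k` and
`l` of `(z - |k|²)⁻¹ (z - |k - l|²)⁻¹` times a function of `l` that carries both `φ` and the test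
function (`Far.opTrace_eq_integral_prod`). Integrating over `z` first, partial fractions and
Cauchy's formula give minus the difference quotient of `f` between `|k|²` and `|k - l|²`
(`integral_fermi_mul_inv_mul_inv`). It remains to integrate this over `k` (`lintegral_occQuot`). The
quotient is the average of `-f'` over the segment joining the two energies; completing the square
(`feynman_square`) and translating `k` makes the integrand radial; integration by parts reduces it
to the one-dimensional integral of `f(ρ² + c)`; and after `t = ρ² + c` the average over the segment
parameter is elementary and equals the logarithm (`lintegral_inv_sqrt`). All integrands there are
nonnegative, so Tonelli applies freely, and finiteness follows from a Gaussian bound.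

For the linearization, `H² ⊂ L^∞` makes a small `φ` a small bounded perturbation `Φ`. With `W = (1 +
Φ R)⁻¹` the perturbed resolvent is `R W = R - R φ R + R (W Φ R) φ R` (`Far.freeRes_comp_resFactor`).
The middle term gives `M φ`. The last one has the same shape with `V = -W Φ R` of size `O(‖Φ‖)`, so
its density is quadratically small in the `H²` norm (`exists_increment`).

With Mathlib's Fourier transform the momentum is `k = 2π ξ`, whence the factors `2π` throughout. -/

theorem log_half_difference {p t : ℝ} (hp : 0 < p) (ht : 0 < t) (hne : t ≠ p ^ 2 / 4) :
    2 * (1 / p * Real.log (p / 2 + √t) - 1 / p * Real.log √|t - p ^ 2 / 4|) =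
      1 / p * Real.log |(√(4 * t) + p) / (√(4 * t) - p)| := by
  have h4 : √(4 * t) = 2 * √t := by
    rw [Real.sqrt_mul (by norm_num), show (4 : ℝ) = 2 ^ 2 by norm_num, Real.sqrt_sq (by norm_num)]
  have hs : 0 < √t := Real.sqrt_pos.2 ht
  have hD : t - p ^ 2 / 4 = (p / 2 + √t) * (√t - p / 2) := by
    nlinarith [Real.sq_sqrt ht.le]
  have hm : √t - p / 2 ≠ 0 := by
    intro h
    rw [h, mul_zero, sub_eq_zero] at hD
    exact hne hD
  have hpos : 0 < p / 2 + √t := by positivity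
  have e : (√(4 * t) + p) / (√(4 * t) - p) = (p / 2 + √t) / (√t - p / 2) := by
    rw [h4]
    have : 2 * √t - p ≠ 0 := fun h => hm (by linarith)
    rw [div_eq_div_iff this hm]
    ring
  rw [e, Real.log_abs, Real.log_div hpos.ne' hm, Real.log_sqrt (abs_nonneg _), Real.log_abs, hD,
    Real.log_mul hpos.ne' hm]
  ring

/-- With `D = t - p² / 4` the radicand is `D + (p v)²`, and `(1 / p) log (p v + √(D + (p v)²))` is
an antiderivative wherever it is positive. Where it is not, `√` and division by zero make the
integrand `0`. -/
theorem integral_half_inv_sqrt {p t : ℝ} (hp : 0 < p) (ht : 0 < t) (hne : t ≠ p ^ 2 / 4) :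
    IntervalIntegrable (fun v => 1 / √(t - p ^ 2 * (1 / 4 - v ^ 2))) volume 0 (1 / 2) ∧
    ∫ v in (0 : ℝ)..(1 / 2), 1 / √(t - p ^ 2 * (1 / 4 - v ^ 2)) =
      1 / p * Real.log (p / 2 + √t) - 1 / p * Real.log √|t - p ^ 2 / 4| := by
  set D := t - p ^ 2 / 4 with hD
  have hD0 : D ≠ 0 := sub_ne_zero.2 hne
  have hrw : ∀ v : ℝ, t - p ^ 2 * (1 / 4 - v ^ 2) = D + (p * v) ^ 2 := fun v => by rw [hD]; ring
  simp only [hrw]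
  -- The zero of the radicand if `D < 0`; for `D > 0` the square root of a negative number is `0`,
  -- so `v₀ = 0` and both signs of `D` are handled together.
  set v₀ := √(-D) / p with hv₀
  have hv0 : 0 ≤ v₀ := by positivity
  have hpv : p * v₀ = √(-D) := by rw [hv₀]; field_simp
  have hv1 : v₀ < 1 / 2 := by
    rw [hv₀, div_lt_iff₀ hp, Real.sqrt_lt' (by positivity)]
    nlinarith
  have hlow : ∀ v ∈ Ioc 0 v₀, 1 / √(D + (p * v) ^ 2) = 0 := by
    intro v hv
    have h1 : p * v ≤ √(-D) := by rw [← hpv]; gcongr; exact hv.2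
    have h2 : 0 < √(-D) := (mul_pos hp hv.1).trans_le h1
    have h3 : (p * v) ^ 2 ≤ -D := by
      rw [← Real.sq_sqrt (Real.sqrt_pos.1 h2).le]
      have : 0 < p * v := mul_pos hp hv.1
      gcongr
    rw [Real.sqrt_eq_zero_of_nonpos (by linarith), div_zero]
  have hup : ∀ v, v₀ < v → 0 < D + (p * v) ^ 2 := by
    intro v hv
    have h1 : √(-D) < p * v := by rw [← hpv]; gcongr
    have h2 := (Real.sqrt_lt' ((Real.sqrt_nonneg _).trans_lt h1)).1 h1
    linarith
  have hpos : ∀ v ∈ Icc v₀ (1 / 2), 0 < p * v + √(D + (p * v) ^ 2) := by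
    intro v hv
    rcases hv.1.eq_or_lt with h | h
    · rw [← h, hpv]
      rcases lt_or_gt_of_ne hD0 with hd | hd
      · have : 0 < √(-D) := Real.sqrt_pos.2 (by linarith)
        positivity
      · have : 0 < √(D + √(-D) ^ 2) := Real.sqrt_pos.2 (by positivity)
        positivity
    · have := Real.sqrt_pos.2 (hup v h)
      have : 0 ≤ p * v := mul_nonneg hp.le (hv0.trans hv.1)
      positivity
  have hcont : ContinuousOn (fun v => 1 / p * Real.log (p * v + √(D + (p * v) ^ 2)))
      (Icc v₀ (1 / 2)) := by
    refine continuousOn_const.mul (ContinuousOn.log (by fun_prop) fun v hv => (hpos v hv).ne')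
  have hderiv : ∀ v ∈ Ioo v₀ (1 / 2), HasDerivAt
      (fun v => 1 / p * Real.log (p * v + √(D + (p * v) ^ 2))) (1 / √(D + (p * v) ^ 2)) v := by
    intro v hv
    have h1 := hup v hv.1
    have h2 := hpos v ⟨hv.1.le, hv.2.le⟩
    have d1 : HasDerivAt (fun v : ℝ => p * v) p v := by
      simpa using (hasDerivAt_id v).const_mul p
    have d2 := ((d1.add ((d1.pow 2).const_add D |>.sqrt h1.ne')).log h2.ne').const_mul (1 / p)
    have h3 := Real.sqrt_pos.2 h1
    refine HasDerivAt.congr_deriv d2 ?_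
    simp only [Nat.cast_ofNat, Pi.pow_apply, Pi.add_apply]
    generalize √(D + (p * v) ^ 2) = r at h2 h3 ⊢
    field_simp
    ring
  -- The integrand is singular at `v₀` when `D < 0`; it is integrable as the nonnegative derivative
  -- of a function continuous up to the endpoint.
  have hint := intervalIntegral.integrableOn_deriv_of_nonneg hcont hderiv
    (fun v _ => by positivity)
  have hint1 : IntervalIntegrable (fun v => 1 / √(D + (p * v) ^ 2)) volume v₀ (1 / 2) :=
    (intervalIntegrable_iff_integrableOn_Ioc_of_le hv1.le).2 hint
  have hint0 : IntervalIntegrable (fun v => 1 / √(D + (p * v) ^ 2)) volume 0 v₀ := by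
    rw [intervalIntegrable_iff_integrableOn_Ioc_of_le hv0]
    exact (integrableOn_zero).congr_fun (fun v hv => (hlow v hv).symm) measurableSet_Ioc
  refine ⟨hint0.trans hint1, ?_⟩
  rw [← intervalIntegral.integral_add_adjacent_intervals hint0 hint1,
    intervalIntegral.integral_eq_sub_of_hasDerivAt_of_le hv1.le hcont hderiv hint1,
    intervalIntegral.integral_of_le hv0, setIntegral_congr_fun measurableSet_Ioc hlow,
    integral_zero, zero_add]
  have e1 : D + (p * (1 / 2)) ^ 2 = t := by rw [hD]; ring
  have e2 : p * v₀ + √(D + (p * v₀) ^ 2) = √|D| := by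
    rw [hpv]
    rcases lt_or_gt_of_ne hD0 with hd | hd
    · rw [Real.sq_sqrt (by linarith), add_neg_cancel, Real.sqrt_zero, add_zero, abs_of_neg hd]
    · rw [Real.sqrt_eq_zero_of_nonpos (by linarith : -D ≤ 0), abs_of_pos hd]
      simp
  rw [e1, e2, mul_one_div]

theorem lintegral_inv_sqrt {p t : ℝ} (hp : 0 < p) (ht : 0 < t) (hne : t ≠ p ^ 2 / 4) :
    ∫⁻ v in Ioc (-(1 / 2) : ℝ) (1 / 2),
      ENNReal.ofReal (1 / √(t - p ^ 2 * (1 / 4 - v ^ 2))) =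
      ENNReal.ofReal (1 / p * Real.log |(√(4 * t) + p) / (√(4 * t) - p)|) := by
  obtain ⟨hi, he⟩ := integral_half_inv_sqrt hp ht hne
  have hi' : IntervalIntegrable (fun v => 1 / √(t - p ^ 2 * (1 / 4 - v ^ 2))) volume (-(1 / 2)) 0 := by
    have h := (hi.comp_sub_left 0).symm
    simpa using h
  have hi2 := hi'.trans hi
  rw [← ofReal_integral_eq_lintegral_ofReal
    ((intervalIntegrable_iff_integrableOn_Ioc_of_le (by norm_num)).1 hi2)
    (.of_forall fun v => by positivity), ← intervalIntegral.integral_of_le (by norm_num),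
    ← intervalIntegral.integral_add_adjacent_intervals hi' hi]
  have e : ∫ v in (-(1 / 2) : ℝ)..0, 1 / √(t - p ^ 2 * (1 / 4 - v ^ 2)) =
      ∫ v in (0 : ℝ)..(1 / 2), 1 / √(t - p ^ 2 * (1 / 4 - v ^ 2)) := by
    have := intervalIntegral.integral_comp_neg (a := 0) (b := 1 / 2)
      (fun v => 1 / √(t - p ^ 2 * (1 / 4 - v ^ 2)))
    simp only [neg_sq, neg_zero] at this
    exact this.symm
  rw [e, he, ← log_half_difference hp ht hne]
  ring_nf

end

/-! ### The occupation number, radial integrals and the symbol -/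

section

open scoped ENNReal
/-- The occupation number `1 / (1 + exp (β (t - μ)))` of the energy `t`. -/
def occ (β μ t : ℝ) : ℝ := 1 / (1 + Real.exp (β * (t - μ)))

/-- Minus the derivative of the occupation number. -/
def occSlope (β μ t : ℝ) : ℝ :=
  β * Real.exp (β * (t - μ)) / (1 + Real.exp (β * (t - μ))) ^ 2

variable {β μ : ℝ}

theorem occ_pos (t : ℝ) : 0 < occ β μ t := by unfold occ; positivity

theorem occSlope_nonneg (hβ : 0 < β) (t : ℝ) : 0 ≤ occSlope β μ t := by unfold occSlope; positivity

@[fun_prop]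
theorem continuous_occ : Continuous (occ β μ) := by
  unfold occ
  exact continuous_const.div (by fun_prop) fun t => by positivity

@[fun_prop]
theorem continuous_occSlope : Continuous (occSlope β μ) := by
  unfold occSlope
  exact Continuous.div (by fun_prop) (by fun_prop) fun t => by positivity

@[fun_prop]
theorem measurable_occ : Measurable (occ β μ) := continuous_occ.measurable

@[fun_prop]
theorem measurable_occSlope : Measurable (occSlope β μ) := continuous_occSlope.measurable

theorem hasDerivAt_occ (t : ℝ) : HasDerivAt (occ β μ) (-occSlope β μ t) t := by
  have h1 : HasDerivAt (fun t => 1 + Real.exp (β * (t - μ))) (Real.exp (β * (t - μ)) * β) t := by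
    have := ((((hasDerivAt_id t).sub_const μ).const_mul β).exp).const_add 1
    simpa using this
  have h2 := h1.inv (by positivity)
  have e : occ β μ = (fun t => 1 + Real.exp (β * (t - μ)))⁻¹ := by
    ext t
    simp [occ]
  rw [e]
  refine h2.congr_deriv ?_
  unfold occSlope
  ring

theorem occ_antitone (hβ : 0 < β) : Antitone (occ β μ) := by
  intro s t hst
  unfold occ
  gcongr

theorem occ_le_exp (t : ℝ) : occ β μ t ≤ Real.exp (β * μ) * Real.exp (-(β * t)) := by
  rw [occ, ← Real.exp_add, one_div, show β * μ + -(β * t) = -(β * (t - μ)) by ring, Real.exp_neg]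
  gcongr
  linarith

theorem tendsto_occ (hβ : 0 < β) : Tendsto (occ β μ) atTop (nhds 0) := by
  have h1 : Tendsto (fun t : ℝ => Real.exp (-(β * t))) atTop (nhds 0) :=
    Real.tendsto_exp_atBot.comp
      (tendsto_neg_atTop_atBot.comp (tendsto_id.const_mul_atTop hβ))
  have h2 := h1.const_mul (Real.exp (β * μ))
  rw [mul_zero] at h2
  exact squeeze_zero (fun t => (occ_pos t).le) occ_le_exp h2

theorem lintegral_Ioi_inner (F : ℝ → ℝ≥0∞) (hF : Measurable F) :
    ∫⁻ r in Ioi (0 : ℝ), ∫⁻ y in Ioi r, F y = ∫⁻ y in Ioi (0 : ℝ), ENNReal.ofReal y * F y := by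
  have e1 : ∀ r ∈ Ioi (0 : ℝ), ∫⁻ y in Ioi r, F y =
      ∫⁻ y in Ioi (0 : ℝ), {q : ℝ × ℝ | q.1 < q.2}.indicator (fun q => F q.2) (r, y) := by
    intro r hr
    rw [← lintegral_indicator measurableSet_Ioi, ← lintegral_indicator measurableSet_Ioi]
    congr 1
    ext y
    by_cases h : r < y
    · have : 0 < y := lt_trans hr h
      simp [indicator, h, this]
    · simp [indicator, h]
  rw [setLIntegral_congr_fun measurableSet_Ioi e1, lintegral_lintegral_swap]
  · refine setLIntegral_congr_fun measurableSet_Ioi fun y hy => ?_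
    have e2 : ∀ r, {q : ℝ × ℝ | q.1 < q.2}.indicator (fun q => F q.2) (r, y) =
        (Iio y).indicator (fun _ => F y) r := fun r => rfl
    simp only [e2]
    rw [lintegral_indicator measurableSet_Iio, setLIntegral_const,
      Measure.restrict_apply measurableSet_Iio, Iio_inter_Ioi, Real.volume_Ioo, sub_zero, mul_comm]
  · refine ((hF.comp measurable_snd).indicator ?_).aemeasurable
    exact measurableSet_lt measurable_fst measurable_snd

/-- Integration by parts done with Tonelli: the occupation number vanishes at infinity, so it is the
integral over `(r, ∞)` of minus its radial derivative, and swapping the two integrals produces a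
factor `y`. -/
theorem lintegral_occ_shell (hβ : 0 < β) (c : ℝ) :
    ∫⁻ r in Ioi (0 : ℝ), ENNReal.ofReal (occ β μ ((2 * Real.pi * r) ^ 2 + c)) =
      ∫⁻ y in Ioi (0 : ℝ), ENNReal.ofReal
        (8 * Real.pi ^ 2 * (y ^ 2 * occSlope β μ ((2 * Real.pi * y) ^ 2 + c))) := by
  set F : ℝ → ℝ := fun y => 8 * Real.pi ^ 2 * y * occSlope β μ ((2 * Real.pi * y) ^ 2 + c)
  have hFm : Measurable F := by fun_prop
  have hd : ∀ y, HasDerivAt (fun y => -occ β μ ((2 * Real.pi * y) ^ 2 + c)) (F y) y := by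
    intro y
    have h1 : HasDerivAt (fun y : ℝ => (2 * Real.pi * y) ^ 2 + c) (8 * Real.pi ^ 2 * y) y := by
      have := ((((hasDerivAt_id y).const_mul (2 * Real.pi)).pow 2).add_const c)
      refine HasDerivAt.congr_deriv this ?_
      simp
      ring
    refine ((hasDerivAt_occ _).comp y h1).neg.congr_deriv ?_
    simp only [F]
    ring
  have ht : Tendsto (fun y => -occ β μ ((2 * Real.pi * y) ^ 2 + c)) atTop (nhds 0) := by
    have h1 : Tendsto (fun y : ℝ => (2 * Real.pi * y) ^ 2 + c) atTop atTop := by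
      refine tendsto_atTop_add_const_right _ _ ((tendsto_pow_atTop two_ne_zero).comp ?_)
      exact tendsto_id.const_mul_atTop (by positivity)
    simpa using ((tendsto_occ hβ).comp h1).neg
  have e : ∀ r ∈ Ioi (0 : ℝ), ENNReal.ofReal (occ β μ ((2 * Real.pi * r) ^ 2 + c)) =
      ∫⁻ y in Ioi r, ENNReal.ofReal (F y) := by
    intro r hr
    have hn : ∀ y ∈ Ioi r, 0 ≤ F y := fun y hy => by
      have : 0 < y := lt_trans hr hy
      have := occSlope_nonneg (μ := μ) hβ ((2 * Real.pi * y) ^ 2 + c)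
      simp only [F]
      positivity
    have hi := integrableOn_Ioi_deriv_of_nonneg' (fun y _ => hd y) hn ht
    rw [← ofReal_integral_eq_lintegral_ofReal hi
      ((ae_restrict_iff' measurableSet_Ioi).2 (.of_forall hn)),
      integral_Ioi_of_hasDerivAt_of_tendsto' (fun y _ => hd y) hi ht]
    simp
  rw [setLIntegral_congr_fun measurableSet_Ioi e, lintegral_Ioi_inner _ (by fun_prop)]
  refine setLIntegral_congr_fun measurableSet_Ioi fun y hy => ?_
  rw [← ENNReal.ofReal_mul (le_of_lt hy)]
  congr 1
  simp only [F]
  ring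

theorem lintegral_comp_two_pi_mul (F : ℝ → ℝ≥0∞) :
    ∫⁻ y in Ioi (0 : ℝ), F y =
      ENNReal.ofReal (2 * Real.pi) * ∫⁻ r in Ioi (0 : ℝ), F (2 * Real.pi * r) := by
  have hp : (0 : ℝ) < 2 * Real.pi := by positivity
  have himg : (fun r : ℝ => 2 * Real.pi * r) '' Ioi 0 = Ioi 0 := by
    rw [image_mul_left_Ioi hp, mul_zero]
  have h := lintegral_image_eq_lintegral_abs_deriv_mul (s := Ioi (0 : ℝ))
    (f := fun r => 2 * Real.pi * r) (f' := fun _ => 2 * Real.pi) measurableSet_Ioi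
    (fun x _ => by simpa using ((hasDerivAt_id x).const_mul (2 * Real.pi)).hasDerivWithinAt)
    (fun x _ y _ h => mul_left_cancel₀ hp.ne' h) F
  rw [himg, abs_of_pos hp] at h
  rw [h, lintegral_const_mul' _ _ ENNReal.ofReal_ne_top]

/-- The integral of `occ (ρ² + c)` over the half-line. -/
def occTail (β μ c : ℝ) : ℝ≥0∞ := ∫⁻ ρ in Ioi (0 : ℝ), ENNReal.ofReal (occ β μ (ρ ^ 2 + c))

theorem occTail_le (hβ : 0 < β) {c : ℝ} (hc : 0 ≤ c) : occTail β μ c ≤ occTail β μ 0 := by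
  refine lintegral_mono fun ρ => ENNReal.ofReal_le_ofReal (occ_antitone hβ ?_)
  linarith

theorem occTail_zero_lt_top (hβ : 0 < β) : occTail β μ 0 < ⊤ := by
  have hi : IntegrableOn (fun ρ => occ β μ (ρ ^ 2 + 0)) (Ioi 0) := by
    refine (((integrable_exp_neg_mul_sq hβ).const_mul (Real.exp (β * μ))).mono'
      (Measurable.aestronglyMeasurable (by fun_prop)) (.of_forall fun ρ => ?_)).integrableOn
    rw [Real.norm_of_nonneg (occ_pos _).le]
    simpa using occ_le_exp (β := β) (μ := μ) (ρ ^ 2)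
  exact hi.lintegral_lt_top

/-- In polar coordinates the left side is `4π ∫ y² g(y) dy`, while `occTail` is `16π³` times the
same radial integral by `lintegral_occ_shell`. -/
theorem lintegral_occSlope (hβ : 0 < β) {c : ℝ} (hc : 0 ≤ c) :
    ∫⁻ ξ : E3, ENNReal.ofReal (occSlope β μ ((2 * Real.pi * ‖ξ‖) ^ 2 + c)) =
      ENNReal.ofReal (1 / (4 * Real.pi ^ 2)) * occTail β μ c := by
  set g : ℝ → ℝ := fun r => occSlope β μ ((2 * Real.pi * r) ^ 2 + c) with hg
  have hgn : ∀ r, 0 ≤ g r := fun r => occSlope_nonneg hβ _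
  have hpi := Real.pi_pos
  have hT : occTail β μ c = ENNReal.ofReal (16 * Real.pi ^ 3) *
      ∫⁻ y in Ioi (0 : ℝ), ENNReal.ofReal (y ^ 2 * g y) := by
    rw [occTail, lintegral_comp_two_pi_mul, lintegral_occ_shell hβ]
    simp only [ENNReal.ofReal_mul (show 0 ≤ 8 * Real.pi ^ 2 by positivity)]
    rw [lintegral_const_mul' _ _ ENNReal.ofReal_ne_top, ← mul_assoc,
      ← ENNReal.ofReal_mul (by positivity)]
    congr 2
    ring
  have hfin : ∫⁻ y in Ioi (0 : ℝ), ENNReal.ofReal (y ^ 2 * g y) ≠ ⊤ := by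
    intro h
    have h1 := (occTail_le (μ := μ) hβ hc).trans_lt (occTail_zero_lt_top hβ)
    rw [hT, h, ENNReal.mul_top (ENNReal.ofReal_pos.2 (by positivity)).ne'] at h1
    exact lt_irrefl _ h1
  have hn2 : ∀ y, 0 ≤ y ^ 2 * g y := fun y => mul_nonneg (sq_nonneg y) (hgn y)
  have hm2 : Measurable fun y => y ^ 2 * g y := by fun_prop
  have hi : IntegrableOn (fun y => y ^ 2 * g y) (Ioi 0) :=
    (lintegral_ofReal_ne_top_iff_integrable hm2.aestronglyMeasurable (.of_forall hn2)).1 hfin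
  have hdim : Module.finrank ℝ E3 = 3 := by simp
  have hi3 : Integrable (fun ξ : E3 => g ‖ξ‖) :=
    (integrable_fun_norm_addHaar volume).2 (by rw [hdim]; exact hi)
  have hball : (volume : Measure E3).real (Metric.ball 0 1) = Real.pi * 4 / 3 := by
    rw [Measure.real, EuclideanSpace.volume_ball_fin_three]
    simp [ENNReal.toReal_ofReal (show 0 ≤ Real.pi * 4 / 3 by positivity)]
  change ∫⁻ ξ : E3, ENNReal.ofReal (g ‖ξ‖) = _
  rw [← ofReal_integral_eq_lintegral_ofReal hi3 (.of_forall fun ξ => hgn _),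
    integral_fun_norm_addHaar, hdim, hball, hT,
    ← ofReal_integral_eq_lintegral_ofReal hi (.of_forall hn2), ← ENNReal.ofReal_mul (by positivity),
    ← ENNReal.ofReal_mul (by positivity)]
  congr 1
  simp only [smul_eq_mul, nsmul_eq_mul, Nat.add_one_sub_one]
  push_cast
  field_simp
  ring

/-- Substitute `t = ρ² + c`. The range becomes `t > c`, but the integral may be taken over `t > 0`
because `1 / √(t - c)` is `0` for `t ≤ c`. A domain independent of `c` is what later permits
averaging over `c` under the integral. -/
theorem occTail_eq (c : ℝ) (hc : 0 ≤ c) :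
    occTail β μ c = ∫⁻ t in Ioi (0 : ℝ), ENNReal.ofReal (occ β μ t / 2) *
      ENNReal.ofReal (1 / √(t - c)) := by
  set G : ℝ → ℝ≥0∞ := fun t => ENNReal.ofReal (occ β μ t / 2) * ENNReal.ofReal (1 / √(t - c))
  have himg : (fun ρ : ℝ => ρ ^ 2 + c) '' Ioi 0 = Ioi c := by
    ext t
    constructor
    · rintro ⟨ρ, hρ, rfl⟩
      have : 0 < ρ := hρ
      simp only [mem_Ioi, lt_add_iff_pos_left]
      positivity
    · intro ht
      have ht' : 0 < t - c := sub_pos.2 ht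
      refine ⟨√(t - c), Real.sqrt_pos.2 ht', ?_⟩
      simp only [Real.sq_sqrt ht'.le, sub_add_cancel]
  have h := lintegral_image_eq_lintegral_abs_deriv_mul (s := Ioi (0 : ℝ))
    (f := fun ρ => ρ ^ 2 + c) (f' := fun ρ => 2 * ρ) measurableSet_Ioi
    (fun x _ => by simpa using (((hasDerivAt_id x).pow 2).add_const c).hasDerivWithinAt)
    (fun x hx y hy h => by
      have h' : x ^ 2 = y ^ 2 := by simpa using h
      exact (sq_eq_sq₀ (le_of_lt hx) (le_of_lt hy)).1 h') G
  rw [himg] at h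
  have e1 : ∫⁻ t in Ioi (0 : ℝ), G t = ∫⁻ t in Ioi c, G t := by
    rw [← lintegral_indicator measurableSet_Ioi, ← lintegral_indicator measurableSet_Ioi]
    congr 1
    ext t
    by_cases h1 : c < t
    · simp [indicator, h1, hc.trans_lt h1]
    · have : √(t - c) = 0 := Real.sqrt_eq_zero_of_nonpos (by linarith)
      simp [indicator, h1, G, this]
  rw [e1, h, occTail]
  refine setLIntegral_congr_fun measurableSet_Ioi fun ρ hρ => ?_
  have hρ' : 0 < ρ := hρ
  simp only [G]
  rw [add_sub_cancel_right, Real.sqrt_sq hρ'.le, abs_of_pos (by positivity),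
    ← ENNReal.ofReal_mul (div_nonneg (occ_pos _).le zero_le_two),
    ← ENNReal.ofReal_mul (by positivity)]
  congr 1
  field_simp

/-- The average of `occTail` over the Feynman parameter. -/
def occMean (β μ p : ℝ) : ℝ≥0∞ :=
  ∫⁻ v in Ioc (-(1 / 2) : ℝ) (1 / 2), occTail β μ (p ^ 2 * (1 / 4 - v ^ 2))

theorem feynman_nonneg (p : ℝ) {v : ℝ} (hv : v ∈ Ioc (-(1 / 2) : ℝ) (1 / 2)) :
    0 ≤ p ^ 2 * (1 / 4 - v ^ 2) := by
  have : v ^ 2 ≤ (1 / 2) ^ 2 := sq_le_sq' hv.1.le hv.2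
  exact mul_nonneg (sq_nonneg p) (by linarith)

theorem occMean_le (hβ : 0 < β) (p : ℝ) : occMean β μ p ≤ occTail β μ 0 := by
  calc occMean β μ p ≤ ∫⁻ v in Ioc (-(1 / 2) : ℝ) (1 / 2), occTail β μ 0 :=
        setLIntegral_mono measurable_const fun v hv => occTail_le hβ (feynman_nonneg p hv)
    _ = occTail β μ 0 := by
        rw [setLIntegral_const, Real.volume_Ioc]
        norm_num

theorem measurable_symbolIntegrand : Measurable fun q : ℝ × ℝ => symbolIntegrand β μ q.1 q.2 := by
  unfold symbolIntegrand
  refine Measurable.mul (Real.measurable_log.comp ?_) (by fun_prop)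
  have h : Measurable fun q : ℝ × ℝ => (√(4 * q.2) + q.1) / (√(4 * q.2) - q.1) :=
    Measurable.div (by fun_prop) (by fun_prop)
  exact measurable_norm.comp h

theorem symbolIntegrand_nonneg {p t : ℝ} (hp : 0 < p) : 0 ≤ symbolIntegrand β μ p t := by
  refine mul_nonneg ?_ (by positivity)
  rcases eq_or_ne (√(4 * t) - p) 0 with h | h
  · rw [h, div_zero, abs_zero, Real.log_zero]
  · refine Real.log_nonneg ?_
    rw [abs_div, one_le_div (abs_pos.2 h)]
    have := Real.sqrt_nonneg (4 * t)
    rw [abs_of_pos (by positivity : 0 < √(4 * t) + p), abs_le]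
    constructor <;> linarith

theorem occMean_eq {p : ℝ} (hp : 0 < p) :
    occMean β μ p = ∫⁻ t in Ioi (0 : ℝ), ENNReal.ofReal (symbolIntegrand β μ p t / (2 * p)) := by
  rw [occMean, setLIntegral_congr_fun measurableSet_Ioc
    fun v hv => occTail_eq _ (feynman_nonneg p hv), lintegral_lintegral_swap
      (Measurable.aemeasurable (by fun_prop))]
  -- The single energy at which the logarithm is singular.
  have hae : ∀ᵐ t ∂(volume : Measure ℝ), t ≠ p ^ 2 / 4 := by
    simp [ae_iff]
  refine setLIntegral_congr_fun_ae measurableSet_Ioi ?_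
  filter_upwards [hae] with t ht h0
  rw [lintegral_const_mul _ (by fun_prop), lintegral_inv_sqrt hp h0 ht,
    ← ENNReal.ofReal_mul (div_nonneg (occ_pos _).le zero_le_two)]
  congr 1
  rw [symbolIntegrand, ← occ]
  field_simp

/-- Up to the factor `2 p` the integral is `occMean`, an average of quantities bounded by the finite
number `occTail β μ 0`; no estimate of the logarithmic singularity is needed. -/
theorem integrableOn_symbolIntegrand (hβ : 0 < β) {p : ℝ} (hp : 0 < p) :
    IntegrableOn (symbolIntegrand β μ p) (Ioi 0) := by
  have hm : Measurable (symbolIntegrand β μ p) := measurable_symbolIntegrand.of_uncurry_left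
  have h : IntegrableOn (fun t => symbolIntegrand β μ p t / (2 * p)) (Ioi 0) := by
    refine (lintegral_ofReal_ne_top_iff_integrable (hm.div_const _).aestronglyMeasurable
      (.of_forall fun t => div_nonneg (symbolIntegrand_nonneg hp) (by positivity))).1 ?_
    rw [← occMean_eq hp]
    exact ((occMean_le hβ p).trans_lt (occTail_zero_lt_top hβ)).ne
  refine (h.mul_const (2 * p)).congr (.of_forall fun t => ?_)
  simp only
  field_simp

theorem symbol_eq {p : ℝ} (hp : 0 < p) :
    symbol β μ p = 1 / (4 * Real.pi ^ 2) * (occMean β μ p).toReal := by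
  have hm : Measurable (symbolIntegrand β μ p) := measurable_symbolIntegrand.of_uncurry_left
  rw [occMean_eq hp, ← integral_eq_lintegral_of_nonneg_ae
    (.of_forall fun t => div_nonneg (symbolIntegrand_nonneg hp) (by positivity))
    (hm.div_const _).aestronglyMeasurable, integral_div, symbol]
  field_simp
  ring

theorem ofReal_symbol (hβ : 0 < β) {p : ℝ} (hp : 0 < p) :
    ENNReal.ofReal (symbol β μ p) = ENNReal.ofReal (1 / (4 * Real.pi ^ 2)) * occMean β μ p := by
  rw [symbol_eq hp, ENNReal.ofReal_mul (by positivity), ENNReal.ofReal_toReal]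
  exact ((occMean_le hβ p).trans_lt (occTail_zero_lt_top hβ)).ne

theorem symbol_nonneg {p : ℝ} (hp : 0 ≤ p) : 0 ≤ symbol β μ p := by
  rcases hp.eq_or_lt with rfl | hp
  · simp [symbol]
  · rw [symbol_eq hp]
    positivity

theorem symbol_le (hβ : 0 < β) {p : ℝ} (hp : 0 ≤ p) :
    symbol β μ p ≤ 1 / (4 * Real.pi ^ 2) * (occTail β μ 0).toReal := by
  rcases hp.eq_or_lt with rfl | hp
  · simp only [symbol, mul_zero, div_zero, zero_mul]
    positivity
  · rw [symbol_eq hp]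
    gcongr
    · exact (occTail_zero_lt_top hβ).ne
    · exact occMean_le hβ p

theorem measurable_symbol : Measurable (symbol β μ) := by
  unfold symbol
  refine Measurable.mul (by fun_prop) ?_
  exact (measurable_symbolIntegrand.stronglyMeasurable.integral_prod_right
    (ν := volume.restrict (Ioi 0))).measurable

end

/-! ### The momentum integral of the difference quotient -/

section

open scoped ENNReal
variable {β μ : ℝ}

/-- Minus the difference quotient of the occupation number. -/
def occQuot (β μ s t : ℝ) : ℝ := -(occ β μ s - occ β μ t) / (s - t)

theorem occQuot_nonneg (hβ : 0 < β) (s t : ℝ) : 0 ≤ occQuot β μ s t := by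
  unfold occQuot
  rcases le_total s t with h | h
  · have := occ_antitone (μ := μ) hβ h
    exact div_nonneg_of_nonpos (by linarith) (by linarith)
  · have := occ_antitone (μ := μ) hβ h
    exact div_nonneg (by linarith) (by linarith)

/-- The fundamental theorem of calculus along the segment from `t` to `s`. The parameter is centred
at the midpoint so that the square completed afterwards depends on it only through `v²`. -/
theorem ofReal_occQuot (hβ : 0 < β) {s t : ℝ} (h : s ≠ t) :
    ENNReal.ofReal (occQuot β μ s t) = ∫⁻ v in Ioc (-(1 / 2) : ℝ) (1 / 2),
      ENNReal.ofReal (occSlope β μ ((1 / 2 + v) * s + (1 / 2 - v) * t)) := by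
  have hst : s - t ≠ 0 := sub_ne_zero.2 h
  have hc : Continuous fun v : ℝ => occSlope β μ ((1 / 2 + v) * s + (1 / 2 - v) * t) := by fun_prop
  have hd : ∀ v ∈ uIcc (-(1 / 2) : ℝ) (1 / 2),
      HasDerivAt (fun v => -occ β μ ((1 / 2 + v) * s + (1 / 2 - v) * t) / (s - t))
      (occSlope β μ ((1 / 2 + v) * s + (1 / 2 - v) * t)) v := by
    intro v _
    have h1 : HasDerivAt (fun v : ℝ => (1 / 2 + v) * s + (1 / 2 - v) * t) (s - t) v := by
      have := (((hasDerivAt_id v).const_add (1 / 2)).mul_const s).add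
        (((hasDerivAt_id v).const_sub (1 / 2)).mul_const t)
      refine this.congr_deriv ?_
      ring
    refine (((hasDerivAt_occ _).comp v h1).neg.div_const (s - t)).congr_deriv ?_
    field_simp
  have hi := hc.intervalIntegrable (μ := volume) (-(1 / 2)) (1 / 2)
  have e := intervalIntegral.integral_eq_sub_of_hasDerivAt hd hi
  rw [intervalIntegral.integral_of_le (by norm_num)] at e
  rw [← ofReal_integral_eq_lintegral_ofReal
    ((intervalIntegrable_iff_integrableOn_Ioc_of_le (by norm_num)).1 hi)
    (.of_forall fun v => occSlope_nonneg hβ _), e]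
  congr 1
  rw [occQuot]
  ring_nf

theorem measurable_occQuot {f g : E3 → ℝ} (hf : Measurable f) (hg : Measurable g) :
    Measurable fun ξ => occQuot β μ (f ξ) (g ξ) := by
  unfold occQuot
  exact Measurable.div (by fun_prop) (by fun_prop)

/-- The exceptional set is the perpendicular bisector of `0` and `l`, a proper affine subspace. On
it the two energies coincide and the difference quotient is undefined. -/
theorem ae_norm_ne_norm_sub {l : E3} (hl : l ≠ 0) : ∀ᵐ ξ : E3, ‖ξ‖ ≠ ‖ξ - l‖ := by
  rw [ae_iff]
  have h := Measure.addHaar_affineSubspace (volume : Measure E3)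
    (AffineSubspace.perpBisector (0 : E3) l)
    (by rw [Ne, AffineSubspace.perpBisector_eq_top]; exact hl.symm)
  convert h using 2
  ext ξ
  simp [AffineSubspace.mem_perpBisector_iff_dist_eq, dist_eq_norm]

theorem feynman_square (ξ l : E3) (v : ℝ) :
    (1 / 2 + v) * (2 * Real.pi * ‖ξ‖) ^ 2 + (1 / 2 - v) * (2 * Real.pi * ‖ξ - l‖) ^ 2 =
      (2 * Real.pi * ‖ξ - (1 / 2 - v) • l‖) ^ 2 + (2 * Real.pi * ‖l‖) ^ 2 * (1 / 4 - v ^ 2) := by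
  simp only [mul_pow, norm_sub_sq_real, norm_smul, real_inner_smul_right, Real.norm_eq_abs, sq_abs]
  ring

/-- After Tonelli the centre `(1/2 - v) l` of the completed square is removed by translation
invariance, leaving the radial integral of `lintegral_occSlope` with `c = p² (1/4 - v²)` and `p = 2π
‖l‖`; its average over `v` is `occMean`. -/
theorem lintegral_occQuot (hβ : 0 < β) {l : E3} (hl : l ≠ 0) :
    ∫⁻ ξ : E3, ENNReal.ofReal
      (occQuot β μ ((2 * Real.pi * ‖ξ‖) ^ 2) ((2 * Real.pi * ‖ξ - l‖) ^ 2)) =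
      ENNReal.ofReal (symbol β μ (2 * Real.pi * ‖l‖)) := by
  have hp : 0 < 2 * Real.pi * ‖l‖ := by positivity
  have e1 : ∀ᵐ ξ : E3, ENNReal.ofReal
      (occQuot β μ ((2 * Real.pi * ‖ξ‖) ^ 2) ((2 * Real.pi * ‖ξ - l‖) ^ 2)) =
      ∫⁻ v in Ioc (-(1 / 2) : ℝ) (1 / 2), ENNReal.ofReal (occSlope β μ
        ((2 * Real.pi * ‖ξ - (1 / 2 - v) • l‖) ^ 2 +
          (2 * Real.pi * ‖l‖) ^ 2 * (1 / 4 - v ^ 2))) := by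
    filter_upwards [ae_norm_ne_norm_sub hl] with ξ hξ
    rw [ofReal_occQuot hβ]
    · simp only [feynman_square]
    · intro h
      rw [sq_eq_sq₀ (by positivity) (by positivity)] at h
      exact hξ (mul_left_cancel₀ (by positivity) h)
  rw [lintegral_congr_ae e1, lintegral_lintegral_swap (Measurable.aemeasurable (by fun_prop)),
    ofReal_symbol hβ hp, occMean, ← lintegral_const_mul' _ _ ENNReal.ofReal_ne_top]
  refine setLIntegral_congr_fun measurableSet_Ioc fun v hv => ?_
  rw [← lintegral_occSlope hβ (feynman_nonneg _ hv)]
  exact lintegral_sub_right_eq_self (fun ξ : E3 => ENNReal.ofReal (occSlope β μ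
    ((2 * Real.pi * ‖ξ‖) ^ 2 + (2 * Real.pi * ‖l‖) ^ 2 * (1 / 4 - v ^ 2)))) ((1 / 2 - v) • l)

theorem integral_occQuot (hβ : 0 < β) {l : E3} (hl : l ≠ 0) :
    ∫ ξ : E3, occQuot β μ ((2 * Real.pi * ‖ξ‖) ^ 2) ((2 * Real.pi * ‖ξ - l‖) ^ 2) =
      symbol β μ (2 * Real.pi * ‖l‖) := by
  rw [integral_eq_lintegral_of_nonneg_ae (.of_forall fun ξ => occQuot_nonneg hβ _ _)
    (measurable_occQuot (by fun_prop) (by fun_prop)).aestronglyMeasurable, lintegral_occQuot hβ hl,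
    ENNReal.toReal_ofReal (symbol_nonneg (by positivity))]

end

/-! ### The contour as a measure, and bounds for the Fermi–Dirac function -/

section

/-- The arc length measure of the contour. -/
def contourMeasure (a α : ℝ) : Measure ℂ :=
  (volume.restrict (Ioi (-a))).map (fun t : ℝ => (t + α * Complex.I : ℂ)) +
    (volume.restrict (Ioc (-α) α)).map (fun s : ℝ => (-a + s * Complex.I : ℂ)) +
    (volume.restrict (Ioi (-a))).map (fun t : ℝ => (t - α * Complex.I : ℂ))

/-- The direction of travel along the contour. -/
def dir (α : ℝ) (z : ℂ) : ℂ :=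
  if z.im = α then -1 else if z.im = -α then 1 else -Complex.I

theorem measurable_dir (α : ℝ) : Measurable (dir α) := by
  unfold dir
  refine Measurable.ite ?_ measurable_const (Measurable.ite ?_ measurable_const measurable_const)
  · exact (measurableSet_singleton α).preimage Complex.measurable_im
  · exact (measurableSet_singleton (-α)).preimage Complex.measurable_im

theorem norm_dir (α : ℝ) (z : ℂ) : ‖dir α z‖ = 1 := by
  unfold dir
  split_ifs <;> simp

instance (a α : ℝ) : SFinite (contourMeasure a α) := by
  unfold contourMeasure; infer_instance

theorem measurableEmbedding_add (α : ℝ) :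
    MeasurableEmbedding (fun t : ℝ => (t + α * Complex.I : ℂ)) :=
  Continuous.measurableEmbedding (by fun_prop) fun s t h => by simpa using congrArg Complex.re h

theorem measurableEmbedding_sub (α : ℝ) :
    MeasurableEmbedding (fun t : ℝ => (t - α * Complex.I : ℂ)) :=
  Continuous.measurableEmbedding (by fun_prop) fun s t h => by simpa using congrArg Complex.re h

theorem measurableEmbedding_left (a : ℝ) :
    MeasurableEmbedding (fun s : ℝ => (-a + s * Complex.I : ℂ)) :=
  Continuous.measurableEmbedding (by fun_prop) fun s t h => by simpa using congrArg Complex.im h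

variable {V : Type*} [NormedAddCommGroup V]

theorem integrable_contour_iff {a α : ℝ} {G : ℂ → V} : Integrable G (contourMeasure a α) ↔
    IntegrableOn (fun t : ℝ => G (t + α * Complex.I)) (Ioi (-a)) ∧
    IntegrableOn (fun s : ℝ => G (-a + s * Complex.I)) (Ioc (-α) α) ∧
    IntegrableOn (fun t : ℝ => G (t - α * Complex.I)) (Ioi (-a)) := by
  rw [contourMeasure, integrable_add_measure, integrable_add_measure,
    (measurableEmbedding_add α).integrable_map_iff, (measurableEmbedding_left a).integrable_map_iff,
    (measurableEmbedding_sub α).integrable_map_iff, and_assoc]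
  rfl

theorem integrable_dir_smul_iff [NormedSpace ℂ V] {a α : ℝ} {G : ℂ → V} :
    Integrable (fun z => dir α z • G z) (contourMeasure a α) ↔
      Integrable G (contourMeasure a α) := by
  have hinv : ∀ z, (dir α z)⁻¹ • dir α z • G z = G z := fun z =>
    inv_smul_smul₀ (norm_ne_zero_iff.1 (by rw [norm_dir]; exact one_ne_zero)) _
  constructor
  · intro h
    exact h.mono (((measurable_dir α).inv.aestronglyMeasurable.smul h.1).congr (.of_forall hinv))
      (.of_forall fun z => by rw [norm_smul, norm_dir, one_mul])
  · intro h
    exact h.mono ((measurable_dir α).aestronglyMeasurable.smul h.1)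
      (.of_forall fun z => by rw [norm_smul, norm_dir, one_mul])

theorem integral_contour [NormedSpace ℂ V] {a α : ℝ} (hα : 0 < α) {G : ℂ → V}
    (hG : Integrable G (contourMeasure a α)) :
    ∫ z, dir α z • G z ∂contourMeasure a α =
      -(∫ t in Ioi (-a), G (t + α * Complex.I))
        - Complex.I • (∫ s in Ioc (-α) α, G (-a + s * Complex.I))
        + ∫ t in Ioi (-a), G (t - α * Complex.I) := by
  have h := integrable_dir_smul_iff.2 hG
  rw [contourMeasure] at h ⊢
  obtain ⟨h12, h3⟩ := integrable_add_measure.1 h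
  obtain ⟨h1, h2⟩ := integrable_add_measure.1 h12
  rw [integral_add_measure h12 h3, integral_add_measure h1 h2,
    (measurableEmbedding_add α).integral_map, (measurableEmbedding_left a).integral_map,
    (measurableEmbedding_sub α).integral_map, sub_eq_add_neg, ← integral_neg, ← neg_smul,
    ← integral_smul]
  congr 1
  · congr 1
    · refine integral_congr_ae (.of_forall fun t => ?_)
      simp [dir]
    · refine integral_congr_ae ?_
      -- `dir` assigns the corners to the horizontal edges. The upper one has to be discarded as a
      -- null set; the lower one is not in `Ioc`.
      have h4 : ∀ᵐ s : ℝ ∂volume.restrict (Ioc (-α) α), s ≠ α :=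
        (Measure.ae_ne volume α).filter_mono (ae_mono Measure.restrict_le_self)
      filter_upwards [ae_restrict_mem measurableSet_Ioc, h4] with s hs hs'
      have h5 : s ≠ -α := hs.1.ne'
      simp [dir, hs', h5]
  · refine integral_congr_ae (.of_forall fun t => ?_)
    have : -α ≠ α := by linarith
    simp [dir, this]

/-- Turns the three-edge integral into one Bochner integral, so that Fubini and domination apply to
the whole contour at once. -/
theorem hasContourIntegral_iff {a α : ℝ} (hα : 0 < α) {G : ℂ → L2 →L[ℂ] L2} {J : L2 →L[ℂ] L2} :
    HasContourIntegral a α G J ↔ Integrable G (contourMeasure a α) ∧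
      J = ∫ z, dir α z • G z ∂contourMeasure a α := by
  constructor
  · rintro ⟨h1, h2, h3, h4⟩
    have h := integrable_contour_iff.2 ⟨h1, h2, h3⟩
    exact ⟨h, h4.trans (integral_contour hα h).symm⟩
  · rintro ⟨h, h4⟩
    obtain ⟨h1, h2, h3⟩ := integrable_contour_iff.1 h
    exact ⟨h1, h2, h3, h4.trans (integral_contour hα h)⟩

theorem ae_mem_contour {a α : ℝ} (hα : 0 < α) : ∀ᵐ z ∂contourMeasure a α, z ∈ contour a α := by
  have hm : MeasurableSet (contour a α) := by
    unfold contour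
    have h1 := Complex.measurable_re
    have h2 : Measurable fun z : ℂ => |z.im| := by fun_prop
    exact ((measurableSet_le measurable_const h1).inter
      (measurableSet_eq_fun h2 measurable_const)).union
      ((measurableSet_eq_fun h1 measurable_const).inter (measurableSet_le h2 measurable_const))
  rw [contourMeasure, ae_add_measure_iff, ae_add_measure_iff,
    (measurableEmbedding_add α).ae_map_iff, (measurableEmbedding_left a).ae_map_iff,
    (measurableEmbedding_sub α).ae_map_iff]
  refine ⟨⟨?_, ?_⟩, ?_⟩
  · filter_upwards [ae_restrict_mem measurableSet_Ioi] with t ht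
    exact Or.inl ⟨by simpa using ht.le, by simp [abs_of_pos hα]⟩
  · filter_upwards [ae_restrict_mem measurableSet_Ioc] with s hs
    exact Or.inr ⟨by simp, by simpa using abs_le.2 ⟨hs.1.le, hs.2⟩⟩
  · filter_upwards [ae_restrict_mem measurableSet_Ioi] with t ht
    exact Or.inl ⟨by simpa using ht.le, by simp [abs_of_pos hα]⟩

/-- The Fermi–Dirac function at inverse temperature `β` and chemical potential `μ`. -/
def fermi (β μ : ℝ) (z : ℂ) : ℂ := fermiDirac (β * (z - μ))

section FermiBounds

variable {β μ a α : ℝ}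

/-- With `r = e^{-Re w}`, the squared modulus is `1 + 2 r cos (Im w) + r² ≥ (r + cos θ)² + sin² θ`.
This keeps the strip `|Im w| ≤ θ` uniformly away from the poles. -/
theorem sin_le_norm_one_add_exp_neg {θ : ℝ} (h0 : 0 < θ) (hθ : θ < Real.pi) {w : ℂ}
    (hw : |w.im| ≤ θ) : Real.sin θ ≤ ‖1 + Complex.exp (-w)‖ := by
  have hs : 0 < Real.sin θ := Real.sin_pos_of_pos_of_lt_pi h0 hθ
  have hc : Real.cos θ ≤ Real.cos w.im := by
    rw [← Real.cos_abs w.im]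
    exact Real.cos_le_cos_of_nonneg_of_le_pi (abs_nonneg _) hθ.le hw
  have he : 0 < Real.exp (-w.re) := Real.exp_pos _
  refine abs_le_of_sq_le_sq' ?_ (norm_nonneg _) |>.2
  rw [← Complex.normSq_eq_norm_sq, Complex.normSq_apply]
  simp only [Complex.add_re, Complex.one_re, Complex.exp_re, Complex.neg_re, Complex.neg_im,
    Real.cos_neg, Complex.add_im, Complex.one_im, Complex.exp_im, Real.sin_neg, zero_add]
  have h1 := Real.sin_sq_add_cos_sq w.im
  have h2 := Real.sin_sq_add_cos_sq θ
  have e1 : (1 + Real.exp (-w.re) * Real.cos w.im) * (1 + Real.exp (-w.re) * Real.cos w.im) +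
      Real.exp (-w.re) * -Real.sin w.im * (Real.exp (-w.re) * -Real.sin w.im) =
      1 + 2 * (Real.exp (-w.re) * Real.cos w.im) +
        Real.exp (-w.re) ^ 2 * (Real.sin w.im ^ 2 + Real.cos w.im ^ 2) := by ring
  rw [e1, h1]
  nlinarith [mul_le_mul_of_nonneg_left hc he.le, sq_nonneg (Real.exp (-w.re) + Real.cos θ)]

theorem one_add_exp_ne_zero {w : ℂ} (hw : |w.im| < Real.pi) : 1 + Complex.exp w ≠ 0 := by
  obtain ⟨θ, h1, h2⟩ := exists_between hw
  have := sin_le_norm_one_add_exp_neg ((abs_nonneg _).trans_lt h1) h2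
    (w := -w) (by rw [Complex.neg_im, abs_neg]; exact h1.le)
  rw [neg_neg] at this
  exact norm_pos_iff.1
    ((Real.sin_pos_of_pos_of_lt_pi ((abs_nonneg _).trans_lt h1) h2).trans_le this)

theorem norm_fermiDirac_le {θ : ℝ} (h0 : 0 < θ) (hθ : θ < Real.pi) {w : ℂ}
    (hw : |w.im| ≤ θ) : ‖fermiDirac w‖ ≤ (Real.sin θ)⁻¹ * Real.exp (-w.re) := by
  have h := sin_le_norm_one_add_exp_neg h0 hθ hw
  have hs : 0 < Real.sin θ := Real.sin_pos_of_pos_of_lt_pi h0 hθ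
  have e : fermiDirac w = Complex.exp (-w) * (1 + Complex.exp (-w))⁻¹ := by
    have h1 := one_add_exp_ne_zero (hw.trans_lt hθ)
    have h2 : 1 + Complex.exp (-w) ≠ 0 := norm_pos_iff.1 (hs.trans_le h)
    unfold fermiDirac
    rw [one_div, inv_eq_iff_eq_inv, mul_inv, inv_inv, ← Complex.exp_neg, neg_neg, mul_add, mul_one,
      ← Complex.exp_add, add_neg_cancel, Complex.exp_zero, add_comm]
  rw [e, norm_mul, norm_inv, Complex.norm_exp, Complex.neg_re, mul_comm]
  gcongr

theorem norm_fermi_le (hβ : 0 < β) (hα : 0 < α) (h : α * β < Real.pi) {z : ℂ}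
    (hz : |z.im| ≤ α) :
    ‖fermi β μ z‖ ≤ (Real.sin (α * β))⁻¹ * Real.exp (β * μ) * Real.exp (-β * z.re) := by
  have := norm_fermiDirac_le (by positivity) h (w := β * (z - μ))
    (by simp only [Complex.mul_im, Complex.ofReal_re, Complex.ofReal_im, Complex.sub_im]
        rw [zero_mul, add_zero, sub_zero, abs_mul, abs_of_pos hβ, mul_comm]
        gcongr)
  refine this.trans_eq ?_
  rw [mul_assoc, ← Real.exp_add]
  congr 2
  simp
  ring

theorem differentiableAt_fermi (hβ : 0 < β) {z : ℂ} (h : |z.im| * β < Real.pi) :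
    DifferentiableAt ℂ (fermi β μ) z := by
  unfold fermi fermiDirac
  have : (1 + Complex.exp (β * (z - μ))) ≠ 0 := by
    apply one_add_exp_ne_zero
    simpa [abs_mul, abs_of_pos hβ, mul_comm] using h
  fun_prop (disch := assumption)

theorem measurable_fermi : Measurable (fermi β μ) := by
  unfold fermi fermiDirac
  fun_prop

theorem abs_im_le_of_mem_contour (hα : 0 < α) {z : ℂ} (hz : z ∈ contour a α) : |z.im| ≤ α :=
  hz.elim (fun h => h.2.le) fun h => h.2

theorem neg_le_re_of_mem_contour {z : ℂ} (hz : z ∈ contour a α) : -a ≤ z.re :=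
  hz.elim (fun h => h.1) fun h => h.1.ge

/-- On the contour the Fermi–Dirac function decays exponentially. -/
theorem exists_norm_fermi_weight_le (hβ : 0 < β) (ha : 0 < a) (hα : 0 < α)
    (h : α * β < Real.pi) : ∃ K : ℝ, ∀ z ∈ contour a α,
      (1 + ‖z‖) ^ 2 * ‖fermi β μ z‖ ≤ K * Real.exp (-(β / 2) * z.re) := by
  -- `c` absorbs the bounded imaginary part and the shift by `a`, so that `1 + ‖z‖ ≤ c (1 + y)` with
  -- `y = Re z + a ≥ 0`. The square of `1 + y` is paid for with half of the decay rate `β`.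
  set c := 1 + α + a
  set A := (Real.sin (α * β))⁻¹ * Real.exp (β * μ)
  have hA : 0 ≤ A := by
    have : 0 < Real.sin (α * β) := Real.sin_pos_of_pos_of_lt_pi (by positivity) h
    positivity
  refine ⟨(c * (1 + 4 / β)) ^ 2 * A * Real.exp (β / 2 * a), fun z hz => ?_⟩
  have h1 : 0 ≤ z.re + a := by linarith [neg_le_re_of_mem_contour hz]
  set y := z.re + a with hy
  have h2 : 1 + ‖z‖ ≤ c * (1 + y) := by
    have h3 := Complex.norm_le_abs_re_add_abs_im z
    have h4 := abs_im_le_of_mem_contour hα hz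
    have h5 : |z.re| ≤ y + a := abs_le.2 ⟨by linarith, by linarith⟩
    simp only [c]
    nlinarith
  have h3 : 1 + y ≤ (1 + 4 / β) * Real.exp (β / 4 * y) := by
    have h4 := Real.add_one_le_exp (β / 4 * y)
    have h5 : 1 ≤ Real.exp (β / 4 * y) := Real.one_le_exp (by positivity)
    have h6 : y = 4 / β * (β / 4 * y) := by field_simp
    have h7 : y ≤ 4 / β * Real.exp (β / 4 * y) := by
      nth_rewrite 1 [h6]
      gcongr
      linarith
    linarith
  have h4 : (1 + ‖z‖) ^ 2 ≤ (c * (1 + 4 / β)) ^ 2 * Real.exp (β / 2 * y) := by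
    have h5 : Real.exp (β / 2 * y) = Real.exp (β / 4 * y) ^ 2 := by
      rw [← Real.exp_nat_mul]
      congr 1
      push_cast
      ring
    rw [h5, ← mul_pow]
    gcongr
    calc _ ≤ c * (1 + y) := h2
      _ ≤ c * ((1 + 4 / β) * Real.exp (β / 4 * y)) := by
        gcongr
      _ = _ := by ring
  calc _ ≤ ((c * (1 + 4 / β)) ^ 2 * Real.exp (β / 2 * y)) * (A * Real.exp (-β * z.re)) := by
        gcongr
        exact norm_fermi_le hβ hα h (abs_im_le_of_mem_contour hα hz)
    _ = (c * (1 + 4 / β)) ^ 2 * A * (Real.exp (β / 2 * y) * Real.exp (-β * z.re)) := by ring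
    _ = (c * (1 + 4 / β)) ^ 2 * A * (Real.exp (β / 2 * a) * Real.exp (-(β / 2) * z.re)) := by
        rw [← Real.exp_add, ← Real.exp_add, hy]
        congr 2
        ring
    _ = _ := by ring

theorem integrable_exp_contour {b : ℝ} (hb : 0 < b) :
    Integrable (fun z : ℂ => Real.exp (-b * z.re)) (contourMeasure a α) := by
  rw [integrable_contour_iff]
  have h := integrableOn_exp_mul_Ioi (neg_neg_of_pos hb) (-a)
  refine ⟨by simpa using h, ?_, by simpa using h⟩
  simp

/-- The square of `1 + ‖z‖` is what a product of two Hilbert–Schmidt factors `χ R` and `φ R` costs.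
-/
theorem integrable_fermi_weight (hβ : 0 < β) (ha : 0 < a) (hα : 0 < α) (h : α * β < Real.pi) :
    Integrable (fun z => (1 + ‖z‖) ^ 2 * ‖fermi β μ z‖) (contourMeasure a α) := by
  obtain ⟨K, hK⟩ := exists_norm_fermi_weight_le (μ := μ) hβ ha hα h
  refine ((integrable_exp_contour (half_pos hβ)).const_mul K).mono' ?_ ?_
  · have := measurable_fermi (β := β) (μ := μ)
    exact Measurable.aestronglyMeasurable (by fun_prop)
  · filter_upwards [ae_mem_contour hα] with z hz
    rw [Real.norm_of_nonneg (by positivity)]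
    exact hK z hz

end FermiBounds

end

/-! ### Cauchy's formula on a rectangle -/

section

open Complex in
theorem integral_div_sq_add_sq (B p q : ℝ) (hB : B ≠ 0) :
    ∫ y in p..q, B / (B ^ 2 + y ^ 2) = Real.arctan (q / B) - Real.arctan (p / B) := by
  have hne : ∀ y : ℝ, B ^ 2 + y ^ 2 ≠ 0 := fun y => by positivity
  refine intervalIntegral.integral_eq_sub_of_hasDerivAt (f := fun y => Real.arctan (y / B))
    (fun y _ => ?_) (Continuous.intervalIntegrable
      (continuous_const.div (by fun_prop) hne) _ _)
  have h : HasDerivAt (fun y => Real.arctan (y / B)) (1 / (1 + (y / B) ^ 2) * (1 / B)) y :=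
    ((hasDerivAt_id y).div_const B).arctan
  have e : B / (B ^ 2 + y ^ 2) = 1 / (1 + (y / B) ^ 2) * (1 / B) := by
    have := hne y
    field_simp
  rw [e]
  exact h

/-- Symmetrizing in `y ↦ -y` cancels the imaginary part and leaves the arctangent integrand. Both
signs of `B` are needed, for the right and the left edge. -/
theorem integral_inv_add_mul_I (B α : ℝ) (hB : B ≠ 0) :
    ∫ y in (-α)..α, (B + y * Complex.I : ℂ)⁻¹ = 2 * Real.arctan (α / B) := by
  have hne : ∀ y : ℝ, (B + y * Complex.I : ℂ) ≠ 0 := fun y h => hB (by simpa using congrArg Complex.re h)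
  have hi : IntervalIntegrable (fun y : ℝ => (B + y * Complex.I : ℂ)⁻¹) volume (-α) α :=
    Continuous.intervalIntegrable (Continuous.inv₀ (by fun_prop) hne) _ _
  have h1 := intervalIntegral.integral_comp_neg (a := -α) (b := α)
    (fun y : ℝ => (B + y * Complex.I : ℂ)⁻¹)
  rw [neg_neg] at h1
  have hi' : IntervalIntegrable (fun y : ℝ => (B + (-y : ℝ) * Complex.I : ℂ)⁻¹) volume (-α) α :=
    Continuous.intervalIntegrable (Continuous.inv₀ (by fun_prop) fun y => hne (-y)) _ _
  have h2 : ∫ y in (-α)..α, ((B + y * Complex.I : ℂ)⁻¹ + (B + (-y : ℝ) * Complex.I : ℂ)⁻¹) =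
      ∫ y in (-α)..α, ((2 * (B / (B ^ 2 + y ^ 2)) : ℝ) : ℂ) := by
    refine intervalIntegral.integral_congr fun y _ => ?_
    have h3 := hne y
    have h4 := hne (-y)
    have h5 : (B ^ 2 + y ^ 2 : ℂ) = (B + y * Complex.I) * (B + (-y : ℝ) * Complex.I) := by
      push_cast
      linear_combination (y : ℂ) ^ 2 * Complex.I_sq
    push_cast at h4 h5 ⊢
    rw [h5]
    have h6 : (B - y * Complex.I : ℂ) ≠ 0 := by rwa [neg_mul, ← sub_eq_add_neg] at h4
    rw [neg_mul, ← sub_eq_add_neg]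
    field_simp
    ring
  rw [intervalIntegral.integral_add hi hi', h1, intervalIntegral.integral_ofReal,
    intervalIntegral.integral_const_mul, integral_div_sq_add_sq B _ _ hB, neg_div,
    Real.arctan_neg] at h2
  push_cast at h2 ⊢
  linear_combination h2 / 2

/-- The winding number of a rectangle around an interior real point. -/
theorem integral_rect_inv {A B α : ℝ} (hA : 0 < A) (hB : 0 < B) (hα : 0 < α) :
    (∫ x in (-A)..B, (x - α * Complex.I : ℂ)⁻¹) - (∫ x in (-A)..B, (x + α * Complex.I : ℂ)⁻¹) +
      Complex.I * (∫ y in (-α)..α, (B + y * Complex.I : ℂ)⁻¹) -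
      Complex.I * (∫ y in (-α)..α, (-A + y * Complex.I : ℂ)⁻¹) = 2 * Real.pi * Complex.I := by
  have hne : ∀ (s : ℝ), s ≠ 0 → ∀ x : ℝ, (x + s * Complex.I : ℂ) ≠ 0 := fun s hs x h =>
    hs (by simpa using congrArg Complex.im h)
  have hne1 := hne α hα.ne'
  have hne2 : ∀ x : ℝ, (x - α * Complex.I : ℂ) ≠ 0 := fun x => by
    have := hne (-α) (by linarith) x
    push_cast at this
    rwa [neg_mul, ← sub_eq_add_neg] at this
  have h1 : (∫ x in (-A)..B, (x - α * Complex.I : ℂ)⁻¹) -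
      (∫ x in (-A)..B, (x + α * Complex.I : ℂ)⁻¹) =
      2 * Complex.I * (Real.arctan (B / α) + Real.arctan (A / α)) := by
    rw [← intervalIntegral.integral_sub]
    · have h2 : ∫ x in (-A)..B, ((x - α * Complex.I : ℂ)⁻¹ - (x + α * Complex.I : ℂ)⁻¹) =
          ∫ x in (-A)..B, 2 * Complex.I * ((α / (α ^ 2 + x ^ 2) : ℝ) : ℂ) := by
        refine intervalIntegral.integral_congr fun x _ => ?_
        have h3 := hne1 x
        have h4 := hne2 x
        have h5 : (α ^ 2 + x ^ 2 : ℂ) = (x - α * Complex.I) * (x + α * Complex.I) := by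
          linear_combination (α : ℂ) ^ 2 * Complex.I_sq
        push_cast
        rw [h5]
        field_simp
        ring
      rw [h2, intervalIntegral.integral_const_mul, intervalIntegral.integral_ofReal,
        integral_div_sq_add_sq α _ _ hα.ne', neg_div, Real.arctan_neg]
      push_cast
      ring
    · exact Continuous.intervalIntegrable (Continuous.inv₀ (by fun_prop) hne2) _ _
    · exact Continuous.intervalIntegrable (Continuous.inv₀ (by fun_prop) hne1) _ _
  have h2 := integral_inv_add_mul_I B α hB.ne'
  have h3 := integral_inv_add_mul_I (-A) α (by linarith)
  rw [div_neg, Real.arctan_neg] at h3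
  simp only [Complex.ofReal_neg] at h3
  -- The angles subtended by adjacent half-edges add up to a right angle; collecting them around the
  -- rectangle gives `2π`.
  have h4 : Real.arctan (B / α) + Real.arctan (α / B) = Real.pi / 2 := by
    rw [← inv_div α B, Real.arctan_inv_of_pos (by positivity)]
    ring
  have h5 : Real.arctan (A / α) + Real.arctan (α / A) = Real.pi / 2 := by
    rw [← inv_div α A, Real.arctan_inv_of_pos (by positivity)]
    ring
  rw [h1, h2, h3]
  have h4' : (Real.arctan (B / α) + Real.arctan (α / B) : ℂ) = Real.pi / 2 := by exact_mod_cast h4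
  have h5' : (Real.arctan (A / α) + Real.arctan (α / A) : ℂ) = Real.pi / 2 := by exact_mod_cast h5
  push_cast at h4' h5' ⊢
  linear_combination 2 * Complex.I * h4' + 2 * Complex.I * h5'

/-- Cauchy's integral formula for a rectangle symmetric about the real axis. -/
theorem integral_rect_cauchy {F : ℂ → ℂ} {a N α c : ℝ} (hc1 : -a < c) (hc2 : c < N) (hα : 0 < α)
    {U : Set ℂ} (hU : IsOpen U) (hF : DifferentiableOn ℂ F U)
    (hsub : uIcc (-a) N ×ℂ uIcc (-α) α ⊆ U) :
    (∫ x in (-a)..N, F (x - α * Complex.I) * (x - α * Complex.I - c)⁻¹) -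
      (∫ x in (-a)..N, F (x + α * Complex.I) * (x + α * Complex.I - c)⁻¹) +
      Complex.I * (∫ y in (-α)..α, F (N + y * Complex.I) * (N + y * Complex.I - c)⁻¹) -
      Complex.I * (∫ y in (-α)..α, F (-a + y * Complex.I) * (-a + y * Complex.I - c)⁻¹) =
      2 * Real.pi * Complex.I * F c := by
  have hcU : (c : ℂ) ∈ U := hsub ⟨by
    rw [mem_preimage, Complex.ofReal_re, uIcc_of_le (by linarith)]; exact ⟨hc1.le, hc2.le⟩, by
    rw [mem_preimage, Complex.ofReal_im, uIcc_of_le (by linarith)]; constructor <;> linarith⟩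
  -- The pole is removed: `(F z - F c) / (z - c)` extends holomorphically, so its boundary integral
  -- vanishes, and only `F c` times the winding integral survives.
  have hd : DifferentiableOn ℂ (dslope F c) U :=
    (Complex.differentiableOn_dslope (hU.mem_nhds hcU)).2 hF
  have h0 := Complex.integral_boundary_rect_eq_zero_of_differentiableOn (dslope F c)
    (-a - α * Complex.I) (N + α * Complex.I) (hd.mono (by simpa using hsub))
  have hds : ∀ z : ℂ, z ≠ c → dslope F c z = F z * (z - c)⁻¹ - F c * (z - c)⁻¹ := by
    intro z hz
    rw [dslope_of_ne _ hz, slope_def_field, div_eq_mul_inv, sub_mul]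
  have hFc : ContinuousOn F U := hF.continuousOn
  have hsplit : ∀ (γ : ℝ → ℂ) (p q : ℝ), Continuous γ → (∀ t ∈ uIcc p q, γ t ∈ U) →
      (∀ t, γ t ≠ c) → ∫ t in p..q, dslope F c (γ t) =
        (∫ t in p..q, F (γ t) * (γ t - c)⁻¹) - F c * ∫ t in p..q, (γ t - c)⁻¹ := by
    intro γ p q hγ hγU hγc
    have hinv : Continuous fun t => (γ t - c)⁻¹ :=
      Continuous.inv₀ (by fun_prop) fun t => sub_ne_zero.2 (hγc t)
    rw [← intervalIntegral.integral_const_mul, ← intervalIntegral.integral_sub]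
    · exact intervalIntegral.integral_congr fun t _ => hds _ (hγc t)
    · exact ContinuousOn.intervalIntegrable
        ((hFc.comp hγ.continuousOn hγU).mul hinv.continuousOn)
    · exact (continuous_const.mul hinv).intervalIntegrable _ _
  have hmem : ∀ x y : ℝ, x ∈ uIcc (-a) N → y ∈ uIcc (-α) α → (x + y * Complex.I : ℂ) ∈ U :=
    fun x y hx hy => hsub ⟨by simpa using hx, by simpa using hy⟩
  have hs1 := hsplit (fun x => x - α * Complex.I) (-a) N (by fun_prop)
    (fun x hx => by
      have := hmem x (-α) hx left_mem_uIcc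
      push_cast at this
      rwa [neg_mul, ← sub_eq_add_neg] at this)
    (fun x h => hα.ne' (by simpa using congrArg Complex.im h))
  have hs2 := hsplit (fun x => x + α * Complex.I) (-a) N (by fun_prop)
    (fun x hx => hmem x α hx right_mem_uIcc)
    (fun x h => hα.ne' (by simpa using congrArg Complex.im h))
  have hs3 := hsplit (fun y => N + y * Complex.I) (-α) α (by fun_prop)
    (fun y hy => hmem N y right_mem_uIcc hy)
    (fun x h => hc2.ne' (by simpa using congrArg Complex.re h))
  have hs4 := hsplit (fun y => -a + y * Complex.I) (-α) α (by fun_prop)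
    (fun y hy => by simpa using hmem (-a) y left_mem_uIcc hy)
    (fun x h => hc1.ne (by simpa using congrArg Complex.re h))
  have hw := integral_rect_inv (A := a + c) (B := N - c) (by linarith) (by linarith) hα
  have e1 : ∫ x in (-a)..N, (x - α * Complex.I - c : ℂ)⁻¹ =
      ∫ x in (-(a + c))..(N - c), (x - α * Complex.I : ℂ)⁻¹ := by
    rw [show -(a + c) = -a - c by ring, ← intervalIntegral.integral_comp_sub_right
      (fun x : ℝ => (x - α * Complex.I : ℂ)⁻¹) c]
    refine intervalIntegral.integral_congr fun x _ => ?_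
    push_cast
    ring_nf
  have e2 : ∫ x in (-a)..N, (x + α * Complex.I - c : ℂ)⁻¹ =
      ∫ x in (-(a + c))..(N - c), (x + α * Complex.I : ℂ)⁻¹ := by
    rw [show -(a + c) = -a - c by ring, ← intervalIntegral.integral_comp_sub_right
      (fun x : ℝ => (x + α * Complex.I : ℂ)⁻¹) c]
    refine intervalIntegral.integral_congr fun x _ => ?_
    push_cast
    ring_nf
  have e3 : ∫ y in (-α)..α, (N + y * Complex.I - c : ℂ)⁻¹ =
      ∫ y in (-α)..α, ((N - c : ℝ) + y * Complex.I : ℂ)⁻¹ := by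
    refine intervalIntegral.integral_congr fun x _ => ?_
    push_cast
    ring_nf
  have e4 : ∫ y in (-α)..α, (-a + y * Complex.I - c : ℂ)⁻¹ =
      ∫ y in (-α)..α, (-(a + c : ℝ) + y * Complex.I : ℂ)⁻¹ := by
    refine intervalIntegral.integral_congr fun x _ => ?_
    push_cast
    ring_nf
  rw [← e1, ← e2, ← e3, ← e4] at hw
  simp only [Complex.sub_re, Complex.neg_re, Complex.ofReal_re, Complex.mul_re, Complex.I_re,
    mul_zero, Complex.ofReal_im, Complex.I_im, mul_one, sub_self, sub_zero, Complex.sub_im,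
    Complex.neg_im, Complex.mul_im, add_zero, Complex.add_re, Complex.add_im,
    zero_add, neg_zero, zero_sub, smul_eq_mul, Complex.ofReal_neg, neg_mul,
    ← sub_eq_add_neg] at h0
  rw [hs1, hs2, hs3, hs4] at h0
  linear_combination h0 + F c * hw

end

/-! ### Cauchy's formula on the half-infinite contour -/

section

variable {β μ a α : ℝ}

theorem norm_inv_contour_sub_le {c : ℝ} (ha : 0 < a) (hα : 0 < α) (hc : 0 ≤ c) {z : ℂ}
    (hz : z ∈ contour a α) : ‖(z - c)⁻¹‖ ≤ (min a α)⁻¹ := by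
  rw [norm_inv]
  refine inv_anti₀ (lt_min ha hα) ?_
  rcases hz with ⟨_, h⟩ | ⟨h, _⟩
  · refine (min_le_right a α).trans ?_
    have := Complex.abs_im_le_norm (z - c)
    rwa [Complex.sub_im, Complex.ofReal_im, sub_zero, h] at this
  · refine (min_le_left a α).trans ?_
    have := Complex.abs_re_le_norm (z - c)
    rw [Complex.sub_re, Complex.ofReal_re, h] at this
    refine le_trans ?_ this
    rw [abs_of_nonpos (by linarith)]
    linarith

theorem integrable_fermi (hβ : 0 < β) (ha : 0 < a) (hα : 0 < α) (h : α * β < Real.pi) :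
    Integrable (fermi β μ) (contourMeasure a α) := by
  refine (integrable_fermi_weight (μ := μ) hβ ha hα h).mono'
    measurable_fermi.aestronglyMeasurable (.of_forall fun z => ?_)
  have : (1 : ℝ) ≤ (1 + ‖z‖) ^ 2 := one_le_pow₀ (by linarith [norm_nonneg z])
  exact le_mul_of_one_le_left (norm_nonneg _) this

theorem integrable_fermi_mul_inv (hβ : 0 < β) (ha : 0 < a) (hα : 0 < α) (h : α * β < Real.pi)
    {c : ℝ} (hc : 0 ≤ c) :
    Integrable (fun z => fermi β μ z * (z - c)⁻¹) (contourMeasure a α) := by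
  refine (integrable_fermi (μ := μ) hβ ha hα h).mul_bdd (c := (min a α)⁻¹) ?_ ?_
  · exact Measurable.aestronglyMeasurable (by fun_prop)
  · filter_upwards [ae_mem_contour hα] with z hz
    exact norm_inv_contour_sub_le ha hα hc hz

theorem isOpen_strip : IsOpen {z : ℂ | |z.im| * β < Real.pi} :=
  isOpen_lt (by fun_prop) continuous_const

/-- Exponential decay of the Fermi function lets the rectangle's right edge escape to infinity
without a contribution. -/
theorem tendsto_right_edge (hβ : 0 < β) (hα : 0 < α) (h : α * β < Real.pi) {c : ℝ} :
    Tendsto (fun N : ℝ => ∫ y in (-α)..α, fermi β μ (N + y * Complex.I) *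
      (N + y * Complex.I - c)⁻¹) atTop (nhds 0) := by
  set K := (Real.sin (α * β))⁻¹ * Real.exp (β * μ)
  have hb : ∀ᶠ N : ℝ in atTop, ‖∫ y in (-α)..α, fermi β μ (N + y * Complex.I) *
      (N + y * Complex.I - c)⁻¹‖ ≤ K * Real.exp (-β * N) * |α - (-α)| := by
    filter_upwards [eventually_ge_atTop (c + 1)] with N hN
    refine intervalIntegral.norm_integral_le_of_norm_le_const fun y hy => ?_
    rw [uIoc_of_le (by linarith)] at hy
    have h1 := norm_fermi_le (μ := μ) hβ hα h (z := N + y * Complex.I)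
      (by simpa using abs_le.2 ⟨hy.1.le, hy.2⟩)
    have h2 : ‖(N + y * Complex.I - c : ℂ)⁻¹‖ ≤ 1 := by
      rw [norm_inv]
      refine inv_le_one_of_one_le₀ ?_
      have := Complex.re_le_norm (N + y * Complex.I - c)
      refine le_trans ?_ this
      simp
      linarith
    rw [norm_mul]
    have h3 : (N + y * Complex.I : ℂ).re = N := by simp
    rw [h3] at h1
    calc _ ≤ (K * Real.exp (-β * N)) * 1 := by gcongr; exact (norm_nonneg _).trans h1
      _ = _ := mul_one _
  refine squeeze_zero_norm' hb ?_
  have h1 : Tendsto (fun N : ℝ => Real.exp (-β * N)) atTop (nhds 0) :=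
    Real.tendsto_exp_atBot.comp (tendsto_id.const_mul_atTop_of_neg (neg_neg_of_pos hβ))
  simpa using (h1.const_mul K).mul_const |α - (-α)|

/-- Cauchy's integral formula for the Fermi–Dirac function on the contour. -/
theorem integral_fermi_mul_inv (hβ : 0 < β) (ha : 0 < a) (hα : 0 < α) (h : α * β < Real.pi)
    {c : ℝ} (hc : 0 ≤ c) :
    ∫ z, dir α z • (fermi β μ z * (z - c)⁻¹) ∂contourMeasure a α =
      2 * Real.pi * Complex.I * fermi β μ c := by
  have hi := integrable_fermi_mul_inv (μ := μ) hβ ha hα h hc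
  obtain ⟨h1, h2, h3⟩ := integrable_contour_iff.1 hi
  rw [integral_contour hα hi]
  have t1 := intervalIntegral_tendsto_integral_Ioi (-a) h1 tendsto_id
  have t3 := intervalIntegral_tendsto_integral_Ioi (-a) h3 tendsto_id
  have t2 := tendsto_right_edge (μ := μ) hβ hα h (c := c)
  have key : ∀ᶠ N : ℝ in atTop,
      (∫ x in (-a)..N, fermi β μ (x - α * Complex.I) * (x - α * Complex.I - c)⁻¹) -
      (∫ x in (-a)..N, fermi β μ (x + α * Complex.I) * (x + α * Complex.I - c)⁻¹) +
      Complex.I * (∫ y in (-α)..α, fermi β μ (N + y * Complex.I) * (N + y * Complex.I - c)⁻¹) -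
      Complex.I * (∫ y in (-α)..α, fermi β μ (-a + y * Complex.I) * (-a + y * Complex.I - c)⁻¹) =
      2 * Real.pi * Complex.I * fermi β μ c := by
    filter_upwards [eventually_gt_atTop c] with N hN
    refine integral_rect_cauchy (by linarith) hN hα (isOpen_strip (β := β))
      (fun z hz => (differentiableAt_fermi hβ hz).differentiableWithinAt) fun z hz => ?_
    have hz2 : z.im ∈ uIcc (-α) α := hz.2
    rw [uIcc_of_le (by linarith)] at hz2
    have : |z.im| ≤ α := abs_le.2 hz2
    change |z.im| * β < Real.pi
    exact (mul_le_mul_of_nonneg_right this hβ.le).trans_lt h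
  have lim := ((t3.sub t1).add (t2.const_mul Complex.I)).sub (tendsto_const_nhds (x :=
    Complex.I * (∫ y in (-α)..α, fermi β μ (-a + y * Complex.I) *
      (-a + y * Complex.I - c)⁻¹)) (f := atTop))
  have e := tendsto_nhds_unique (lim.congr' key) tendsto_const_nhds
  rw [intervalIntegral.integral_of_le (by linarith)] at e
  rw [← e, smul_eq_mul]
  ring

/-- The contour integral of the Fermi–Dirac function against a product of two resolvents. -/
theorem integral_fermi_mul_inv_mul_inv (hβ : 0 < β) (ha : 0 < a) (hα : 0 < α)
    (h : α * β < Real.pi) {s t : ℝ} (hs : 0 ≤ s) (ht : 0 ≤ t) (hst : s ≠ t) :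
    ∫ z, (-(2 * Real.pi * Complex.I)⁻¹ * (dir α z * fermi β μ z)) * ((z - s)⁻¹ * (z - t)⁻¹)
      ∂contourMeasure a α = -(fermi β μ s - fermi β μ t) / (s - t) := by
  have hst' : (s - t : ℂ) ≠ 0 := sub_ne_zero.2 fun h => hst (by exact_mod_cast h)
  have e : ∀ᵐ z ∂contourMeasure a α,
      (-(2 * Real.pi * Complex.I)⁻¹ * (dir α z * fermi β μ z)) * ((z - s)⁻¹ * (z - t)⁻¹) =
      (-(2 * Real.pi * Complex.I)⁻¹ * (s - t : ℂ)⁻¹) *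
        (dir α z • (fermi β μ z * (z - s)⁻¹) - dir α z • (fermi β μ z * (z - t)⁻¹)) := by
    filter_upwards [ae_mem_contour hα] with z hz
    have hne : ∀ c : ℝ, 0 ≤ c → z - c ≠ 0 := by
      intro c hc h0
      have hz' := hz
      rw [sub_eq_zero] at h0
      rw [h0] at hz'
      rcases hz' with ⟨_, h2⟩ | ⟨h1, _⟩
      · rw [Complex.ofReal_im, abs_zero] at h2; linarith
      · rw [Complex.ofReal_re] at h1; linarith
    have h1 := hne s hs
    have h2 := hne t ht
    have e1 : (z - s)⁻¹ * (z - t)⁻¹ = (s - t : ℂ)⁻¹ * ((z - s)⁻¹ - (z - t)⁻¹) := by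
      field_simp
      ring
    rw [e1, smul_eq_mul, smul_eq_mul]
    ring
  have hi := fun c hc => integrable_dir_smul_iff.2
    (integrable_fermi_mul_inv (μ := μ) (a := a) (c := c) hβ ha hα h hc)
  rw [integral_congr_ae e, integral_const_mul, integral_sub (hi s hs) (hi t ht),
    integral_fermi_mul_inv hβ ha hα h hs, integral_fermi_mul_inv hβ ha hα h ht]
  have hpi : (Real.pi : ℂ) ≠ 0 := by exact_mod_cast Real.pi_ne_zero
  have hI := Complex.I_ne_zero
  field_simp

end

/-! ### Multiplication operators and Fourier multipliers on `L²` -/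

section

open scoped ENNReal BoundedContinuousFunction

/-- Essentially bounded functions on `ℝ³`. -/
abbrev Linf : Type := Lp (α := E3) ℂ ∞ volume

/-- Integrable functions on `ℝ³`. -/
abbrev L1 : Type := Lp (α := E3) ℂ 1 volume

/-- Bounded multiplication operators on `L²`. -/
def mulInf : Linf →L[ℂ] L2 →L[ℂ] L2 := (ContinuousLinearMap.mul ℂ ℂ).holderL volume ∞ 2 2

theorem coeFn_mulInf (m : Linf) (u : L2) : mulInf m u =ᵐ[volume] fun x => m x * u x :=
  (ContinuousLinearMap.mul ℂ ℂ).coeFn_holder m u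

theorem norm_mulInf_apply_le (m : Linf) : ‖mulInf m‖ ≤ ‖m‖ := by
  refine ContinuousLinearMap.opNorm_le_bound _ (norm_nonneg _) fun u => ?_
  have := (ContinuousLinearMap.mul ℂ ℂ).norm_holder_apply_apply_le (r := 2) m u
  rw [ContinuousLinearMap.opNorm_mul, one_mul] at this
  exact this

/-- Products of two square integrable functions, as integrable functions. -/
def mulTwo : L2 →L[ℂ] L2 →L[ℂ] L1 := (ContinuousLinearMap.mul ℂ ℂ).holderL volume 2 2 1

theorem coeFn_mulTwo (m u : L2) : mulTwo m u =ᵐ[volume] fun x => m x * u x :=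
  (ContinuousLinearMap.mul ℂ ℂ).coeFn_holder m u

theorem norm_mulTwo_le (m u : L2) : ‖mulTwo m u‖ ≤ ‖m‖ * ‖u‖ := by
  have := (ContinuousLinearMap.mul ℂ ℂ).norm_holder_apply_apply_le (r := 1) m u
  rw [ContinuousLinearMap.opNorm_mul, one_mul] at this
  exact this

/-- Multiplication of an essentially bounded function by a square integrable one. -/
def mulLtwo : L2 →L[ℂ] Linf →L[ℂ] L2 := (ContinuousLinearMap.mul ℂ ℂ).holderL volume 2 ∞ 2

theorem coeFn_mulLtwo (m : L2) (u : Linf) : mulLtwo m u =ᵐ[volume] fun x => m x * u x :=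
  (ContinuousLinearMap.mul ℂ ℂ).coeFn_holder m u

theorem norm_mulLtwo_le (m : L2) (u : Linf) : ‖mulLtwo m u‖ ≤ ‖m‖ * ‖u‖ := by
  have := (ContinuousLinearMap.mul ℂ ℂ).norm_holder_apply_apply_le (r := 2) m u
  rw [ContinuousLinearMap.opNorm_mul, one_mul] at this
  exact this

theorem memLp_top_boundedContinuous (g : E3 →ᵇ ℂ) : MemLp g ∞ (volume : Measure E3) :=
  memLp_top_of_bound g.continuous.aestronglyMeasurable ‖g‖ (.of_forall g.norm_coe_le_norm)

/-- Bounded continuous functions as essentially bounded ones. -/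
def bcToLinf : (E3 →ᵇ ℂ) →L[ℂ] Linf :=
  LinearMap.mkContinuous
    { toFun := fun g => (memLp_top_boundedContinuous g).toLp
      map_add' := fun _ _ => rfl
      map_smul' := fun _ _ => rfl } 1 fun g => by
    rw [one_mul]
    change ‖(memLp_top_boundedContinuous g).toLp g‖ ≤ ‖g‖
    rw [Lp.norm_toLp, eLpNorm_exponent_top]
    exact ENNReal.toReal_le_of_le_ofReal (norm_nonneg g)
      (eLpNormEssSup_le_of_ae_bound (.of_forall g.norm_coe_le_norm))

theorem coeFn_bcToLinf (g : E3 →ᵇ ℂ) : bcToLinf g =ᵐ[volume] g :=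
  (memLp_top_boundedContinuous g).coeFn_toLp

theorem norm_bcToLinf_le (g : E3 →ᵇ ℂ) : ‖bcToLinf g‖ ≤ ‖g‖ := by
  have := bcToLinf.le_of_opNorm_le (LinearMap.mkContinuous_norm_le _ zero_le_one _) g
  rwa [one_mul] at this

/-- The Fourier transform on `L²` as a continuous linear map. -/
def fourierL2 : L2 →L[ℂ] L2 := FourierTransform.fourierCLM ℂ L2

theorem fourierL2_apply (u : L2) : fourierL2 u = 𝓕 u := rfl

/-- The Fourier multiplier with square integrable symbol `m`, with values in bounded continuous
functions. -/
def multBC (m : L2) : L2 →L[ℂ] (E3 →ᵇ ℂ) :=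
  Real.Lp.fourierTransformInvCLM E3 ℂ ∘L mulTwo m ∘L fourierL2

theorem multBC_apply (m u : L2) (x : E3) :
    multBC m u x = 𝓕⁻ (fun ξ => m ξ * (𝓕 u : L2) ξ) x := by
  change Real.Lp.fourierTransformInvCLM E3 ℂ (mulTwo m (𝓕 u)) x = _
  rw [Real.Lp.fourierTransformInvCLM_apply, Real.Lp.fourierTransformInv_apply]
  exact Real.fourierInv_congr_ae (coeFn_mulTwo _ _) x

/-- Cauchy–Schwarz, Plancherel and the contraction of the inverse transform from `L¹` to bounded
functions. Point evaluations of `multBC m u` are therefore bounded functionals of `u`, which drives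
both the Sobolev embedding and the Hilbert–Schmidt bound. -/
theorem norm_multBC_apply_le (m u : L2) : ‖multBC m u‖ ≤ ‖m‖ * ‖u‖ := by
  have h1 : ‖Real.Lp.fourierTransformInvCLM E3 ℂ (mulTwo m (𝓕 u))‖ ≤ ‖mulTwo m (𝓕 u)‖ := by
    rw [BoundedContinuousFunction.norm_le (norm_nonneg _)]
    intro x
    rw [Real.Lp.fourierTransformInvCLM_apply, Real.Lp.fourierTransformInv_apply,
      Real.fourierInv_eq]
    refine (norm_integral_le_integral_norm _).trans ?_
    simp_rw [Circle.norm_smul]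
    exact (L1.norm_eq_integral_norm _).symm.le
  refine h1.trans ((norm_mulTwo_le _ _).trans ?_)
  rw [Lp.norm_fourier_eq]

/-- The operator `χ m(∇)`: the Fourier multiplier with symbol `m` followed by multiplication
by `χ`, for square integrable `χ` and `m`. -/
def mulMult (χ m : L2) : L2 →L[ℂ] L2 := mulLtwo χ ∘L bcToLinf ∘L multBC m

theorem coeFn_mulMult (χ m u : L2) :
    mulMult χ m u =ᵐ[volume] fun x => χ x * multBC m u x := by
  filter_upwards [coeFn_mulLtwo χ (bcToLinf (multBC m u)), coeFn_bcToLinf (multBC m u)]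
    with x h1 h2
  change mulLtwo χ (bcToLinf (multBC m u)) x = _
  rw [h1, h2]

theorem norm_mulMult_le (χ m : L2) : ‖mulMult χ m‖ ≤ ‖χ‖ * ‖m‖ := by
  refine ContinuousLinearMap.opNorm_le_bound _ (by positivity) fun u => ?_
  calc ‖mulMult χ m u‖ ≤ ‖χ‖ * ‖bcToLinf (multBC m u)‖ := norm_mulLtwo_le _ _
    _ ≤ ‖χ‖ * (‖m‖ * ‖u‖) := by
      gcongr
      exact (norm_bcToLinf_le _).trans (norm_multBC_apply_le _ _)
    _ = _ := by ring

theorem multBC_add (m n : L2) : multBC (m + n) = multBC m + multBC n := by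
  simp only [multBC, map_add, ContinuousLinearMap.add_comp, ContinuousLinearMap.comp_add]

theorem multBC_smul (c : ℂ) (m : L2) : multBC (c • m) = c • multBC m := by
  simp only [multBC, map_smul, ContinuousLinearMap.smul_comp, ContinuousLinearMap.comp_smul]

/-- `mulMult` as a continuous bilinear map. -/
def mulMultL : L2 →L[ℂ] L2 →L[ℂ] L2 →L[ℂ] L2 :=
  LinearMap.mkContinuous₂ (LinearMap.mk₂ ℂ mulMult
    (fun χ χ' m => by simp only [mulMult, map_add, ContinuousLinearMap.add_comp])
    (fun c χ m => by simp only [mulMult, map_smul, ContinuousLinearMap.smul_comp])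
    (fun χ m m' => by
      simp only [mulMult, multBC_add, ContinuousLinearMap.comp_add])
    (fun c χ m => by
      simp only [mulMult, multBC_smul, ContinuousLinearMap.comp_smul])) 1
    fun χ m => by rw [one_mul]; exact norm_mulMult_le χ m

/-- The Fourier multiplier with essentially bounded symbol `m`. -/
def multInf (m : Linf) : L2 →L[ℂ] L2 :=
  FourierTransform.fourierInvCLM ℂ L2 ∘L mulInf m ∘L fourierL2

theorem fourier_multInf (m : Linf) (u : L2) :
    (𝓕 (multInf m u) : L2) =ᵐ[volume] fun ξ => m ξ * (𝓕 u : L2) ξ := by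
  have : (𝓕 (multInf m u) : L2) = mulInf m (𝓕 u) :=
    FourierTransform.fourier_fourierInv_eq (mulInf m (𝓕 u))
  rw [this]
  exact coeFn_mulInf _ _

theorem norm_multInf_le (m : Linf) : ‖multInf m‖ ≤ ‖m‖ := by
  refine ContinuousLinearMap.opNorm_le_bound _ (norm_nonneg _) fun u => ?_
  rw [← Lp.norm_fourier_eq]
  have : (𝓕 (multInf m u) : L2) = mulInf m (𝓕 u) :=
    FourierTransform.fourier_fourierInv_eq (mulInf m (𝓕 u))
  rw [this]
  calc _ ≤ ‖mulInf m‖ * ‖(𝓕 u : L2)‖ := ContinuousLinearMap.le_opNorm _ _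
    _ ≤ ‖m‖ * ‖u‖ := by
      rw [Lp.norm_fourier_eq]
      gcongr
      exact norm_mulInf_apply_le m

theorem multInf_sub (m n : Linf) : multInf (m - n) = multInf m - multInf n := by
  simp only [multInf, map_sub, ContinuousLinearMap.sub_comp, ContinuousLinearMap.comp_sub]

theorem fourier_injective {u v : L2} (h : (𝓕 u : L2) =ᵐ[volume] (𝓕 v : L2)) : u = v := by
  have : (𝓕 u : L2) = 𝓕 v := Lp.ext h
  exact (Lp.fourierTransformₗᵢ E3 ℂ).injective this

/-- Square integrable functions are determined by integration against Schwartz functions. -/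
theorem ae_eq_of_forall_integral_schwartz {f g : E3 → ℂ} (hf : LocallyIntegrable f)
    (hg : LocallyIntegrable g) (h : ∀ φ : 𝓢(E3, ℂ), ∫ x, φ x * f x = ∫ x, φ x * g x) :
    f =ᵐ[volume] g := by
  refine ae_eq_of_integral_contDiff_smul_eq hf hg fun φ hφ hc => ?_
  have h1 : HasCompactSupport (Complex.ofRealCLM ∘ φ) := hc.comp_left rfl
  have h2 : ContDiff ℝ ∞ (Complex.ofRealCLM ∘ φ) := by fun_prop
  have := h (h1.toSchwartzMap h2)
  simpa using this

theorem locallyIntegrable_L2 (u : L2) : LocallyIntegrable (u : E3 → ℂ) volume :=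
  (Lp.memLp u).locallyIntegrable (by norm_num)

theorem integral_fourier_mul_flip {f g : E3 → ℂ} (hf : Integrable f) (hg : Integrable g) :
    ∫ ξ, 𝓕 f ξ * g ξ = ∫ x, f x * 𝓕 g x := by
  have := VectorFourier.integral_fourierIntegral_smul_eq_flip (L := innerₗ E3)
    Real.continuous_fourierChar continuous_inner hf hg
  rw [flip_innerₗ] at this
  exact this

theorem integral_fourierInv_mul_flip {f g : E3 → ℂ} (hf : Integrable f) (hg : Integrable g) :
    ∫ ξ, 𝓕⁻ f ξ * g ξ = ∫ x, f x * 𝓕⁻ g x := by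
  have := VectorFourier.integral_fourierIntegral_smul_eq_flip (L := -innerₗ E3)
    Real.continuous_fourierChar continuous_inner.neg hf hg
  have h : (-innerₗ E3).flip = -innerₗ E3 := by
    ext x y
    exact congrArg Neg.neg (real_inner_comm x y)
  rw [h] at this
  exact this

/-- On `L¹ ∩ L²` the Plancherel transform is given by the integral: both sides agree against
Schwartz functions, one through tempered distributions and the other through Fubini. -/
theorem fourier_eq_integral {h : L2} (h1 : Integrable (h : E3 → ℂ)) :
    (𝓕 h : L2) =ᵐ[volume] 𝓕 (h : E3 → ℂ) := by
  refine ae_eq_of_forall_integral_schwartz (locallyIntegrable_L2 _) ?_ fun φ => ?_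
  · exact (VectorFourier.fourierIntegral_continuous Real.continuous_fourierChar
      (innerSL ℝ).continuous₂ h1).locallyIntegrable
  · have e1 := congrArg (fun T : 𝓢'(E3, ℂ) => T φ) (Lp.fourier_toTemperedDistribution_eq
      (E := E3) (F := ℂ) h)
    simp only [TemperedDistribution.fourier_apply, Lp.toTemperedDistribution_apply,
      smul_eq_mul] at e1
    rw [← e1]
    exact integral_fourier_mul_flip φ.integrable h1

theorem fourierInv_eq_integral {h : L2} (h1 : Integrable (h : E3 → ℂ)) :
    (𝓕⁻ h : L2) =ᵐ[volume] 𝓕⁻ (h : E3 → ℂ) := by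
  refine ae_eq_of_forall_integral_schwartz (locallyIntegrable_L2 _) ?_ fun φ => ?_
  · exact (VectorFourier.fourierIntegral_continuous (L := -innerₗ E3) Real.continuous_fourierChar
      continuous_inner.neg h1).locallyIntegrable
  · have e1 := congrArg (fun T : 𝓢'(E3, ℂ) => T φ) (Lp.fourierInv_toTemperedDistribution_eq
      (E := E3) (F := ℂ) h)
    simp only [TemperedDistribution.fourierInv_apply, Lp.toTemperedDistribution_apply,
      smul_eq_mul] at e1
    rw [← e1]
    rw [SchwartzMap.fourierInv_coe]
    exact integral_fourierInv_mul_flip φ.integrable h1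

end

/-! ### The Laplacian, resolvents and products on the Fourier side -/

section

open scoped ENNReal BoundedContinuousFunction

/-- The symbol `|k|²`, `k = 2πξ`, of `-Δ`. -/
def sqSymbol (ξ : E3) : ℝ := (2 * Real.pi) ^ 2 * ‖ξ‖ ^ 2

theorem sqSymbol_nonneg (ξ : E3) : 0 ≤ sqSymbol ξ := by unfold sqSymbol; positivity

@[fun_prop]
theorem continuous_sqSymbol : Continuous sqSymbol := by unfold sqSymbol; fun_prop

/-- The distributional Laplacian is a Fourier multiplier, so membership in its graph can be tested
on Schwartz functions after transforming. All domain questions become pointwise algebra with the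
symbol. -/
theorem mem_laplaceGraph_iff (u v : L2) : (u, v) ∈ laplaceGraph ↔
    (𝓕 v : L2) =ᵐ[volume] fun ξ => -(sqSymbol ξ : ℂ) * (𝓕 u : L2) ξ := by
  have hg : (fun x : E3 => Complex.ofReal (‖x‖ ^ 2)).HasTemperateGrowth := by fun_prop
  have key : ∀ φ : 𝓢(E3, ℂ), (𝓕 (Δ (u : 𝓢'(E3, ℂ))) : 𝓢'(E3, ℂ)) φ =
      ∫ x, φ x * (-(sqSymbol x : ℂ) * (𝓕 u : L2) x) := by
    intro φ
    rw [TemperedDistribution.laplacian_eq_fourierMultiplierCLM,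
      TemperedDistribution.fourierMultiplierCLM_apply, ← Complex.coe_smul (-(2 * Real.pi) ^ 2),
      FourierTransform.fourier_smul,
      FourierTransform.fourier_fourierInv_eq, Lp.fourier_toTemperedDistribution_eq]
    change ((-(2 * Real.pi) ^ 2 : ℝ) : ℂ) • ((Lp.toTemperedDistribution (𝓕 u : L2) : 𝓢'(E3, ℂ))
      (SchwartzMap.smulLeftCLM ℂ (fun x : E3 => Complex.ofReal (‖x‖ ^ 2)) φ)) = _
    rw [Lp.toTemperedDistribution_apply, ← integral_smul]
    refine integral_congr_ae (.of_forall fun x => ?_)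
    simp only [SchwartzMap.smulLeftCLM_apply_apply hg, smul_eq_mul, sqSymbol]
    push_cast
    ring
  have key2 : ∀ φ : 𝓢(E3, ℂ), (𝓕 (v : 𝓢'(E3, ℂ)) : 𝓢'(E3, ℂ)) φ =
      ∫ x, φ x * (𝓕 v : L2) x := by
    intro φ
    rw [Lp.fourier_toTemperedDistribution_eq, Lp.toTemperedDistribution_apply]
    rfl
  change Δ (u : 𝓢'(E3, ℂ)) = (v : 𝓢'(E3, ℂ)) ↔ _
  constructor
  · intro h
    refine ae_eq_of_forall_integral_schwartz (locallyIntegrable_L2 _) ?_ fun φ => ?_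
    · have := (locallyIntegrable_L2 (𝓕 u : L2)).continuous_smul
        (g := fun ξ => -(sqSymbol ξ : ℂ)) (by fun_prop)
      simpa only [smul_eq_mul] using this
    · rw [← key2, ← key, h]
  · intro h
    have h2 : (𝓕 (Δ (u : 𝓢'(E3, ℂ))) : 𝓢'(E3, ℂ)) = 𝓕 (v : 𝓢'(E3, ℂ)) := by
      ext φ
      rw [key, key2]
      refine integral_congr_ae ?_
      filter_upwards [h] with x hx
      rw [hx]
    rw [← FourierTransform.fourierInv_fourier_eq (E := 𝓢'(E3, ℂ)) (F := 𝓢'(E3, ℂ))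
      (Δ (u : 𝓢'(E3, ℂ))), h2, FourierTransform.fourierInv_fourier_eq]

theorem mem_laplace_domain_iff {u : L2} : u ∈ laplace.domain ↔ ∃ v, (u, v) ∈ laplaceGraph := by
  rw [LinearPMap.mem_domain_iff, laplace_graph]

theorem laplace_apply_eq_iff (u : laplace.domain) (v : L2) :
    laplace u = v ↔ ((u : L2), v) ∈ laplaceGraph := by
  rw [← laplace_graph]
  constructor
  · rintro rfl
    exact laplace.mem_graph u
  · intro h
    obtain ⟨y, hy1, hy2⟩ := (LinearPMap.mem_graph_iff _).1 h
    have : y = u := Subtype.ext hy1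
    rw [← this]
    exact hy2

theorem mem_mulOp_domain_iff {φ u : L2} :
    u ∈ (mulOp φ).domain ↔ ∃ v : L2, v =ᵐ[volume] fun x => φ x * u x := by
  rw [LinearPMap.mem_domain_iff, mulOp_graph]
  rfl

theorem mulOp_apply_eq_iff {φ : L2} (u : (mulOp φ).domain) (v : L2) :
    mulOp φ u = v ↔ v =ᵐ[volume] fun x => φ x * (u : L2) x := by
  change _ ↔ ((u : L2), v) ∈ mulGraph φ
  rw [← mulOp_graph]
  constructor
  · rintro rfl
    exact (mulOp φ).mem_graph u
  · intro h
    obtain ⟨y, hy1, hy2⟩ := (LinearPMap.mem_graph_iff _).1 h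
    have : y = u := Subtype.ext hy1
    rw [← this]
    exact hy2

/-- A left inverse equals a right inverse. This makes the choice inside `resolventOf` harmless. -/
theorem IsResolventAt.unique {H : L2 →ₗ.[ℂ] L2} {z : ℂ} {R S : L2 →L[ℂ] L2}
    (hR : IsResolventAt H z R) (hS : IsResolventAt H z S) : R = S := by
  ext1 u
  obtain ⟨h, e⟩ := hS.1 u
  have h2 := hR.2 ⟨S u, h⟩
  rwa [e] at h2

theorem IsResolventAt.resolventOf_eq {H : L2 →ₗ.[ℂ] L2} {z : ℂ} {R : L2 →L[ℂ] L2}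
    (hR : IsResolventAt H z R) : resolventOf H z = R := by
  have h : ∃ R, IsResolventAt H z R := ⟨R, hR⟩
  rw [resolventOf, dif_pos h]
  exact h.choose_spec.unique hR

/-- Reflection and translation `q ↦ k - q` of a square integrable function. -/
theorem measurePreserving_const_sub (k : E3) :
    MeasurePreserving (fun q : E3 => k - q) volume volume :=
  Measure.measurePreserving_sub_left volume k

/-- The bilinear pairing `∫ f u` on `L²`. -/
def pairL2 : L2 →L[ℂ] L2 →L[ℂ] ℂ := (ContinuousLinearMap.mul ℂ ℂ).lpPairing volume 2 2

theorem pairL2_apply (f u : L2) : pairL2 f u = ∫ x, f x * u x :=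
  (ContinuousLinearMap.mul ℂ ℂ).lpPairing_eq_integral f u

theorem continuous_mulTwo : Continuous fun p : L2 × L2 => mulTwo p.1 p.2 :=
  mulTwo.continuous₂

/-- The function `q ↦ f̂(k - q)`. -/
def fourierShift (k : E3) (f : L2) : L2 :=
  Lp.compMeasurePreserving _ (measurePreserving_const_sub k) (𝓕 f : L2)

theorem coeFn_fourierShift (k : E3) (f : L2) :
    fourierShift k f =ᵐ[volume] fun q => (𝓕 f : L2) (k - q) :=
  Lp.coeFn_compMeasurePreserving (𝓕 f : L2) (measurePreserving_const_sub k)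

theorem continuous_fourierShift (k : E3) : Continuous (fourierShift k) :=
  (Lp.isometry_compMeasurePreserving (measurePreserving_const_sub k)).continuous.comp
    fourierL2.continuous

/-- The Fourier transform of a product is a convolution. -/
theorem fourier_mul_eq_integral (f u : L2) (k : E3) :
    𝓕 (fun x => f x * u x) k = ∫ q, (𝓕 f : L2) (k - q) * (𝓕 u : L2) q := by
  let ev : (E3 →ᵇ ℂ) →L[ℂ] ℂ := BoundedContinuousFunction.evalCLM ℂ k
  have hl : ∀ f u : L2, 𝓕 (fun x => f x * u x) k =
      ev (Real.Lp.fourierTransformCLM E3 ℂ (mulTwo f u)) := by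
    intro f u
    change _ = Real.Lp.fourierTransformCLM E3 ℂ (mulTwo f u) k
    rw [Real.Lp.fourierTransformCLM_apply, Real.Lp.fourierTransform_apply]
    exact (Real.fourier_congr_ae (coeFn_mulTwo _ _) k).symm
  have hr : ∀ f u : L2, ∫ q, (𝓕 f : L2) (k - q) * (𝓕 u : L2) q = pairL2 (fourierShift k f) (fourierL2 u) := by
    intro f u
    rw [pairL2_apply]
    refine integral_congr_ae ?_
    filter_upwards [coeFn_fourierShift k f] with q hq
    rw [hq, fourierL2_apply]
  rw [hl, hr]
  -- Both sides are jointly continuous in `(f, u) ∈ L² × L²` for fixed `k`, so it suffices to check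
  -- Schwartz functions.
  refine DenseRange.induction_on₂ (p := fun f u : L2 =>
      ev (Real.Lp.fourierTransformCLM E3 ℂ (mulTwo f u)) = pairL2 (fourierShift k f) (fourierL2 u))
    (SchwartzMap.denseRange_toLpCLM (E := E3) (F := ℂ) (p := 2) (μ := volume)
      ENNReal.ofNat_ne_top) ?_ ?_ f u
  · have c2 : Continuous fun g : L1 => ev (Real.Lp.fourierTransformCLM E3 ℂ g) :=
      (ev ∘L Real.Lp.fourierTransformCLM E3 ℂ).continuous
    have c4 : Continuous fun p : L2 × L2 => fourierShift k p.1 :=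
      (continuous_fourierShift k).comp continuous_fst
    have c5 : Continuous fun p : L2 × L2 => fourierL2 p.2 :=
      fourierL2.continuous.comp continuous_snd
    have c7 : Continuous fun p : L2 × L2 => pairL2 (fourierShift k p.1) (fourierL2 p.2) :=
      (pairL2.continuous.comp c4).clm_apply c5
    have c8 : Continuous fun p : L2 × L2 => ev (Real.Lp.fourierTransformCLM E3 ℂ
        (mulTwo p.1 p.2)) :=
      Continuous.comp (g := fun g : L1 => ev (Real.Lp.fourierTransformCLM E3 ℂ g)) c2
        continuous_mulTwo
    exact isClosed_eq c8 c7
  · intro f u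
    rw [← hl, ← hr]
    have e1 : 𝓕 (fun x => (f.toLp 2 : L2) x * (u.toLp 2 : L2) x) k = 𝓕 (fun x => f x * u x) k := by
      refine Real.fourier_congr_ae ?_ k
      filter_upwards [f.coeFn_toLp 2 volume, u.coeFn_toLp 2 volume] with x h1 h2
      rw [h1, h2]
    have e2 : ∫ q, (𝓕 (f.toLp 2 : L2) : L2) (k - q) * (𝓕 (u.toLp 2 : L2) : L2) q =
        ∫ q, (𝓕 f) (k - q) * (𝓕 u) q := by
      rw [SchwartzMap.toLp_fourier_eq, SchwartzMap.toLp_fourier_eq]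
      refine integral_congr_ae ?_
      filter_upwards [(𝓕 u).coeFn_toLp 2 volume,
        (measurePreserving_const_sub k).quasiMeasurePreserving.ae ((𝓕 f).coeFn_toLp 2 volume)]
        with x h1 h2
      rw [h1, h2]
    rw [SchwartzMap.toLpCLM_apply, SchwartzMap.toLpCLM_apply, e1, e2]
    have hF : Integrable (𝓕 f : 𝓢(E3, ℂ)) volume := SchwartzMap.integrable _
    have hG : Integrable (fun q => (𝓕 f : 𝓢(E3, ℂ)) (k - q)) := hF.comp_sub_left k
    -- By Fourier inversion the transform of `q ↦ f̂(k - q)` is `f` times a character; moving the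
    -- transform across the pairing then gives the transform of the product at `k`.
    have e3 : ∀ x, 𝓕 (fun q : E3 => (𝓕 f : 𝓢(E3, ℂ)) (k - q)) x =
        Real.fourierChar (-(inner ℝ x k)) • f x := by
      intro x
      have e4 : f x = 𝓕⁻ (𝓕 f : 𝓢(E3, ℂ)) x := by rw [FourierTransform.fourierInv_fourier_eq]
      rw [e4, SchwartzMap.fourierInv_coe, Real.fourier_eq, Real.fourierInv_eq, Circle.smul_def,
        ← integral_smul, ← integral_sub_left_eq_self _ volume k]
      refine integral_congr_ae (.of_forall fun q => ?_)
      simp only [sub_sub_cancel, Circle.smul_def, smul_smul, ← Circle.coe_mul,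
        ← AddChar.map_add_eq_mul, inner_sub_left]
      rw [real_inner_comm x k]
      congr 3
      ring
    have e5 := integral_fourier_mul_flip hG (u.integrable (μ := volume))
    simp only [← SchwartzMap.fourier_coe u] at e5
    rw [← e5, Real.fourier_eq]
    refine integral_congr_ae (.of_forall fun x => ?_)
    simp only [e3, Circle.smul_def, smul_eq_mul]
    ring

end

/-! ### The free resolvent -/

section

open scoped ENNReal BoundedContinuousFunction

/-- The point `z` has distance at least `δ` to the half-line `[0, ∞)`. -/
def Far (δ : ℝ) (z : ℂ) : Prop := ∀ t : ℝ, 0 ≤ t → δ ≤ ‖z - t‖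

/-- The symbol `(z - |k|²)⁻¹` of the free resolvent. -/
def resSymbol (z : ℂ) (ξ : E3) : ℂ := (z - sqSymbol ξ)⁻¹

@[fun_prop]
theorem measurable_resSymbol : Measurable fun p : ℂ × E3 => resSymbol p.1 p.2 := by
  unfold resSymbol
  have := continuous_sqSymbol.measurable
  fun_prop

theorem measurable_resSymbol_right (z : ℂ) : Measurable (resSymbol z) :=
  measurable_resSymbol.comp measurable_prodMk_left

theorem Far.sub_ne_zero {δ : ℝ} {z : ℂ} (hδ : 0 < δ) (hz : Far δ z) (ξ : E3) :
    z - sqSymbol ξ ≠ 0 :=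
  norm_pos_iff.1 (hδ.trans_le (hz _ (sqSymbol_nonneg ξ)))

theorem Far.norm_resSymbol_le {δ : ℝ} {z : ℂ} (hδ : 0 < δ) (hz : Far δ z) (ξ : E3) :
    ‖resSymbol z ξ‖ ≤ δ⁻¹ := by
  rw [resSymbol, norm_inv]
  exact inv_anti₀ hδ (hz _ (sqSymbol_nonneg ξ))

/-- The growth factor in the bound on the square integral norm of the resolvent symbol. -/
def growth (δ : ℝ) (z : ℂ) : ℝ := 1 + (1 + ‖z‖) / δ

theorem growth_pos {δ : ℝ} (hδ : 0 < δ) (z : ℂ) : 0 < growth δ z := by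
  unfold growth; positivity

/-- With `s = |k|²`, one has `s ≤ ‖z‖ + ‖z - s‖` and `1 + ‖z‖ ≤ ((1 + ‖z‖) / δ) ‖z - s‖`. The bound
separates a linear growth in `z` from a fixed square integrable profile. -/
theorem Far.norm_resSymbol_le_growth {δ : ℝ} {z : ℂ} (hδ : 0 < δ) (hz : Far δ z) (ξ : E3) :
    ‖resSymbol z ξ‖ ≤ growth δ z * (1 + sqSymbol ξ)⁻¹ := by
  have h0 := sqSymbol_nonneg ξ
  have h1 := hz _ h0
  have h2 : 0 < ‖z - sqSymbol ξ‖ := hδ.trans_le h1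
  have h3 : sqSymbol ξ ≤ ‖z‖ + ‖z - sqSymbol ξ‖ := by
    have := norm_sub_le z (z - sqSymbol ξ)
    rw [sub_sub_cancel, Complex.norm_real, Real.norm_of_nonneg h0] at this
    exact this
  have h4 : 1 + ‖z‖ ≤ (1 + ‖z‖) / δ * ‖z - sqSymbol ξ‖ := by
    rw [div_mul_eq_mul_div, le_div_iff₀ hδ]
    gcongr
  rw [resSymbol, norm_inv, ← div_eq_mul_inv, inv_eq_one_div, div_le_div_iff₀ h2 (by positivity)]
  unfold growth
  linarith

theorem memLp_inv_one_add_sqSymbol :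
    MemLp (fun ξ : E3 => (1 + sqSymbol ξ)⁻¹) 2 volume := by
  have hc : Continuous fun ξ : E3 => (1 + sqSymbol ξ)⁻¹ :=
    Continuous.inv₀ (by fun_prop) fun ξ => by have := sqSymbol_nonneg ξ; positivity
  have h1 : MemLp (fun ξ : E3 => (1 + ‖ξ‖ ^ 2)⁻¹) 2 volume := by
    have hc' : Continuous fun ξ : E3 => (1 + ‖ξ‖ ^ 2)⁻¹ :=
      Continuous.inv₀ (by fun_prop) fun ξ => by positivity
    rw [memLp_two_iff_integrable_sq hc'.aestronglyMeasurable]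
    -- The dimension enters here: the squared profile decays with exponent `4 > 3`.
    have := integrable_rpow_neg_one_add_norm_sq (E := E3) (μ := volume) (r := 4)
      (by rw [finrank_euclideanSpace_fin]; norm_num)
    refine this.congr (.of_forall fun ξ => ?_)
    have h : (0 : ℝ) ≤ 1 + ‖ξ‖ ^ 2 := by positivity
    change (1 + ‖ξ‖ ^ 2) ^ (-4 / 2 : ℝ) = ((1 + ‖ξ‖ ^ 2)⁻¹) ^ 2
    rw [show (-4 / 2 : ℝ) = -(2 : ℕ) by norm_num, Real.rpow_neg h, Real.rpow_natCast, inv_pow]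
  refine h1.mono hc.aestronglyMeasurable (.of_forall fun ξ => ?_)
  have h0 := sqSymbol_nonneg ξ
  rw [Real.norm_of_nonneg (by positivity), Real.norm_of_nonneg (by positivity)]
  refine inv_anti₀ (by positivity) ?_
  unfold sqSymbol
  have h1 : 1 ≤ (2 * Real.pi) ^ 2 := by nlinarith [Real.pi_gt_three]
  linarith [le_mul_of_one_le_left (sq_nonneg ‖ξ‖) h1]

/-- The square integral norm of `(1 + |k|²)⁻¹`. -/
def decayNorm : ℝ := ‖memLp_inv_one_add_sqSymbol.toLp‖

theorem decayNorm_nonneg : 0 ≤ decayNorm := norm_nonneg _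

theorem Far.memLp_two {δ : ℝ} {z : ℂ} (hδ : 0 < δ) (hz : Far δ z) :
    MemLp (resSymbol z) 2 volume := by
  refine memLp_inv_one_add_sqSymbol.of_le_mul (c := growth δ z)
    (measurable_resSymbol_right z).aestronglyMeasurable (.of_forall fun ξ => ?_)
  have h0 := sqSymbol_nonneg ξ
  rw [Real.norm_of_nonneg (by positivity)]
  exact hz.norm_resSymbol_le_growth hδ ξ

theorem Far.memLp_top {δ : ℝ} {z : ℂ} (hδ : 0 < δ) (hz : Far δ z) :
    MemLp (resSymbol z) ∞ volume :=
  memLp_top_of_bound (measurable_resSymbol_right z).aestronglyMeasurable δ⁻¹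
    (.of_forall fun ξ => hz.norm_resSymbol_le hδ ξ)

open scoped Classical in
/-- The resolvent symbol as an element of `L²`. -/
def resTwo (z : ℂ) : L2 := if h : MemLp (resSymbol z) 2 volume then h.toLp else 0

open scoped Classical in
/-- The resolvent symbol as an element of `L^∞`. -/
def resInf (z : ℂ) : Linf := if h : MemLp (resSymbol z) ∞ volume then h.toLp else 0

theorem Far.coeFn_resTwo {δ : ℝ} {z : ℂ} (hδ : 0 < δ) (hz : Far δ z) :
    resTwo z =ᵐ[volume] resSymbol z := by
  rw [resTwo, dif_pos (hz.memLp_two hδ)]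
  exact MemLp.coeFn_toLp _

theorem Far.coeFn_resInf {δ : ℝ} {z : ℂ} (hδ : 0 < δ) (hz : Far δ z) :
    resInf z =ᵐ[volume] resSymbol z := by
  rw [resInf, dif_pos (hz.memLp_top hδ)]
  exact MemLp.coeFn_toLp _

theorem norm_Linf_le_of_ae_bound {f : Linf} {C : ℝ} (hC : 0 ≤ C)
    (h : ∀ᵐ ξ ∂(volume : Measure E3), ‖f ξ‖ ≤ C) : ‖f‖ ≤ C := by
  rw [Lp.norm_def, eLpNorm_exponent_top]
  exact ENNReal.toReal_le_of_le_ofReal hC (eLpNormEssSup_le_of_ae_bound h)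

theorem Far.norm_resInf_le {δ : ℝ} {z : ℂ} (hδ : 0 < δ) (hz : Far δ z) : ‖resInf z‖ ≤ δ⁻¹ := by
  refine norm_Linf_le_of_ae_bound (by positivity) ?_
  filter_upwards [hz.coeFn_resInf hδ] with ξ h
  rw [h]
  exact hz.norm_resSymbol_le hδ ξ

theorem Far.norm_resTwo_le {δ : ℝ} {z : ℂ} (hδ : 0 < δ) (hz : Far δ z) :
    ‖resTwo z‖ ≤ growth δ z * decayNorm := by
  refine Lp.norm_le_mul_norm_of_ae_le_mul ?_
  filter_upwards [hz.coeFn_resTwo hδ, memLp_inv_one_add_sqSymbol.coeFn_toLp] with ξ h1 h2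
  have h0 := sqSymbol_nonneg ξ
  rw [h1, h2, Real.norm_of_nonneg (by positivity)]
  exact hz.norm_resSymbol_le_growth hδ ξ

theorem Far.resSymbol_sub {δ : ℝ} {z w : ℂ} (hδ : 0 < δ) (hz : Far δ z) (hw : Far δ w) (ξ : E3) :
    resSymbol z ξ - resSymbol w ξ = (w - z) * (resSymbol z ξ * resSymbol w ξ) := by
  have h1 := hz.sub_ne_zero hδ ξ
  have h2 := hw.sub_ne_zero hδ ξ
  unfold resSymbol
  field_simp
  ring

/-- The first resolvent identity for symbols; it yields the continuity in `z` that makes the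
operator-valued integrands measurable. -/
theorem Far.norm_resTwo_sub_le {δ : ℝ} {z w : ℂ} (hδ : 0 < δ) (hz : Far δ z) (hw : Far δ w) :
    ‖resTwo z - resTwo w‖ ≤ ‖z - w‖ * δ⁻¹ * ‖resTwo w‖ := by
  refine Lp.norm_le_mul_norm_of_ae_le_mul ?_
  filter_upwards [hz.coeFn_resTwo hδ, hw.coeFn_resTwo hδ, Lp.coeFn_sub (resTwo z) (resTwo w)]
    with ξ h1 h2 h3
  rw [h3, Pi.sub_apply, h1, h2, hz.resSymbol_sub hδ hw, norm_mul, norm_mul, norm_sub_rev w z,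
    ← mul_assoc]
  gcongr
  exact hz.norm_resSymbol_le hδ ξ

theorem Far.norm_resInf_sub_le {δ : ℝ} {z w : ℂ} (hδ : 0 < δ) (hz : Far δ z) (hw : Far δ w) :
    ‖resInf z - resInf w‖ ≤ ‖z - w‖ * (δ⁻¹ * δ⁻¹) := by
  refine norm_Linf_le_of_ae_bound (by positivity) ?_
  filter_upwards [hz.coeFn_resInf hδ, hw.coeFn_resInf hδ, Lp.coeFn_sub (resInf z) (resInf w)]
    with ξ h1 h2 h3
  rw [h3, Pi.sub_apply, h1, h2, hz.resSymbol_sub hδ hw, norm_mul, norm_mul, norm_sub_rev w z]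
  gcongr
  · exact hz.norm_resSymbol_le hδ ξ
  · exact hw.norm_resSymbol_le hδ ξ

theorem continuousOn_of_norm_sub_le {V : Type*} [NormedAddCommGroup V] {s : Set ℂ} {f : ℂ → V}
    (C : ℂ → ℝ) (h : ∀ z ∈ s, ∀ w ∈ s, ‖f z - f w‖ ≤ ‖z - w‖ * C w) : ContinuousOn f s := by
  intro w hw
  rw [ContinuousWithinAt, tendsto_iff_norm_sub_tendsto_zero]
  refine squeeze_zero' (.of_forall fun _ => norm_nonneg _)
    (eventually_mem_nhdsWithin.mono fun z hz => h z hz w hw) ?_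
  have : Tendsto (fun z => ‖z - w‖ * C w) (nhds w) (nhds (‖w - w‖ * C w)) := by
    apply Continuous.tendsto; fun_prop
  rw [sub_self, norm_zero, zero_mul] at this
  exact this.mono_left nhdsWithin_le_nhds

theorem continuousOn_resTwo {δ : ℝ} (hδ : 0 < δ) : ContinuousOn resTwo {z | Far δ z} :=
  continuousOn_of_norm_sub_le (fun w => δ⁻¹ * ‖resTwo w‖) fun z hz w hw => by
    rw [← mul_assoc]
    exact Far.norm_resTwo_sub_le hδ hz hw

/-- The free resolvent `(z + Δ)⁻¹`. -/
def freeRes (z : ℂ) : L2 →L[ℂ] L2 := multInf (resInf z)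

theorem Far.norm_freeRes_le {δ : ℝ} {z : ℂ} (hδ : 0 < δ) (hz : Far δ z) : ‖freeRes z‖ ≤ δ⁻¹ :=
  (norm_multInf_le _).trans (hz.norm_resInf_le hδ)

theorem continuousOn_freeRes {δ : ℝ} (hδ : 0 < δ) : ContinuousOn freeRes {z | Far δ z} :=
  continuousOn_of_norm_sub_le (fun _ => δ⁻¹ * δ⁻¹) fun z hz w hw => by
    rw [freeRes, freeRes, ← multInf_sub]
    exact (norm_multInf_le _).trans (Far.norm_resInf_sub_le hδ hz hw)

theorem continuousOn_mulMult {δ : ℝ} (hδ : 0 < δ) (χ : L2) :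
    ContinuousOn (fun z => mulMult χ (resTwo z)) {z | Far δ z} :=
  (mulMultL χ).continuous.comp_continuousOn (continuousOn_resTwo hδ)

theorem Far.fourier_freeRes {δ : ℝ} {z : ℂ} (hδ : 0 < δ) (hz : Far δ z) (u : L2) :
    (𝓕 (freeRes z u) : L2) =ᵐ[volume] fun ξ => resSymbol z ξ * (𝓕 u : L2) ξ := by
  filter_upwards [fourier_multInf (resInf z) u, hz.coeFn_resInf hδ] with ξ h1 h2
  rw [← h2, ← h1]
  rfl

/-- The symbol is both bounded and square integrable, so its product with `𝓕 u` lies in `L¹ ∩ L²`,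
where the two inverse transforms agree. Thus the resolvent maps `L²` into bounded continuous
functions. -/
theorem Far.freeRes_ae_eq_multBC {δ : ℝ} {z : ℂ} (hδ : 0 < δ) (hz : Far δ z) (u : L2) :
    freeRes z u =ᵐ[volume] multBC (resTwo z) u := by
  let h : L2 := mulInf (resInf z) (𝓕 u)
  have e : (h : E3 → ℂ) =ᵐ[volume] fun ξ => resTwo z ξ * (𝓕 u : L2) ξ := by
    filter_upwards [coeFn_mulInf (resInf z) (𝓕 u), hz.coeFn_resInf hδ, hz.coeFn_resTwo hδ]
      with ξ h1 h2 h3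
    rw [h1, h2, h3]
  have hi : Integrable (h : E3 → ℂ) volume :=
    ((Lp.memLp (resTwo z)).integrable_mul (Lp.memLp (𝓕 u : L2))).congr e.symm
  have h1 : freeRes z u = (𝓕⁻ h : L2) := rfl
  rw [h1]
  filter_upwards [fourierInv_eq_integral hi] with x hx
  rw [hx, multBC_apply]
  exact Real.fourierInv_congr_ae e x

theorem Far.coeFn_mulMult_resTwo {δ : ℝ} {z : ℂ} (hδ : 0 < δ) (hz : Far δ z) (χ u : L2) :
    mulMult χ (resTwo z) u =ᵐ[volume] fun x => χ x * freeRes z u x := by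
  filter_upwards [coeFn_mulMult χ (resTwo z) u, hz.freeRes_ae_eq_multBC hδ u] with x h1 h2
  rw [h1, h2]

/-- Links two readings of one operator: as `Φ R` it is small in norm, for the Neumann argument; as
`mulMult` it is Hilbert–Schmidt. -/
theorem Far.mulInf_comp_freeRes {δ : ℝ} {z : ℂ} (hδ : 0 < δ) (hz : Far δ z) {φ : L2} {Φ : Linf}
    (h : φ =ᵐ[volume] Φ) : mulInf Φ ∘L freeRes z = mulMult φ (resTwo z) := by
  ext1 u
  refine Lp.ext ?_
  filter_upwards [hz.coeFn_mulMult_resTwo hδ φ u, coeFn_mulInf Φ (freeRes z u), h] with x h1 h2 h3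
  rw [h1, h3, ← h2]
  rfl

theorem Far.laplaceGraph_freeRes {δ : ℝ} {z : ℂ} (hδ : 0 < δ) (hz : Far δ z) (u : L2) :
    (freeRes z u, u - z • freeRes z u) ∈ laplaceGraph := by
  rw [mem_laplaceGraph_iff]
  have e : (𝓕 (u - z • freeRes z u) : L2) = 𝓕 u - z • (𝓕 (freeRes z u) : L2) := by
    rw [← fourierL2_apply, map_sub, map_smul]
    rfl
  rw [e]
  filter_upwards [hz.fourier_freeRes hδ u, Lp.coeFn_sub (𝓕 u : L2) (z • (𝓕 (freeRes z u) : L2)),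
    Lp.coeFn_smul z (𝓕 (freeRes z u) : L2)] with ξ h1 h2 h3
  have := hz.sub_ne_zero hδ ξ
  rw [h2, Pi.sub_apply, h3, Pi.smul_apply, h1, resSymbol, smul_eq_mul]
  field_simp
  ring

theorem Far.freeRes_of_mem_laplaceGraph {δ : ℝ} {z : ℂ} (hδ : 0 < δ) (hz : Far δ z) {u v : L2}
    (h : (u, v) ∈ laplaceGraph) : freeRes z (z • u + v) = u := by
  rw [mem_laplaceGraph_iff] at h
  apply fourier_injective
  have e : (𝓕 (z • u + v) : L2) = z • (𝓕 u : L2) + 𝓕 v := by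
    rw [← fourierL2_apply, map_add, map_smul]
    rfl
  filter_upwards [h, hz.fourier_freeRes hδ (z • u + v), Lp.coeFn_add (z • (𝓕 u : L2)) (𝓕 v),
    Lp.coeFn_smul z (𝓕 u : L2)] with ξ h1 h2 h3 h4
  have := hz.sub_ne_zero hδ ξ
  rw [h2, e, h3, Pi.add_apply, h4, Pi.smul_apply, h1, resSymbol, smul_eq_mul]
  field_simp
  ring

theorem Far.isResolventAt_neg_laplace {δ : ℝ} {z : ℂ} (hδ : 0 < δ) (hz : Far δ z) :
    IsResolventAt (-laplace) z (freeRes z) := by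
  constructor
  · intro u
    have h := hz.laplaceGraph_freeRes hδ u
    have hd : freeRes z u ∈ laplace.domain := mem_laplace_domain_iff.2 ⟨_, h⟩
    refine ⟨hd, ?_⟩
    have h2 := (laplace_apply_eq_iff ⟨_, hd⟩ _).2 h
    rw [LinearPMap.neg_apply]
    rw [h2]
    abel
  · intro u
    have h := (laplace_apply_eq_iff u _).1 rfl
    rw [LinearPMap.neg_apply, sub_neg_eq_add]
    exact hz.freeRes_of_mem_laplaceGraph hδ h

end

/-! ### Sobolev embedding and the perturbed resolvent -/

section

open scoped ENNReal BoundedContinuousFunction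

/-- The Sobolev embedding `H²(ℝ³) ⊂ L^∞(ℝ³)`. -/
theorem exists_Linf_of_mem_domain : ∃ C : ℝ, 0 ≤ C ∧ ∀ φ : laplace.domain, ∃ Φ : Linf,
    (φ : L2) =ᵐ[volume] Φ ∧ ‖Φ‖ ≤ C * (‖(φ : L2)‖ + ‖laplace φ‖) := by
  have hz : Far 1 (-1) := by
    intro t ht
    have h : (-1 - t : ℂ) = ((-(1 + t) : ℝ) : ℂ) := by push_cast; ring
    rw [h, Complex.norm_real, norm_neg, Real.norm_of_nonneg (by positivity)]
    linarith
  refine ⟨‖resTwo (-1)‖, norm_nonneg _, fun φ => ?_⟩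
  -- `φ = (-1 + Δ)⁻¹ y`, so the supremum of `φ` is at most the `L²` norm of the resolvent symbol at
  -- `-1` times `‖y‖`.
  let y : L2 := (-1 : ℂ) • (φ : L2) + laplace φ
  have hy : freeRes (-1) y = φ :=
    hz.freeRes_of_mem_laplaceGraph one_pos ((laplace_apply_eq_iff φ _).1 rfl)
  refine ⟨bcToLinf (multBC (resTwo (-1)) y), ?_, ?_⟩
  · rw [← hy]
    exact (hz.freeRes_ae_eq_multBC one_pos y).trans (coeFn_bcToLinf _).symm
  · calc _ ≤ ‖resTwo (-1)‖ * ‖y‖ := (norm_bcToLinf_le _).trans (norm_multBC_apply_le _ _)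
      _ ≤ _ := by
        gcongr
        refine (norm_add_le _ _).trans ?_
        rw [norm_smul, norm_neg, norm_one, one_mul]

/-- The factor `(1 + Φ (z + Δ)⁻¹)⁻¹` of the perturbed resolvent. -/
def resFactor (Φ : Linf) (z : ℂ) : L2 →L[ℂ] L2 := Ring.inverse (1 + mulInf Φ ∘L freeRes z)

theorem Far.norm_mulInf_comp_freeRes_le {δ : ℝ} {z : ℂ} (hδ : 0 < δ) (hz : Far δ z) (Φ : Linf) :
    ‖mulInf Φ ∘L freeRes z‖ ≤ ‖Φ‖ * δ⁻¹ :=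
  (ContinuousLinearMap.opNorm_comp_le _ _).trans
    (mul_le_mul (norm_mulInf_apply_le Φ) (hz.norm_freeRes_le hδ) (norm_nonneg _) (norm_nonneg _))

theorem Far.norm_mulInf_comp_freeRes_le_half {δ : ℝ} {z : ℂ} (hδ : 0 < δ) (hz : Far δ z)
    {Φ : Linf} (hΦ : ‖Φ‖ ≤ δ / 2) : ‖mulInf Φ ∘L freeRes z‖ ≤ 1 / 2 := by
  refine (hz.norm_mulInf_comp_freeRes_le hδ Φ).trans ?_
  rw [← div_eq_mul_inv, div_le_iff₀ hδ]
  linarith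

theorem Far.isUnit_one_add {δ : ℝ} {z : ℂ} (hδ : 0 < δ) (hz : Far δ z)
    {Φ : Linf} (hΦ : ‖Φ‖ ≤ δ / 2) : IsUnit (1 + mulInf Φ ∘L freeRes z) := by
  have h := hz.norm_mulInf_comp_freeRes_le_half hδ hΦ
  have := isUnit_one_sub_of_norm_lt_one (x := -(mulInf Φ ∘L freeRes z))
    (by rw [norm_neg]; linarith)
  rwa [sub_neg_eq_add] at this

theorem Far.one_add_mul_resFactor {δ : ℝ} {z : ℂ} (hδ : 0 < δ) (hz : Far δ z)
    {Φ : Linf} (hΦ : ‖Φ‖ ≤ δ / 2) :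
    (1 + mulInf Φ ∘L freeRes z) * resFactor Φ z = 1 :=
  Ring.mul_inverse_cancel _ (hz.isUnit_one_add hδ hΦ)

theorem Far.resFactor_mul_one_add {δ : ℝ} {z : ℂ} (hδ : 0 < δ) (hz : Far δ z)
    {Φ : Linf} (hΦ : ‖Φ‖ ≤ δ / 2) :
    resFactor Φ z * (1 + mulInf Φ ∘L freeRes z) = 1 :=
  Ring.inverse_mul_cancel _ (hz.isUnit_one_add hδ hΦ)

/-- From `W = 1 - Φ R W` and `‖Φ R‖ ≤ 1/2` follows `‖W‖ ≤ 1 + ‖W‖ / 2`. -/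
theorem Far.norm_resFactor_le {δ : ℝ} {z : ℂ} (hδ : 0 < δ) (hz : Far δ z)
    {Φ : Linf} (hΦ : ‖Φ‖ ≤ δ / 2) : ‖resFactor Φ z‖ ≤ 2 := by
  have h := hz.norm_mulInf_comp_freeRes_le_half hδ hΦ
  have e : resFactor Φ z = 1 - (mulInf Φ ∘L freeRes z) * resFactor Φ z := by
    have := hz.one_add_mul_resFactor hδ hΦ
    rw [add_mul, one_mul] at this
    rw [← this]
    abel
  have h1 : ‖(1 : L2 →L[ℂ] L2)‖ ≤ 1 := ContinuousLinearMap.norm_id_le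
  have h2 : ‖resFactor Φ z‖ ≤ 1 + 1 / 2 * ‖resFactor Φ z‖ := by
    calc ‖resFactor Φ z‖ = ‖1 - (mulInf Φ ∘L freeRes z) * resFactor Φ z‖ := congrArg _ e
      _ ≤ ‖(1 : L2 →L[ℂ] L2)‖ + ‖(mulInf Φ ∘L freeRes z) * resFactor Φ z‖ := norm_sub_le _ _
      _ ≤ 1 + ‖mulInf Φ ∘L freeRes z‖ * ‖resFactor Φ z‖ := by
        gcongr
        exact norm_mul_le _ _
      _ ≤ _ := by gcongr
  linarith

theorem continuousOn_resFactor {δ : ℝ} (hδ : 0 < δ) {Φ : Linf} (hΦ : ‖Φ‖ ≤ δ / 2) :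
    ContinuousOn (resFactor Φ) {z | Far δ z} := by
  intro z hz
  obtain ⟨x, hx⟩ := Far.isUnit_one_add hδ hz hΦ
  have h1 : ContinuousAt Ring.inverse (1 + mulInf Φ ∘L freeRes z) := by
    rw [← hx]
    exact NormedRing.inverse_continuousAt x
  have h2 : ContinuousOn (fun z => 1 + mulInf Φ ∘L freeRes z) {z | Far δ z} := by
    refine continuousOn_const.add ?_
    exact (ContinuousLinearMap.compL ℂ L2 L2 L2 (mulInf Φ)).continuous.comp_continuousOn
      (continuousOn_freeRes hδ)
  exact ContinuousAt.comp_continuousWithinAt (f := fun z => 1 + mulInf Φ ∘L freeRes z) h1 (h2 z hz)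

/-- On the domain of the Laplacian, `z + Δ + φ = (1 + Φ R)(z + Δ)`. Since `Φ` is bounded,
multiplication by `φ` is defined everywhere and does not shrink this domain. -/
theorem Far.isResolventAt_hamiltonian {δ : ℝ} {z : ℂ} (hδ : 0 < δ) (hz : Far δ z)
    {φ : L2} {Φ : Linf} (hφ : φ =ᵐ[volume] Φ) (hΦ : ‖Φ‖ ≤ δ / 2) :
    IsResolventAt (hamiltonian φ) z (freeRes z ∘L resFactor Φ z) := by
  have hmul : ∀ u : L2, mulInf Φ u =ᵐ[volume] fun x => φ x * u x := by
    intro u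
    filter_upwards [coeFn_mulInf Φ u, hφ] with x h1 h2
    rw [h1, h2]
  have hdom : ∀ u : L2, u ∈ (hamiltonian φ).domain ↔ u ∈ laplace.domain := by
    intro u
    rw [hamiltonian, LinearPMap.sub_domain, LinearPMap.neg_domain, Submodule.mem_inf]
    exact and_iff_left (mem_mulOp_domain_iff.2 ⟨_, hmul u⟩)
  have happ : ∀ (u v : L2) (hu : u ∈ (hamiltonian φ).domain), (u, v) ∈ laplaceGraph →
      hamiltonian φ ⟨u, hu⟩ = -v - mulInf Φ u := by
    intro u v hu hv
    have h1 : laplace ⟨u, (hdom u).1 hu⟩ = v := (laplace_apply_eq_iff _ _).2 hv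
    have h2 : mulOp φ ⟨u, mem_mulOp_domain_iff.2 ⟨_, hmul u⟩⟩ = mulInf Φ u :=
      (mulOp_apply_eq_iff _ _).2 (hmul u)
    rw [← h1, ← h2]
    rfl
  constructor
  · intro u
    have h := hz.laplaceGraph_freeRes hδ (resFactor Φ z u)
    have hd : freeRes z (resFactor Φ z u) ∈ (hamiltonian φ).domain :=
      (hdom _).2 (mem_laplace_domain_iff.2 ⟨_, h⟩)
    refine ⟨hd, ?_⟩
    have e := congrArg (fun A : L2 →L[ℂ] L2 => A u) (hz.one_add_mul_resFactor hδ hΦ)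
    change resFactor Φ z u + mulInf Φ (freeRes z (resFactor Φ z u)) = u at e
    change z • freeRes z (resFactor Φ z u) - hamiltonian φ ⟨freeRes z (resFactor Φ z u), hd⟩ = u
    rw [happ _ _ hd h]
    refine Eq.trans ?_ e
    abel
  · rintro ⟨u, hu⟩
    have hu' := (hdom u).1 hu
    have h := (laplace_apply_eq_iff ⟨u, hu'⟩ _).1 rfl
    change freeRes z (resFactor Φ z (z • u - hamiltonian φ ⟨u, hu⟩)) = u
    rw [happ _ _ hu h]
    set y : L2 := z • u + laplace ⟨u, hu'⟩ with hy
    have hfy : freeRes z y = u := hz.freeRes_of_mem_laplaceGraph hδ h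
    have e := congrArg (fun A : L2 →L[ℂ] L2 => A y) (hz.resFactor_mul_one_add hδ hΦ)
    change resFactor Φ z (y + mulInf Φ (freeRes z y)) = y at e
    have e2 : z • u - (-laplace ⟨u, hu'⟩ - mulInf Φ u) = y + mulInf Φ (freeRes z y) := by
      rw [hfy, hy]
      abel
    rw [e2, e, hfy]

/-- The second order expansion of the perturbed resolvent. -/
theorem Far.freeRes_comp_resFactor {δ : ℝ} {z : ℂ} (hδ : 0 < δ) (hz : Far δ z)
    {φ : L2} {Φ : Linf} (hφ : φ =ᵐ[volume] Φ) (hΦ : ‖Φ‖ ≤ δ / 2) :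
    freeRes z ∘L resFactor Φ z = freeRes z - freeRes z ∘L mulMult φ (resTwo z) +
      freeRes z ∘L (resFactor Φ z ∘L mulInf Φ ∘L freeRes z) ∘L mulMult φ (resTwo z) := by
  rw [← hz.mulInf_comp_freeRes hδ hφ]
  have h := hz.resFactor_mul_one_add hδ hΦ
  set P := mulInf Φ ∘L freeRes z
  set W := resFactor Φ z
  set R := freeRes z
  -- The identity `W = 1 - W P` is inserted into itself once. Of the two factors `P`, one will
  -- supply smallness and the other, read as `mulMult`, the Hilbert–Schmidt property.
  have e : W = 1 - P + W * P * P := by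
    have h1 : W = 1 - W * P := by
      rw [← h]; noncomm_ring
    calc W = 1 - W * P := h1
      _ = 1 - (1 - W * P) * P := by rw [← h1]; exact h1
      _ = _ := by noncomm_ring
  change R * W = R - R * P + R * (W * P * P)
  nth_rewrite 1 [e]
  noncomm_ring

theorem Far.isSandwich {δ : ℝ} {z : ℂ} (hδ : 0 < δ) (hz : Far δ z) (φ : L2) :
    IsSandwich φ z (freeRes z ∘L mulMult φ (resTwo z)) := by
  have hR := hz.isResolventAt_neg_laplace hδ
  refine ⟨⟨_, hR⟩, fun u => ?_⟩
  have hm := hz.coeFn_mulMult_resTwo hδ φ u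
  rw [hR.resolventOf_eq]
  have hd : freeRes z u ∈ (mulOp φ).domain := mem_mulOp_domain_iff.2 ⟨_, hm⟩
  refine ⟨hd, ?_⟩
  rw [(mulOp_apply_eq_iff ⟨_, hd⟩ _).2 hm]
  rfl

theorem IsSandwich.unique {φ : L2} {z : ℂ} {S T : L2 →L[ℂ] L2} (hS : IsSandwich φ z S)
    (hT : IsSandwich φ z T) : S = T := by
  ext1 u
  obtain ⟨_, h1⟩ := hS.2 u
  obtain ⟨_, h2⟩ := hT.2 u
  rw [h1, h2]

open scoped ComplexConjugate in
/-- The Fourier transform of the adjoint of `χ m(∇)`, for `χ` the complex conjugate of `X`. -/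
theorem fourier_adjoint_mulMult (X m u : L2) :
    (𝓕 (ContinuousLinearMap.adjoint (mulMult (star X) m) u) : L2) =ᵐ[volume]
      fun ξ => conj (m ξ) * 𝓕 (fun x => X x * u x) ξ := by
  let b : E3 →ᵇ ℂ := Real.Lp.fourierTransformCLM E3 ℂ (mulTwo X u)
  have hb : ∀ ξ, b ξ = 𝓕 (fun x => X x * u x) ξ := by
    intro ξ
    change Real.Lp.fourierTransformCLM E3 ℂ (mulTwo X u) ξ = _
    rw [Real.Lp.fourierTransformCLM_apply, Real.Lp.fourierTransform_apply]
    exact Real.fourier_congr_ae (coeFn_mulTwo _ _) ξ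
  have hXu : Integrable (fun x => X x * u x) volume :=
    (Lp.memLp X).integrable_mul (Lp.memLp u)
  let w : L2 := mulLtwo (star m) (bcToLinf b)
  have hw : w =ᵐ[volume] fun ξ => conj (m ξ) * b ξ := by
    filter_upwards [coeFn_mulLtwo (star m) (bcToLinf b), coeFn_bcToLinf b, Lp.coeFn_star m]
      with ξ h1 h2 h3
    rw [h1, h2, h3]
    rfl
  suffices h : ContinuousLinearMap.adjoint (mulMult (star X) m) u = 𝓕⁻ w by
    rw [h, FourierTransform.fourier_fourierInv_eq]
    filter_upwards [hw] with ξ h1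
    rw [h1, hb]
  refine ext_inner_right ℂ fun v => ?_
  rw [ContinuousLinearMap.adjoint_inner_left, ← Lp.inner_fourier_eq (𝓕⁻ w : L2) v,
    FourierTransform.fourier_fourierInv_eq, L2.inner_def, L2.inner_def]
  have hmv : Integrable (fun ξ => m ξ * (𝓕 v : L2) ξ) volume :=
    (Lp.memLp m).integrable_mul (Lp.memLp (𝓕 v : L2))
  have hXu' : Integrable (fun x => conj (X x * u x)) volume :=
    Complex.conjCLE.toContinuousLinearMap.integrable_comp hXu
  have e := integral_fourierInv_mul_flip hXu' hmv
  calc _ = ∫ x, conj (X x * u x) * 𝓕⁻ (fun ξ => m ξ * (𝓕 v : L2) ξ) x := by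
        refine integral_congr_ae ?_
        filter_upwards [coeFn_mulMult (star X) m v, Lp.coeFn_star X] with x h1 h2
        rw [h1, h2, multBC_apply, RCLike.inner_apply, Pi.star_apply, map_mul]
        simp only [RCLike.star_def]
        ring
    _ = _ := by
        rw [← e]
        refine integral_congr_ae ?_
        filter_upwards [hw] with ξ h1
        have h2 : 𝓕⁻ (fun x => conj (X x * u x)) ξ = conj (b ξ) := by
          rw [hb, Real.fourier_eq, Real.fourierInv_eq, ← integral_conj]
          refine integral_congr_ae (.of_forall fun x => ?_)
          simp only [Circle.smul_def, smul_eq_mul, map_mul, AddChar.map_neg_eq_inv,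
            Circle.coe_inv_eq_conj, Complex.conj_conj]
        rw [h2, h1, RCLike.inner_apply, map_mul, Complex.conj_conj]
        ring

end

/-! ### Hilbert–Schmidt operators and traces -/

section

open scoped ENNReal BoundedContinuousFunction ComplexConjugate

/-- The Hilbert–Schmidt norm of `A` is at most `c`. -/
def HSBound (A : L2 →L[ℂ] L2) (c : ℝ) : Prop :=
  0 ≤ c ∧ ∀ (ι : Type) (e : HilbertBasis ι ℂ L2) (s : Finset ι), ∑ i ∈ s, ‖A (e i)‖ ^ 2 ≤ c ^ 2

theorem HSBound.summable {A : L2 →L[ℂ] L2} {c : ℝ} (hA : HSBound A c) {ι : Type}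
    (e : HilbertBasis ι ℂ L2) : Summable fun i => ‖A (e i)‖ ^ 2 :=
  summable_of_sum_le (fun _ => sq_nonneg _) (hA.2 ι e)

theorem HSBound.tsum_le {A : L2 →L[ℂ] L2} {c : ℝ} (hA : HSBound A c) {ι : Type}
    (e : HilbertBasis ι ℂ L2) : ∑' i, ‖A (e i)‖ ^ 2 ≤ c ^ 2 :=
  (hA.summable e).tsum_le_of_sum_le (hA.2 ι e)

theorem hasSum_norm_inner_sq {ι : Type} (e : HilbertBasis ι ℂ L2) (x : L2) :
    HasSum (fun i => ‖⟪e i, x⟫_ℂ‖ ^ 2) (‖x‖ ^ 2) := by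
  have h := Complex.hasSum_re (e.hasSum_inner_mul_inner x x)
  have h2 : (⟪x, x⟫_ℂ).re = ‖x‖ ^ 2 := by
    rw [inner_self_eq_norm_sq_to_K]
    norm_cast
  rw [h2] at h
  convert h using 2 with i
  rw [← inner_conj_symm x (e i), mul_comm, Complex.mul_conj, Complex.normSq_eq_norm_sq,
    Complex.ofReal_re]

theorem HSBound.comp_left {A : L2 →L[ℂ] L2} {c : ℝ} (hA : HSBound A c) (C : L2 →L[ℂ] L2) :
    HSBound (C ∘L A) (‖C‖ * c) := by
  refine ⟨mul_nonneg (norm_nonneg _) hA.1, fun ι e s => ?_⟩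
  calc ∑ i ∈ s, ‖C (A (e i))‖ ^ 2 ≤ ∑ i ∈ s, ‖C‖ ^ 2 * ‖A (e i)‖ ^ 2 := by
        refine Finset.sum_le_sum fun i _ => ?_
        rw [← mul_pow]
        gcongr
        exact C.le_opNorm _
    _ = ‖C‖ ^ 2 * ∑ i ∈ s, ‖A (e i)‖ ^ 2 := by rw [Finset.mul_sum]
    _ ≤ ‖C‖ ^ 2 * c ^ 2 := by gcongr; exact hA.2 ι e s
    _ = _ := by ring

theorem HSBound.mono {A : L2 →L[ℂ] L2} {c d : ℝ} (hA : HSBound A c) (h : c ≤ d) : HSBound A d :=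
  ⟨hA.1.trans h, fun ι e s => (hA.2 ι e s).trans (by have := hA.1; gcongr)⟩

/-- Expand `‖A* f_j‖²` in the same basis, exchange the sums, and use Bessel's inequality for `A
f_i`. -/
theorem HSBound.adjoint {A : L2 →L[ℂ] L2} {c : ℝ} (hA : HSBound A c) :
    HSBound (ContinuousLinearMap.adjoint A) c := by
  refine ⟨hA.1, fun ι f s => ?_⟩
  have h1 : HasSum (fun i => ∑ j ∈ s, ‖⟪f i, ContinuousLinearMap.adjoint A (f j)⟫_ℂ‖ ^ 2)
      (∑ j ∈ s, ‖ContinuousLinearMap.adjoint A (f j)‖ ^ 2) :=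
    hasSum_sum fun j _ => hasSum_norm_inner_sq f _
  refine (h1.tsum_eq ▸ Summable.tsum_le_tsum (fun i => ?_) h1.summable (hA.summable f)).trans
    (hA.tsum_le f)
  have h2 : ∀ j, ‖⟪f i, ContinuousLinearMap.adjoint A (f j)⟫_ℂ‖ = ‖⟪f j, A (f i)⟫_ℂ‖ := by
    intro j
    rw [ContinuousLinearMap.adjoint_inner_right, norm_inner_symm]
  simp only [h2]
  exact sum_le_hasSum s (fun _ _ => sq_nonneg _) (hasSum_norm_inner_sq f (A (f i)))

/-- The matrix elements of a product of Hilbert–Schmidt operators. -/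
theorem inner_comp_eq (A B : L2 →L[ℂ] L2) (x : L2) :
    ⟪x, (A ∘L B) x⟫_ℂ = ⟪ContinuousLinearMap.adjoint A x, B x⟫_ℂ :=
  (ContinuousLinearMap.adjoint_inner_left A (B x) x).symm

theorem summable_norm_mul_norm {A B : L2 →L[ℂ] L2} {c d : ℝ} (hA : HSBound A c)
    (hB : HSBound B d) {ι : Type} (e : HilbertBasis ι ℂ L2) :
    Summable (fun i => ‖A (e i)‖ * ‖B (e i)‖) ∧ ∑' i, ‖A (e i)‖ * ‖B (e i)‖ ≤ c * d := by
  have h : ∀ s : Finset ι, ∑ i ∈ s, ‖A (e i)‖ * ‖B (e i)‖ ≤ c * d := fun s => by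
    refine (Real.sum_mul_le_sqrt_mul_sqrt s _ _).trans ?_
    exact mul_le_mul (Real.sqrt_le_iff.2 ⟨hA.1, hA.2 ι e s⟩) (Real.sqrt_le_iff.2
      ⟨hB.1, hB.2 ι e s⟩) (Real.sqrt_nonneg _) hA.1
  have h1 : Summable (fun i => ‖A (e i)‖ * ‖B (e i)‖) :=
    summable_of_sum_le (fun _ => by positivity) h
  exact ⟨h1, h1.tsum_le_of_sum_le h⟩

theorem HSBound.summable_prod {A : L2 →L[ℂ] L2} {c : ℝ} (hA : HSBound A c) {ι κ : Type}
    (e : HilbertBasis ι ℂ L2) (f : HilbertBasis κ ℂ L2) :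
    Summable fun p : ι × κ => ‖⟪f p.2, A (e p.1)⟫_ℂ‖ ^ 2 := by
  rw [summable_prod_of_nonneg (fun _ => sq_nonneg _)]
  refine ⟨fun i => (hasSum_norm_inner_sq f (A (e i))).summable, ?_⟩
  exact (hA.summable e).congr fun i => (hasSum_norm_inner_sq f (A (e i))).tsum_eq.symm

theorem HSBound.summable_inner_prod {A B : L2 →L[ℂ] L2} {c d : ℝ} (hA : HSBound A c)
    (hB : HSBound B d) {ι κ : Type} (e : HilbertBasis ι ℂ L2) (f : HilbertBasis κ ℂ L2) :
    Summable fun p : ι × κ => ⟪A (e p.1), f p.2⟫_ℂ * ⟪f p.2, B (e p.1)⟫_ℂ := by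
  refine Summable.of_norm_bounded ((hA.summable_prod e f).add (hB.summable_prod e f)) fun p => ?_
  rw [norm_mul, norm_inner_symm]
  generalize ‖⟪f p.2, A (e p.1)⟫_ℂ‖ = r
  generalize ‖⟪f p.2, B (e p.1)⟫_ℂ‖ = t
  nlinarith [sq_nonneg (r - t), sq_nonneg r, sq_nonneg t]

/-- `Tr (A B) = Tr (B A)`, with the two traces taken in possibly different bases: both are sums of
one absolutely summable double family. Applying it twice shows that the trace is independent of the
basis. -/
theorem tsum_inner_adjoint {A B : L2 →L[ℂ] L2} {c d : ℝ} (hA : HSBound A c) (hB : HSBound B d)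
    {ι κ : Type} (e : HilbertBasis ι ℂ L2) (f : HilbertBasis κ ℂ L2) :
    ∑' i, ⟪ContinuousLinearMap.adjoint A (e i), B (e i)⟫_ℂ =
      ∑' j, ⟪ContinuousLinearMap.adjoint B (f j), A (f j)⟫_ℂ := by
  have hF := hA.adjoint.summable_inner_prod hB e f
  have h1 : ∀ i, ∑' j, ⟪ContinuousLinearMap.adjoint A (e i), f j⟫_ℂ * ⟪f j, B (e i)⟫_ℂ =
      ⟪ContinuousLinearMap.adjoint A (e i), B (e i)⟫_ℂ :=
    fun i => f.tsum_inner_mul_inner _ _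
  have h2 : ∀ j, ∑' i, ⟪ContinuousLinearMap.adjoint A (e i), f j⟫_ℂ * ⟪f j, B (e i)⟫_ℂ =
      ⟪ContinuousLinearMap.adjoint B (f j), A (f j)⟫_ℂ := by
    intro j
    rw [← e.tsum_inner_mul_inner]
    refine tsum_congr fun i => ?_
    rw [ContinuousLinearMap.adjoint_inner_left, ContinuousLinearMap.adjoint_inner_left, mul_comm]
  simp only [← h1, ← h2]
  exact (Summable.tsum_comm hF).symm

/-- Basis vectors are `√2` apart in a separable space. Countability is needed to exchange sums with
integrals and to intersect almost-everywhere statements. -/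
theorem countable_of_hilbertBasis {ι : Type} (e : HilbertBasis ι ℂ L2) : Countable ι := by
  have : Fact ((2 : ℝ≥0∞) ≠ ⊤) := ⟨by norm_num⟩
  have : SecondCountableTopology L2 := Lp.SecondCountableTopology
  refine Pairwise.countable_of_isOpen_disjoint (s := fun i => Metric.ball (e i) (1 / 2)) ?_
    (fun _ => Metric.isOpen_ball) fun i => ⟨e i, Metric.mem_ball_self (by norm_num)⟩
  intro i j hij
  refine Metric.ball_disjoint_ball ?_
  have h2 : ‖e i - e j‖ ^ 2 = 2 := by
    rw [@norm_sub_sq ℂ, e.orthonormal.2 hij, e.orthonormal.1, e.orthonormal.1]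
    simp
    norm_num
  rw [dist_eq_norm]
  nlinarith [norm_nonneg (e i - e j)]

theorem exists_basis : ∃ (ι : Type), Nonempty (HilbertBasis ι ℂ L2) := by
  obtain ⟨w, b, _⟩ := exists_hilbertBasis ℂ L2
  exact ⟨w, ⟨b⟩⟩

/-- The index type of a fixed Hilbert basis of `L²`. -/
def BasisIndex : Type := exists_basis.choose

/-- A fixed Hilbert basis of `L²`. -/
def fixedBasis : HilbertBasis BasisIndex ℂ L2 := exists_basis.choose_spec.some

/-- The trace of an operator in the fixed Hilbert basis. -/
def opTrace (T : L2 →L[ℂ] L2) : ℂ := ∑' i, ⟪fixedBasis i, T (fixedBasis i)⟫_ℂ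

theorem HSBound.summable_inner_comp {A B : L2 →L[ℂ] L2} {c d : ℝ} (hA : HSBound A c)
    (hB : HSBound B d) {ι : Type} (e : HilbertBasis ι ℂ L2) :
    Summable fun i => ‖⟪e i, (A ∘L B) (e i)⟫_ℂ‖ := by
  refine .of_nonneg_of_le (fun _ => norm_nonneg _) (fun i => ?_)
    (summable_norm_mul_norm hA.adjoint hB e).1
  rw [inner_comp_eq]
  exact norm_inner_le_norm _ _

theorem HSBound.tsum_norm_inner_comp_le {A B : L2 →L[ℂ] L2} {c d : ℝ} (hA : HSBound A c)
    (hB : HSBound B d) {ι : Type} (e : HilbertBasis ι ℂ L2) :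
    ∑' i, ‖⟪e i, (A ∘L B) (e i)⟫_ℂ‖ ≤ c * d := by
  have h := summable_norm_mul_norm hA.adjoint hB e
  refine (Summable.tsum_le_tsum (fun i => ?_) (hA.summable_inner_comp hB e) h.1).trans h.2
  rw [inner_comp_eq]
  exact norm_inner_le_norm _ _

theorem HSBound.hasTrace {A B : L2 →L[ℂ] L2} {c d : ℝ} (hA : HSBound A c)
    (hB : HSBound B d) : HasTrace (A ∘L B) (opTrace (A ∘L B)) := by
  intro ι e
  have h : opTrace (A ∘L B) = ∑' i, ⟪e i, (A ∘L B) (e i)⟫_ℂ := by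
    simp only [opTrace, inner_comp_eq]
    rw [tsum_inner_adjoint hA hB fixedBasis fixedBasis, ← tsum_inner_adjoint hA hB e fixedBasis]
  rw [h]
  exact (hA.summable_inner_comp hB e).of_norm.hasSum

theorem HasTrace.eq_opTrace {T : L2 →L[ℂ] L2} {τ : ℂ} (h : HasTrace T τ) : τ = opTrace T :=
  (h _ fixedBasis).tsum_eq.symm

theorem HSBound.norm_opTrace_le {A B : L2 →L[ℂ] L2} {c d : ℝ} (hA : HSBound A c)
    (hB : HSBound B d) : ‖opTrace (A ∘L B)‖ ≤ c * d :=
  (norm_tsum_le_tsum_norm (hA.summable_inner_comp hB fixedBasis)).trans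
    (hA.tsum_norm_inner_comp_le hB fixedBasis)

theorem norm_sq_L2 (u : L2) : ‖u‖ ^ 2 = ∫ x, ‖u x‖ ^ 2 := by
  have h : (⟪u, u⟫_ℂ).re = ‖u‖ ^ 2 := by
    rw [inner_self_eq_norm_sq_to_K]
    norm_cast
  rw [← h, L2.inner_def]
  have h2 : ∀ x, ⟪u x, u x⟫_ℂ = ((‖u x‖ ^ 2 : ℝ) : ℂ) := by
    intro x
    rw [inner_self_eq_norm_sq_to_K]
    norm_cast
  simp only [h2]
  rw [integral_complex_ofReal, Complex.ofReal_re]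

theorem integrable_norm_sq_L2 (u : L2) : Integrable (fun x => ‖u x‖ ^ 2) volume :=
  (Lp.memLp u).integrable_norm_pow (by norm_num)

/-- At each point `x`, the map `u ↦ multBC m u x` is an inner product with a vector of norm at most
`‖m‖`, so Bessel bounds the sum of `|multBC m (e i) x|²` by `‖m‖²`. Integrating against `|χ|²` gives
the claim. -/
theorem hsBound_mulMult (χ m : L2) : HSBound (mulMult χ m) (‖χ‖ * ‖m‖) := by
  refine ⟨by positivity, fun ι e s => ?_⟩
  have hpt : ∀ x : E3, ∑ i ∈ s, ‖multBC m (e i) x‖ ^ 2 ≤ ‖m‖ ^ 2 := by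
    intro x
    let ℓ : StrongDual ℂ L2 := BoundedContinuousFunction.evalCLM ℂ x ∘L multBC m
    have hℓ : ‖ℓ‖ ≤ ‖m‖ := ContinuousLinearMap.opNorm_le_bound _ (norm_nonneg _) fun u =>
      ((multBC m u).norm_coe_le_norm x).trans (norm_multBC_apply_le m u)
    let y : L2 := (InnerProductSpace.toDual ℂ L2).symm ℓ
    have hy : ‖y‖ ≤ ‖m‖ := by rwa [LinearIsometryEquiv.norm_map]
    have h1 : ∀ i, ‖multBC m (e i) x‖ = ‖⟪e i, y⟫_ℂ‖ := by
      intro i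
      rw [norm_inner_symm, InnerProductSpace.toDual_symm_apply]
      rfl
    simp only [h1]
    refine (sum_le_hasSum s (fun _ _ => sq_nonneg _) (hasSum_norm_inner_sq e y)).trans ?_
    gcongr
  have h2 : ∀ i, ‖mulMult χ m (e i)‖ ^ 2 = ∫ x, ‖χ x‖ ^ 2 * ‖multBC m (e i) x‖ ^ 2 := by
    intro i
    rw [norm_sq_L2]
    refine integral_congr_ae ?_
    filter_upwards [coeFn_mulMult χ m (e i)] with x hx
    rw [hx, norm_mul, mul_pow]
  have h3 : ∀ i, Integrable (fun x => ‖χ x‖ ^ 2 * ‖multBC m (e i) x‖ ^ 2) volume := by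
    intro i
    refine (integrable_norm_sq_L2 (mulMult χ m (e i))).congr ?_
    filter_upwards [coeFn_mulMult χ m (e i)] with x hx
    rw [hx, norm_mul, mul_pow]
  simp only [h2]
  rw [← integral_finsetSum _ fun i _ => h3 i, mul_pow, norm_sq_L2 χ, ← integral_mul_const]
  refine integral_mono (integrable_finsetSum _ fun i _ => h3 i)
    ((integrable_norm_sq_L2 χ).mul_const _) fun x => ?_
  simp only [← Finset.mul_sum]
  gcongr
  exact hpt x

end

/-! ### The trace formula in Fourier variables -/

section

open scoped ENNReal ComplexConjugate

theorem inner_fourierInv_left (a u : L2) : ⟪(𝓕⁻ a : L2), u⟫_ℂ = ⟪a, (𝓕 u : L2)⟫_ℂ := by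
  rw [← Lp.inner_fourier_eq (𝓕⁻ a : L2) u, FourierTransform.fourier_fourierInv_eq]

/-- Parseval's identity for the coefficients of two functions in the Fourier transform of a
Hilbert basis. -/
theorem hasSum_fourier_parseval {ι : Type} (e : HilbertBasis ι ℂ L2) (a b : L2) :
    HasSum (fun i => conj (⟪a, (𝓕 (e i) : L2)⟫_ℂ) * ⟪b, (𝓕 (e i) : L2)⟫_ℂ) ⟪b, a⟫_ℂ := by
  have h := e.hasSum_inner_mul_inner (𝓕⁻ b : L2) (𝓕⁻ a : L2)
  have h2 : ⟪(𝓕⁻ b : L2), (𝓕⁻ a : L2)⟫_ℂ = ⟪b, a⟫_ℂ := by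
    rw [inner_fourierInv_left, FourierTransform.fourier_fourierInv_eq]
  rw [h2] at h
  have h3 : ∀ i, ⟪(𝓕⁻ b : L2), e i⟫_ℂ * ⟪e i, (𝓕⁻ a : L2)⟫_ℂ =
      conj (⟪a, (𝓕 (e i) : L2)⟫_ℂ) * ⟪b, (𝓕 (e i) : L2)⟫_ℂ := by
    intro i
    rw [← inner_conj_symm (e i), inner_fourierInv_left, inner_fourierInv_left, mul_comm]
  simpa only [h3] using h

theorem inner_star_eq_integral (a u : L2) : ⟪star a, u⟫_ℂ = ∫ q, a q * u q := by
  rw [L2.inner_def]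
  refine integral_congr_ae ?_
  filter_upwards [Lp.coeFn_star a] with q hq
  rw [hq, RCLike.inner_apply, Pi.star_apply, RCLike.star_def, Complex.conj_conj, mul_comm]

/-- For fixed `k` the transform of `φ R u` is a convolution integral, written as an inner product
with `𝓕 u` so that Parseval can be applied over a basis with `k` frozen. -/
theorem Far.fourier_mulMult_resTwo {δ : ℝ} {z : ℂ} (hδ : 0 < δ) (hz : Far δ z) (φ u : L2) :
    (𝓕 (mulMult φ (resTwo z) u) : L2) =ᵐ[volume]
      fun k => ⟪star (mulInf (resInf z) (fourierShift k φ)), (𝓕 u : L2)⟫_ℂ := by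
  have h1 := hz.coeFn_mulMult_resTwo hδ φ u
  have hi : Integrable (fun x => φ x * freeRes z u x) volume :=
    (Lp.memLp φ).integrable_mul (Lp.memLp (freeRes z u))
  filter_upwards [fourier_eq_integral (hi.congr h1.symm)] with k hk
  rw [hk, Real.fourier_congr_ae h1, fourier_mul_eq_integral, inner_star_eq_integral]
  refine integral_congr_ae ?_
  filter_upwards [hz.fourier_freeRes hδ u, coeFn_mulInf (resInf z) (fourierShift k φ),
    coeFn_fourierShift k φ, hz.coeFn_resInf hδ] with q h2 h3 h4 h5
  rw [h2, h3, h4, h5]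
  ring

theorem Far.fourier_adjoint_mulMult_resTwo {δ : ℝ} {z : ℂ} (hδ : 0 < δ) (hz : Far δ z) (X u : L2) :
    (𝓕 (ContinuousLinearMap.adjoint (mulMult (star X) (resTwo z)) u) : L2) =ᵐ[volume]
      fun k => conj (resSymbol z k) * ⟪star (fourierShift k X), (𝓕 u : L2)⟫_ℂ := by
  filter_upwards [fourier_adjoint_mulMult X (resTwo z) u, hz.coeFn_resTwo hδ] with k h1 h2
  rw [h1, h2, fourier_mul_eq_integral, inner_star_eq_integral]
  congr 1
  refine integral_congr_ae ?_
  filter_upwards [coeFn_fourierShift k X] with q h4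
  rw [h4]

theorem inner_eq_integral_fourier (u v : L2) :
    ⟪u, v⟫_ℂ = ∫ k, conj ((𝓕 u : L2) k) * (𝓕 v : L2) k := by
  rw [← Lp.inner_fourier_eq u v, L2.inner_def]
  refine integral_congr_ae (.of_forall fun k => ?_)
  simp only [RCLike.inner_apply]
  ring

theorem integrable_conj_mul (u v : L2) : Integrable (fun k => conj (u k) * v k) volume := by
  have : Integrable (fun k => (star u) k * v k) volume :=
    (Lp.memLp (star u)).integrable_mul (Lp.memLp v)
  refine this.congr ?_
  filter_upwards [Lp.coeFn_star u] with k h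
  rw [h]
  rfl

theorem integral_norm_conj_mul_le (u v : L2) :
    ∫ k, ‖conj (u k) * v k‖ ≤ ‖u‖ ^ 2 + ‖v‖ ^ 2 := by
  rw [norm_sq_L2, norm_sq_L2, ← integral_add (integrable_norm_sq_L2 u) (integrable_norm_sq_L2 v)]
  refine integral_mono (integrable_conj_mul u v).norm
    ((integrable_norm_sq_L2 u).add (integrable_norm_sq_L2 v)) fun k => ?_
  simp only [norm_mul, RCLike.norm_conj]
  nlinarith [sq_nonneg (‖u k‖ - ‖v k‖), sq_nonneg ‖u k‖, sq_nonneg ‖v k‖]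

/-- The trace is a sum of integrals over `k` of products of transforms. Hilbert–Schmidt summability
allows summing under the integral, and for almost every `k` Parseval collapses the sum into the
integral over `q`. Conjugating the test function matches the sesquilinear inner product. -/
theorem Far.opTrace_eq {δ : ℝ} {z : ℂ} (hδ : 0 < δ) (hz : Far δ z) (X φ : L2) :
    opTrace (mulMult (star X) (resTwo z) ∘L mulMult φ (resTwo z)) =
      ∫ k, resSymbol z k * ∫ q, resSymbol z q *
        ((𝓕 φ : L2) (k - q) * conj ((𝓕 X : L2) (k - q))) := by
  set A := mulMult (star X) (resTwo z)
  set B := mulMult φ (resTwo z)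
  have hA : HSBound A _ := hsBound_mulMult _ _
  have hB : HSBound B _ := hsBound_mulMult _ _
  let e := fixedBasis
  have := countable_of_hilbertBasis e
  let F : BasisIndex → E3 → ℂ := fun i k =>
    conj ((𝓕 (ContinuousLinearMap.adjoint A (e i)) : L2) k) * (𝓕 (B (e i)) : L2) k
  have hF : ∀ i, Integrable (F i) volume := fun i => integrable_conj_mul _ _
  have hS : Summable fun i => ∫ k, ‖F i k‖ := by
    refine .of_nonneg_of_le (fun i => integral_nonneg fun _ => norm_nonneg _)
      (fun i => integral_norm_conj_mul_le _ _) ?_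
    simp only [Lp.norm_fourier_eq]
    exact (hA.adjoint.summable e).add (hB.summable e)
  have h1 := hasSum_integral_of_summable_integral_norm hF hS
  have h2 : opTrace (A ∘L B) = ∑' i, ∫ k, F i k := by
    rw [opTrace]
    refine tsum_congr fun i => ?_
    rw [inner_comp_eq, inner_eq_integral_fourier]
  rw [h2, h1.tsum_eq]
  have h3 : ∀ᵐ k ∂(volume : Measure E3), ∀ i, F i k = resSymbol z k *
      (conj (⟪star (fourierShift k X), (𝓕 (e i) : L2)⟫_ℂ) *
        ⟪star (mulInf (resInf z) (fourierShift k φ)), (𝓕 (e i) : L2)⟫_ℂ) := by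
    refine ae_all_iff.2 fun i => ?_
    filter_upwards [hz.fourier_adjoint_mulMult_resTwo hδ X (e i),
      hz.fourier_mulMult_resTwo hδ φ (e i)] with k h1 h2
    simp only [F]
    rw [h1, h2, map_mul, Complex.conj_conj]
    ring
  refine integral_congr_ae ?_
  filter_upwards [h3] with k hk
  simp only [hk]
  rw [((hasSum_fourier_parseval e _ _).mul_left _).tsum_eq, inner_star_eq_integral]
  congr 1
  refine integral_congr_ae ?_
  filter_upwards [coeFn_fourierShift k X, coeFn_fourierShift k φ, hz.coeFn_resInf hδ,
    coeFn_mulInf (resInf z) (fourierShift k φ), Lp.coeFn_star (fourierShift k X)]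
    with q h4 h5 h6 h7 h8
  rw [h7, h6, h8, Pi.star_apply, h4, h5]
  simp only [RCLike.star_def]
  ring

end

/-! ### The contour integral of the traces -/

section

open scoped ENNReal ComplexConjugate

theorem far_of_notMem_halfStrip {a α : ℝ} {z : ℂ} (hz : z ∉ halfStrip a α) :
    Far (min a α) z := by
  intro t ht
  have h : z.re ≤ -a ∨ α ≤ |z.im| := by
    by_contra! h
    exact hz h
  rcases h with h | h
  · refine (min_le_left a α).trans ?_
    have := Complex.abs_re_le_norm (z - t)
    rw [Complex.sub_re, Complex.ofReal_re] at this
    refine le_trans ?_ this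
    rw [abs_sub_comm]
    exact le_trans (by linarith) (le_abs_self _)
  · refine (min_le_right a α).trans ?_
    have := Complex.abs_im_le_norm (z - t)
    rw [Complex.sub_im, Complex.ofReal_im, sub_zero] at this
    exact h.trans this

theorem notMem_halfStrip_of_mem_contour {a α : ℝ} {z : ℂ} (hz : z ∈ contour a α) :
    z ∉ halfStrip a α := by
  rintro ⟨h1, h2⟩
  rcases hz with ⟨_, h⟩ | ⟨h, _⟩
  · exact h2.ne h
  · exact h1.ne' h

theorem far_of_mem_contour {a α : ℝ} {z : ℂ} (hz : z ∈ contour a α) : Far (min a α) z :=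
  far_of_notMem_halfStrip (notMem_halfStrip_of_mem_contour hz)

variable {β μ a α : ℝ}

/-- The weight `-f(z) dz / (2πi)` of the contour integral. -/
def weight (β μ α : ℝ) (z : ℂ) : ℂ := -(2 * Real.pi * Complex.I)⁻¹ * (dir α z * fermi β μ z)

theorem measurable_weight : Measurable (weight β μ α) := by
  unfold weight
  have := measurable_dir α
  have := measurable_fermi (β := β) (μ := μ)
  fun_prop

theorem growth_le (δ : ℝ) (z : ℂ) : growth δ z ≤ (1 + δ⁻¹) * (1 + ‖z‖) := by
  unfold growth
  have : (1 + ‖z‖) / δ = δ⁻¹ * (1 + ‖z‖) := by ring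
  nlinarith [norm_nonneg z]

theorem continuous_growth (δ : ℝ) : Continuous (growth δ) := by
  unfold growth
  fun_prop

theorem integrable_weight_growth (hβ : 0 < β) (ha : 0 < a) (hα : 0 < α) (h : α * β < Real.pi) :
    Integrable (fun z => ‖weight β μ α z‖ * growth (min a α) z ^ 2) (contourMeasure a α) := by
  have hδ : 0 < min a α := lt_min ha hα
  have hi := (integrable_fermi_weight (μ := μ) hβ ha hα h).const_mul
    (‖(2 * Real.pi * Complex.I : ℂ)⁻¹‖ * (1 + (min a α)⁻¹) ^ 2)
  refine hi.mono' ?_ (.of_forall fun z => ?_)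
  · exact (measurable_weight.norm.mul
      ((continuous_growth _).measurable.pow_const 2)).aestronglyMeasurable
  · have h1 : ‖weight β μ α z‖ = ‖(2 * Real.pi * Complex.I : ℂ)⁻¹‖ * ‖fermi β μ z‖ := by
      rw [weight, norm_mul, norm_mul, norm_neg, norm_dir, one_mul]
    rw [Real.norm_of_nonneg (by positivity), h1]
    have h2 : growth (min a α) z ^ 2 ≤ ((1 + (min a α)⁻¹) * (1 + ‖z‖)) ^ 2 := by
      have := growth_le (min a α) z
      have := (growth_pos hδ z).le
      gcongr
    calc _ ≤ ‖(2 * Real.pi * Complex.I : ℂ)⁻¹‖ * ‖fermi β μ z‖ *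
          ((1 + (min a α)⁻¹) * (1 + ‖z‖)) ^ 2 := by gcongr
      _ = _ := by ring

theorem occ_eq_fermi (t : ℝ) : fermi β μ t = (occ β μ t : ℂ) := by
  rw [fermi, fermiDirac, occ]
  push_cast
  rfl

theorem integral_weight_resSymbol (hβ : 0 < β) (ha : 0 < a) (hα : 0 < α)
    (h : α * β < Real.pi) {ξ η : E3} (hne : ‖ξ‖ ≠ ‖η‖) :
    ∫ z, weight β μ α z * (resSymbol z ξ * resSymbol z η) ∂contourMeasure a α =
      (occQuot β μ ((2 * Real.pi * ‖ξ‖) ^ 2) ((2 * Real.pi * ‖η‖) ^ 2) : ℂ) := by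
  have hs : ∀ x : E3, sqSymbol x = (2 * Real.pi * ‖x‖) ^ 2 := fun x => by
    rw [sqSymbol]
    ring
  have hne' : sqSymbol ξ ≠ sqSymbol η := by
    rw [hs, hs, Ne, sq_eq_sq₀ (by positivity) (by positivity)]
    exact fun h => hne (mul_left_cancel₀ (by positivity) h)
  have e := integral_fermi_mul_inv_mul_inv (μ := μ) hβ ha hα h (sqSymbol_nonneg ξ)
    (sqSymbol_nonneg η) hne'
  simp only [occ_eq_fermi] at e
  rw [← hs, ← hs, occQuot]
  push_cast
  exact e

/-- The symbol of the linear response operator. -/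
def responseSymbol (β μ : ℝ) (ξ : E3) : ℂ := (symbol β μ (2 * Real.pi * ‖ξ‖) : ℂ)

/-- The kernel of the trace formula. -/
def traceKernel (z : ℂ) (G : E3 → ℂ) (p : E3 × E3) : ℂ :=
  resSymbol z p.2 * (resSymbol z (p.2 - p.1) * G p.1)

/-- The bound on the kernel of the trace formula, up to a growth factor. -/
def decayKernel (G : E3 → ℂ) (p : E3 × E3) : ℝ :=
  (1 + sqSymbol p.2)⁻¹ * ((1 + sqSymbol (p.2 - p.1))⁻¹ * ‖G p.1‖)

theorem Far.norm_traceKernel_le {δ : ℝ} {z : ℂ} (hδ : 0 < δ) (hz : Far δ z) (G : E3 → ℂ)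
    (p : E3 × E3) : ‖traceKernel z G p‖ ≤ growth δ z ^ 2 * decayKernel G p := by
  have h1 := hz.norm_resSymbol_le_growth hδ p.2
  have h2 := hz.norm_resSymbol_le_growth hδ (p.2 - p.1)
  have h3 := sqSymbol_nonneg p.2
  have h4 := (growth_pos hδ z).le
  rw [traceKernel, norm_mul, norm_mul]
  calc _ ≤ (growth δ z * (1 + sqSymbol p.2)⁻¹) *
        ((growth δ z * (1 + sqSymbol (p.2 - p.1))⁻¹) * ‖G p.1‖) := by gcongr
    _ = _ := by rw [decayKernel]; ring

theorem aestronglyMeasurable_comp_fst {G : E3 → ℂ} (hG : AEStronglyMeasurable G volume) :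
    AEStronglyMeasurable (fun p : E3 × E3 => G p.1) (volume.prod volume) :=
  hG.comp_quasiMeasurePreserving Measure.quasiMeasurePreserving_fst

/-- The `k`-integral at fixed `l` is bounded uniformly in `l`, by `a b ≤ a² + b²` and translation
invariance; what remains is `∫ ‖G‖`. -/
theorem integrable_decayKernel {G : E3 → ℂ} (hG : Integrable G) :
    Integrable (decayKernel G) (volume.prod volume) := by
  have hd := memLp_inv_one_add_sqSymbol
  have hm : Measurable fun ξ : E3 => (1 + sqSymbol ξ)⁻¹ := by
    have := continuous_sqSymbol.measurable
    fun_prop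
  have hpos : ∀ ξ : E3, 0 ≤ (1 + sqSymbol ξ)⁻¹ := fun ξ => by
    have := sqSymbol_nonneg ξ
    positivity
  have hmeas : AEStronglyMeasurable (decayKernel G) (volume.prod volume) := by
    unfold decayKernel
    refine ((hm.comp measurable_snd).aestronglyMeasurable).mul
      ((hm.comp (measurable_snd.sub measurable_fst)).aestronglyMeasurable.mul ?_)
    exact (aestronglyMeasurable_comp_fst hG.1).norm
  have hsq : Integrable (fun ξ : E3 => ((1 + sqSymbol ξ)⁻¹) ^ 2) := hd.integrable_sq
  set C := ∫ ξ : E3, ((1 + sqSymbol ξ)⁻¹) ^ 2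
  have hsec : ∀ l : E3, Integrable fun k : E3 => (1 + sqSymbol k)⁻¹ * (1 + sqSymbol (k - l))⁻¹ :=
    fun l => hd.integrable_mul (hd.comp_measurePreserving (measurePreserving_sub_right volume l))
  have hle : ∀ l : E3, ∫ k : E3, (1 + sqSymbol k)⁻¹ * (1 + sqSymbol (k - l))⁻¹ ≤ C + C := by
    intro l
    have e : ∫ k : E3, ((1 + sqSymbol (k - l))⁻¹) ^ 2 = C :=
      integral_sub_right_eq_self (fun k : E3 => ((1 + sqSymbol k)⁻¹) ^ 2) l
    nth_rewrite 2 [← e]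
    rw [← integral_add hsq (hsq.comp_sub_right l)]
    refine integral_mono (hsec l) (hsq.add (hsq.comp_sub_right l)) fun k => ?_
    have h1 := hpos k
    have h2 := hpos (k - l)
    nlinarith [sq_nonneg ((1 + sqSymbol k)⁻¹ - (1 + sqSymbol (k - l))⁻¹)]
  rw [integrable_prod_iff hmeas]
  constructor
  · refine .of_forall fun l => ?_
    refine ((hsec l).mul_const ‖G l‖).congr (.of_forall fun k => ?_)
    simp only [decayKernel]
    ring
  · refine (hG.norm.const_mul (C + C)).mono' hmeas.norm.integral_prod_right' (.of_forall fun l => ?_)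
    have e : ∀ k, ‖decayKernel G (l, k)‖ =
        ((1 + sqSymbol k)⁻¹ * (1 + sqSymbol (k - l))⁻¹) * ‖G l‖ := by
      intro k
      have h1 := hpos k
      have h2 := hpos (k - l)
      simp only [decayKernel]
      rw [Real.norm_of_nonneg (by positivity)]
      ring
    simp only [e]
    rw [integral_mul_const, Real.norm_of_nonneg]
    · gcongr
      exact hle l
    · exact mul_nonneg (integral_nonneg fun k => mul_nonneg (hpos _) (hpos _)) (norm_nonneg _)

theorem aestronglyMeasurable_traceKernel {G : E3 → ℂ} (hG : Integrable G) (z : ℂ) :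
    AEStronglyMeasurable (traceKernel z G) (volume.prod volume) := by
  unfold traceKernel
  have h := measurable_resSymbol_right z
  exact (h.comp measurable_snd).aestronglyMeasurable.mul
    ((h.comp (measurable_snd.sub measurable_fst)).aestronglyMeasurable.mul
      (aestronglyMeasurable_comp_fst hG.1))

theorem Far.integrable_traceKernel {δ : ℝ} {z : ℂ} (hδ : 0 < δ) (hz : Far δ z) {G : E3 → ℂ}
    (hG : Integrable G) : Integrable (traceKernel z G) (volume.prod volume) :=
  ((integrable_decayKernel hG).const_mul (growth δ z ^ 2)).mono'
    (aestronglyMeasurable_traceKernel hG z) (.of_forall fun p => hz.norm_traceKernel_le hδ G p)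

/-- The change of variable `l = k - q` isolates the potential and test function in a factor of `l`
alone, so that `z` and `k` can be integrated out first. -/
theorem Far.opTrace_eq_integral_prod {δ : ℝ} {z : ℂ} (hδ : 0 < δ) (hz : Far δ z) (X φ : L2) :
    opTrace (mulMult (star X) (resTwo z) ∘L mulMult φ (resTwo z)) =
      ∫ p, traceKernel z (fun l => (𝓕 φ : L2) l * conj ((𝓕 X : L2) l)) p
        ∂(volume.prod volume) := by
  have hG : Integrable (fun l => (𝓕 φ : L2) l * conj ((𝓕 X : L2) l)) volume :=
    (integrable_conj_mul (𝓕 X : L2) (𝓕 φ : L2)).congr (.of_forall fun l => mul_comm _ _)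
  rw [hz.opTrace_eq hδ, integral_prod_symm _ (hz.integrable_traceKernel hδ hG)]
  refine integral_congr_ae (.of_forall fun k => ?_)
  simp only [traceKernel]
  rw [integral_const_mul, ← integral_sub_left_eq_self _ volume k]
  simp only [sub_sub_cancel]

theorem ae_far (hα : 0 < α) : ∀ᵐ z ∂contourMeasure a α, Far (min a α) z := by
  filter_upwards [ae_mem_contour hα] with z hz
  exact far_of_mem_contour hz

theorem integrable_weight_traceKernel (hβ : 0 < β) (ha : 0 < a) (hα : 0 < α)
    (h : α * β < Real.pi) {G : E3 → ℂ} (hG : Integrable G) :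
    Integrable (fun q : ℂ × (E3 × E3) => weight β μ α q.1 * traceKernel q.1 G q.2)
      ((contourMeasure a α).prod (volume.prod volume)) := by
  have hδ : 0 < min a α := lt_min ha hα
  have hb := (integrable_weight_growth (μ := μ) hβ ha hα h).mul_prod (integrable_decayKernel hG)
  refine hb.mono' ?_ ?_
  · refine (measurable_weight.comp measurable_fst).aestronglyMeasurable.mul ?_
    unfold traceKernel
    have m1 : Measurable fun q : ℂ × (E3 × E3) => ((q.1, q.2.2) : ℂ × E3) :=
      measurable_fst.prodMk (measurable_snd.comp measurable_snd)
    have m2 : Measurable fun q : ℂ × (E3 × E3) => ((q.1, q.2.2 - q.2.1) : ℂ × E3) :=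
      measurable_fst.prodMk ((measurable_snd.comp measurable_snd).sub
        (measurable_fst.comp measurable_snd))
    have h1 : Measurable fun q : ℂ × (E3 × E3) => resSymbol q.1 q.2.2 :=
      measurable_resSymbol.comp m1
    have h2 : Measurable fun q : ℂ × (E3 × E3) => resSymbol q.1 (q.2.2 - q.2.1) :=
      measurable_resSymbol.comp m2
    have h3 : AEStronglyMeasurable (fun q : ℂ × (E3 × E3) => G q.2.1)
        ((contourMeasure a α).prod (volume.prod volume)) :=
      (aestronglyMeasurable_comp_fst hG.1).comp_snd
    exact h1.aestronglyMeasurable.mul (h2.aestronglyMeasurable.mul h3)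
  · have := (Measure.quasiMeasurePreserving_fst (μ := contourMeasure a α)
      (ν := (volume : Measure E3).prod (volume : Measure E3))).ae (ae_far (a := a) hα)
    filter_upwards [this] with q hq
    rw [norm_mul, mul_assoc]
    gcongr
    exact hq.norm_traceKernel_le hδ G q.2

/-- The contour integral of the traces is given by the response symbol. -/
theorem integral_weight_opTrace (hβ : 0 < β) (ha : 0 < a) (hα : 0 < α)
    (h : α * β < Real.pi) (X φ : L2) :
    ∫ z, weight β μ α z * opTrace (mulMult (star X) (resTwo z) ∘L mulMult φ (resTwo z))
      ∂contourMeasure a α =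
      ∫ l, conj ((𝓕 X : L2) l) * (responseSymbol β μ l * (𝓕 φ : L2) l) := by
  have hδ : 0 < min a α := lt_min ha hα
  set G : E3 → ℂ := fun l => (𝓕 φ : L2) l * conj ((𝓕 X : L2) l) with hGdef
  have hG : Integrable G :=
    (integrable_conj_mul (𝓕 X : L2) (𝓕 φ : L2)).congr (.of_forall fun l => mul_comm _ _)
  have hint := integrable_weight_traceKernel (μ := μ) hβ ha hα h hG
  have e1 : ∀ᵐ z ∂contourMeasure a α,
      weight β μ α z * opTrace (mulMult (star X) (resTwo z) ∘L mulMult φ (resTwo z)) =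
      ∫ p, weight β μ α z * traceKernel z G p ∂(volume.prod volume) := by
    filter_upwards [ae_far hα] with z hz
    rw [hz.opTrace_eq_integral_prod hδ, integral_const_mul]
  rw [integral_congr_ae e1, integral_integral_swap hint,
    integral_prod _ hint.integral_prod_right]
  refine integral_congr_ae ?_
  -- At `l = 0` the two energies agree for every `k`; this single frequency is discarded.
  have hl0 : ∀ᵐ l : E3, l ≠ 0 := by simp [ae_iff]
  filter_upwards [hl0] with l hl
  have e2 : ∀ᵐ k : E3, ∫ z, weight β μ α z * traceKernel z G (l, k) ∂contourMeasure a α =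
      (occQuot β μ ((2 * Real.pi * ‖k‖) ^ 2) ((2 * Real.pi * ‖k - l‖) ^ 2) : ℂ) * G l := by
    filter_upwards [ae_norm_ne_norm_sub hl] with k hk
    rw [← integral_weight_resSymbol hβ ha hα h hk, ← integral_mul_const]
    refine integral_congr_ae (.of_forall fun z => ?_)
    simp only [traceKernel]
    ring
  refine (integral_congr_ae e2).trans ?_
  rw [integral_mul_const, integral_complex_ofReal, integral_occQuot hβ hl,
    responseSymbol, hGdef]
  ring

end

/-! ### Densities of contour integrals by duality -/

section

open scoped ENNReal ComplexConjugate

variable {β μ a α : ℝ}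

theorem measurableSet_far (δ : ℝ) : MeasurableSet {z | Far δ z} := by
  have e : {z | Far δ z} = ⋂ t : ℝ, ⋂ _ : 0 ≤ t, {z : ℂ | δ ≤ ‖z - t‖} := by
    ext z
    simp [Far]
  rw [e]
  exact (isClosed_iInter fun t => isClosed_iInter fun _ =>
    isClosed_le continuous_const (by fun_prop)).measurableSet

theorem aestronglyMeasurable_of_continuousOn_far {W : Type*} [NormedAddCommGroup W] (hα : 0 < α)
    {f : ℂ → W} (hf : ContinuousOn f {z | Far (min a α) z}) :
    AEStronglyMeasurable f (contourMeasure a α) := by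
  rw [← Measure.restrict_eq_self_of_ae_mem (s := {z | Far (min a α) z}) (ae_far hα)]
  exact hf.aestronglyMeasurable (measurableSet_far _)

theorem integrable_weight_smul {W : Type*} [NormedAddCommGroup W] [NormedSpace ℂ W]
    (hβ : 0 < β) (ha : 0 < a) (hα : 0 < α) (h : α * β < Real.pi) {f : ℂ → W}
    (hf : ContinuousOn f {z | Far (min a α) z}) (C : ℝ)
    (hC : ∀ z, Far (min a α) z → ‖f z‖ ≤ C * growth (min a α) z ^ 2) :
    Integrable (fun z => weight β μ α z • f z) (contourMeasure a α) := by
  refine ((integrable_weight_growth (μ := μ) hβ ha hα h).const_mul C).mono'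
    (measurable_weight.aestronglyMeasurable.smul (aestronglyMeasurable_of_continuousOn_far hα hf)) ?_
  filter_upwards [ae_far hα] with z hz
  rw [norm_smul]
  calc _ ≤ ‖weight β μ α z‖ * (C * growth (min a α) z ^ 2) := by gcongr; exact hC z hz
    _ = _ := by ring

theorem HasTrace.add {S T : L2 →L[ℂ] L2} {σ τ : ℂ} (hS : HasTrace S σ) (hT : HasTrace T τ) :
    HasTrace (S + T) (σ + τ) := fun ι e => by
  simpa only [add_apply, inner_add_right] using (hS ι e).add (hT ι e)

theorem HasTrace.smul {T : L2 →L[ℂ] L2} {τ : ℂ} (c : ℂ) (hT : HasTrace T τ) :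
    HasTrace (c • T) (c * τ) := fun ι e => by
  simpa only [smul_apply, inner_smul_right] using (hT ι e).mul_left c

/-- The operator `χ (z + Δ)⁻¹ V φ (z + Δ)⁻¹`. -/
def sandwichOp (V : ℂ → L2 →L[ℂ] L2) (χ φ : L2) (z : ℂ) : L2 →L[ℂ] L2 :=
  mulMult χ (resTwo z) ∘L V z ∘L mulMult φ (resTwo z)

/-- The total mass of the weight that controls the traces. -/
def traceMass (β μ a α : ℝ) : ℝ :=
  (∫ z, ‖weight β μ α z‖ * growth (min a α) z ^ 2 ∂contourMeasure a α) * decayNorm ^ 2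

/-- A bounded continuous family of operators on the resolvent set. -/
structure IsAdmissible (a α : ℝ) (V : ℂ → L2 →L[ℂ] L2) (v : ℝ) : Prop where
  nonneg : 0 ≤ v
  norm_le : ∀ z, Far (min a α) z → ‖V z‖ ≤ v
  cont : ContinuousOn V {z | Far (min a α) z}

section

variable {V : ℂ → L2 →L[ℂ] L2} {v : ℝ}

theorem hsBound_sandwich_right {z : ℂ} (hδ : 0 < min a α) (hV : IsAdmissible a α V v)
    (hz : Far (min a α) z) (φ : L2) :
    HSBound (V z ∘L mulMult φ (resTwo z)) (v * (‖φ‖ * (growth (min a α) z * decayNorm))) := by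
  refine ((hsBound_mulMult φ (resTwo z)).comp_left (V z)).mono ?_
  have h1 := hV.norm_le z hz
  have h2 := hz.norm_resTwo_le hδ
  have h3 := hV.nonneg
  gcongr

theorem hsBound_sandwich_left {z : ℂ} (hδ : 0 < min a α) (hz : Far (min a α) z) (χ : L2) :
    HSBound (mulMult χ (resTwo z)) (‖χ‖ * (growth (min a α) z * decayNorm)) := by
  refine (hsBound_mulMult χ (resTwo z)).mono ?_
  have h2 := hz.norm_resTwo_le hδ
  gcongr

theorem continuousOn_sandwichOp (hδ : 0 < min a α) (hV : IsAdmissible a α V v) (χ φ : L2) :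
    ContinuousOn (sandwichOp V χ φ) {z | Far (min a α) z} :=
  (continuousOn_mulMult hδ χ).clm_comp (hV.cont.clm_comp (continuousOn_mulMult hδ φ))

theorem norm_sandwichOp_le (hδ : 0 < min a α) (hV : IsAdmissible a α V v) (χ φ : L2) (z : ℂ)
    (hz : Far (min a α) z) : ‖sandwichOp V χ φ z‖ ≤
      ‖χ‖ * (‖φ‖ * v) * decayNorm ^ 2 * growth (min a α) z ^ 2 := by
  have h1 := hV.norm_le z hz
  have h2 := hz.norm_resTwo_le hδ
  have h3 := hV.nonneg
  have h4 := decayNorm_nonneg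
  have h5 := (growth_pos hδ z).le
  calc _ ≤ ‖mulMult χ (resTwo z)‖ * (‖V z‖ * ‖mulMult φ (resTwo z)‖) :=
        (ContinuousLinearMap.opNorm_comp_le _ _).trans
          (mul_le_mul_of_nonneg_left (ContinuousLinearMap.opNorm_comp_le _ _) (norm_nonneg _))
    _ ≤ (‖χ‖ * (growth (min a α) z * decayNorm)) *
        (v * (‖φ‖ * (growth (min a α) z * decayNorm))) := by
        gcongr
        · exact (norm_mulMult_le _ _).trans (by gcongr)
        · exact (norm_mulMult_le _ _).trans (by gcongr)
    _ = _ := by ring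

theorem integrable_sandwichOp (hβ : 0 < β) (ha : 0 < a) (hα : 0 < α) (h : α * β < Real.pi)
    (hV : IsAdmissible a α V v) (χ φ : L2) :
    Integrable (fun z => weight β μ α z • sandwichOp V χ φ z) (contourMeasure a α) :=
  integrable_weight_smul hβ ha hα h (continuousOn_sandwichOp (lt_min ha hα) hV χ φ) _
    (norm_sandwichOp_le (lt_min ha hα) hV χ φ)

/-- The contour integral of the operators `χ (z + Δ)⁻¹ V φ (z + Δ)⁻¹`. -/
def sandwichInt (β μ a α : ℝ) (V : ℂ → L2 →L[ℂ] L2) (χ φ : L2) : L2 →L[ℂ] L2 :=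
  ∫ z, weight β μ α z • sandwichOp V χ φ z ∂contourMeasure a α

theorem sandwichInt_add (hβ : 0 < β) (ha : 0 < a) (hα : 0 < α) (h : α * β < Real.pi)
    (hV : IsAdmissible a α V v) (χ χ' φ : L2) :
    sandwichInt β μ a α V (χ + χ') φ = sandwichInt β μ a α V χ φ + sandwichInt β μ a α V χ' φ := by
  refine Eq.trans ?_ (integral_add (integrable_sandwichOp hβ ha hα h hV χ φ)
    (integrable_sandwichOp hβ ha hα h hV χ' φ))
  refine integral_congr_ae (.of_forall fun z => ?_)
  simp only [sandwichOp, mulMult, map_add, ContinuousLinearMap.add_comp, smul_add]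

theorem sandwichInt_smul (c : ℂ) (χ φ : L2) :
    sandwichInt β μ a α V (c • χ) φ = c • sandwichInt β μ a α V χ φ := by
  refine Eq.trans ?_ (integral_smul c _)
  refine integral_congr_ae (.of_forall fun z => ?_)
  simp only [sandwichOp, mulMult, map_smul, ContinuousLinearMap.smul_comp]
  rw [smul_comm]

/-- Convergence in operator norm controls only matrix elements. Their sum is exchanged with the
contour integral because, at each `z`, absolute sums over finite sets of basis vectors have a common
integrable bound from the Hilbert–Schmidt estimates. -/
theorem hasTrace_sandwichInt (hβ : 0 < β) (ha : 0 < a) (hα : 0 < α) (h : α * β < Real.pi)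
    (hV : IsAdmissible a α V v) (χ φ : L2) :
    HasTrace (sandwichInt β μ a α V χ φ)
      (∫ z, weight β μ α z * opTrace (sandwichOp V χ φ z) ∂contourMeasure a α) := by
  intro ι e
  have := countable_of_hilbertBasis e
  have hδ : 0 < min a α := lt_min ha hα
  have hi := integrable_sandwichOp (μ := μ) hβ ha hα h hV χ φ
  let ev : ι → (L2 →L[ℂ] L2) →L[ℂ] ℂ := fun i =>
    innerSL ℂ (e i) ∘L ContinuousLinearMap.apply ℂ L2 (e i)
  have hev : ∀ i T, ev i T = ⟪e i, T (e i)⟫_ℂ := fun i T => rfl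
  let F : ι → ℂ → ℂ := fun i z => ev i (weight β μ α z • sandwichOp V χ φ z)
  have hF : ∀ i, Integrable (F i) (contourMeasure a α) := fun i => (ev i).integrable_comp hi
  have hbound : ∀ z, Far (min a α) z → ∀ s : Finset ι, ∑ i ∈ s, ‖F i z‖ ≤
      ‖weight β μ α z‖ * growth (min a α) z ^ 2 * (‖χ‖ * (‖φ‖ * v) * decayNorm ^ 2) := by
    intro z hz s
    have hA := hsBound_sandwich_left hδ hz χ
    have hB := hsBound_sandwich_right hδ hV hz φ
    have h1 := ((hA.summable_inner_comp hB e).sum_le_tsum s (fun _ _ => norm_nonneg _)).trans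
      (hA.tsum_norm_inner_comp_le hB e)
    have h2 : ∀ i, ‖F i z‖ = ‖weight β μ α z‖ * ‖⟪e i, sandwichOp V χ φ z (e i)⟫_ℂ‖ := by
      intro i
      simp only [F]
      rw [map_smul, norm_smul, hev]
    simp only [h2]
    rw [← Finset.mul_sum]
    calc _ ≤ ‖weight β μ α z‖ * (‖χ‖ * (growth (min a α) z * decayNorm) *
          (v * (‖φ‖ * (growth (min a α) z * decayNorm)))) := by
            gcongr
            exact h1
      _ = _ := by ring
  have hS : Summable fun i => ∫ z, ‖F i z‖ ∂contourMeasure a α := by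
    refine summable_of_sum_le (fun i => integral_nonneg fun _ => norm_nonneg _)
      (c := ∫ z, ‖weight β μ α z‖ * growth (min a α) z ^ 2 *
        (‖χ‖ * (‖φ‖ * v) * decayNorm ^ 2) ∂contourMeasure a α) fun s => ?_
    rw [← integral_finsetSum _ fun i _ => (hF i).norm]
    refine integral_mono_ae (integrable_finsetSum _ fun i _ => (hF i).norm)
      ((integrable_weight_growth (μ := μ) hβ ha hα h).mul_const _) ?_
    filter_upwards [ae_far hα] with z hz
    exact hbound z hz s
  have h1 := hasSum_integral_of_summable_integral_norm hF hS
  have h2 : ∀ i, ∫ z, F i z ∂contourMeasure a α = ⟪e i, sandwichInt β μ a α V χ φ (e i)⟫_ℂ :=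
    fun i => (ev i).integral_comp_comm hi
  have h3 : ∫ z, ∑' i, F i z ∂contourMeasure a α =
      ∫ z, weight β μ α z * opTrace (sandwichOp V χ φ z) ∂contourMeasure a α := by
    refine integral_congr_ae ?_
    filter_upwards [ae_far hα] with z hz
    have hA := hsBound_sandwich_left hδ hz χ
    have hB := hsBound_sandwich_right hδ hV hz φ
    exact (((hA.hasTrace hB).smul (weight β μ α z)) ι e).tsum_eq
  rw [← h3]
  simpa only [h2] using h1

theorem norm_integral_opTrace_le (hβ : 0 < β) (ha : 0 < a) (hα : 0 < α) (h : α * β < Real.pi)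
    (hV : IsAdmissible a α V v) (χ φ : L2) :
    ‖∫ z, weight β μ α z * opTrace (sandwichOp V χ φ z) ∂contourMeasure a α‖ ≤
      ‖φ‖ * v * traceMass β μ a α * ‖χ‖ := by
  have hδ : 0 < min a α := lt_min ha hα
  refine (norm_integral_le_of_norm_le ((integrable_weight_growth (μ := μ) hβ ha hα h).mul_const
    (‖χ‖ * (‖φ‖ * v) * decayNorm ^ 2)) ?_).trans ?_
  · filter_upwards [ae_far hα] with z hz
    have h1 := (hsBound_sandwich_left hδ hz χ).norm_opTrace_le (hsBound_sandwich_right hδ hV hz φ)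
    rw [norm_mul]
    calc _ ≤ ‖weight β μ α z‖ * (‖χ‖ * (growth (min a α) z * decayNorm) *
          (v * (‖φ‖ * (growth (min a α) z * decayNorm)))) := by
            gcongr
            exact h1
      _ = _ := by ring
  · rw [integral_mul_const, traceMass]
    exact le_of_eq (by ring)

/-- The contour integral of the operators `(z + Δ)⁻¹ V φ (z + Δ)⁻¹`. -/
def resolventInt (β μ a α : ℝ) (V : ℂ → L2 →L[ℂ] L2) (φ : L2) : L2 →L[ℂ] L2 :=
  ∫ z, weight β μ α z • (freeRes z ∘L V z ∘L mulMult φ (resTwo z)) ∂contourMeasure a α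

theorem one_le_growth {δ : ℝ} (hδ : 0 < δ) (z : ℂ) : 1 ≤ growth δ z := by
  unfold growth
  have : 0 ≤ (1 + ‖z‖) / δ := by positivity
  linarith

theorem integrable_resolventInt (hβ : 0 < β) (ha : 0 < a) (hα : 0 < α) (h : α * β < Real.pi)
    (hV : IsAdmissible a α V v) (φ : L2) :
    Integrable (fun z => weight β μ α z • (freeRes z ∘L V z ∘L mulMult φ (resTwo z)))
      (contourMeasure a α) := by
  have hδ : 0 < min a α := lt_min ha hα
  refine integrable_weight_smul hβ ha hα h ((continuousOn_freeRes hδ).clm_comp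
    (hV.cont.clm_comp (continuousOn_mulMult hδ φ))) ((min a α)⁻¹ * (v * (‖φ‖ * decayNorm)))
    fun z hz => ?_
  have h1 := hV.norm_le z hz
  have h2 := hz.norm_resTwo_le hδ
  have h3 := hV.nonneg
  have h4 := decayNorm_nonneg
  have h5 := (growth_pos hδ z).le
  have h6 := one_le_growth hδ z
  calc _ ≤ ‖freeRes z‖ * (‖V z‖ * ‖mulMult φ (resTwo z)‖) :=
        (ContinuousLinearMap.opNorm_comp_le _ _).trans
          (mul_le_mul_of_nonneg_left (ContinuousLinearMap.opNorm_comp_le _ _) (norm_nonneg _))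
    _ ≤ (min a α)⁻¹ * (v * (‖φ‖ * (growth (min a α) z * decayNorm))) := by
        gcongr
        · exact hz.norm_freeRes_le hδ
        · exact (norm_mulMult_le _ _).trans (by gcongr)
    _ = (min a α)⁻¹ * (v * (‖φ‖ * decayNorm)) * growth (min a α) z := by ring
    _ ≤ _ := by
        gcongr
        nlinarith

theorem mulInf_comp_resolventInt (hβ : 0 < β) (ha : 0 < a) (hα : 0 < α) (h : α * β < Real.pi)
    (hV : IsAdmissible a α V v) (φ : L2) {χ : L2} {χI : Linf} (hχ : χ =ᵐ[volume] χI) :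
    mulInf χI ∘L resolventInt β μ a α V φ = sandwichInt β μ a α V χ φ := by
  have hδ : 0 < min a α := lt_min ha hα
  have hi := integrable_resolventInt (μ := μ) hβ ha hα h hV φ
  refine ((ContinuousLinearMap.compL ℂ L2 L2 L2 (mulInf χI)).integral_comp_comm hi).symm.trans ?_
  refine integral_congr_ae ?_
  filter_upwards [ae_far hα] with z hz
  rw [map_smul, ContinuousLinearMap.compL_apply, sandwichOp, ← hz.mulInf_comp_freeRes hδ hχ]
  rfl

/-- The density of a contour integral exists and is square integrable. -/
theorem exists_density (hβ : 0 < β) (ha : 0 < a) (hα : 0 < α) (h : α * β < Real.pi)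
    (hV : IsAdmissible a α V v) (φ : L2) :
    ∃ ρ : L2, ‖ρ‖ ≤ ‖φ‖ * v * traceMass β μ a α ∧
      HasDensity (resolventInt β μ a α V φ) ρ ∧
      ∀ χ : L2, ⟪star χ, ρ⟫_ℂ =
        ∫ z, weight β μ α z * opTrace (sandwichOp V χ φ z) ∂contourMeasure a α := by
  have htr := fun χ => hasTrace_sandwichInt (μ := μ) hβ ha hα h hV χ φ
  -- Linearity is read off from uniqueness of the trace of a linear family of operators;
  -- measurability of the traces as functions of `z` is not needed.
  let ℓ₀ : L2 →ₗ[ℂ] ℂ :=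
    { toFun := fun χ => ∫ z, weight β μ α z * opTrace (sandwichOp V χ φ z) ∂contourMeasure a α
      map_add' := fun χ χ' => by
        have h1 := htr (χ + χ')
        rw [sandwichInt_add hβ ha hα h hV] at h1
        rw [h1.eq_opTrace, ((htr χ).add (htr χ')).eq_opTrace]
      map_smul' := fun c χ => by
        have h1 := htr (c • χ)
        rw [sandwichInt_smul] at h1
        rw [h1.eq_opTrace, RingHom.id_apply, smul_eq_mul, ((htr χ).smul c).eq_opTrace] }
  let ℓ : StrongDual ℂ L2 := ℓ₀.mkContinuous (‖φ‖ * v * traceMass β μ a α)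
    (norm_integral_opTrace_le hβ ha hα h hV · φ)
  have hM : 0 ≤ ‖φ‖ * v * traceMass β μ a α := by
    have := hV.nonneg
    have : 0 ≤ traceMass β μ a α :=
      mul_nonneg (integral_nonneg fun z => by positivity) (sq_nonneg _)
    positivity
  let y : L2 := (InnerProductSpace.toDual ℂ L2).symm ℓ
  have hy : ∀ χ, ∫ x, χ x * (star y) x = ℓ₀ χ := by
    intro χ
    have h1 : ⟪y, χ⟫_ℂ = ℓ₀ χ := InnerProductSpace.toDual_symm_apply
    rw [← h1, L2.inner_def]
    refine integral_congr_ae ?_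
    filter_upwards [Lp.coeFn_star y] with x hx
    rw [hx, RCLike.inner_apply]
    rfl
  -- The density pairs bilinearly with `χ`, so it is the complex conjugate of the Riesz vector.
  refine ⟨star y, ?_, ⟨locallyIntegrable_L2 _, fun χ hχ hc => ?_⟩, fun χ => ?_⟩
  · have h1 : ‖star y‖ ≤ ‖y‖ := Lp.norm_le_norm_of_ae_le <| by
      filter_upwards [Lp.coeFn_star y] with x hx
      rw [hx, Pi.star_apply, norm_star]
    refine h1.trans ?_
    rw [LinearIsometryEquiv.norm_map]
    exact ℓ₀.mkContinuous_norm_le hM _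
  · have m2 : MemLp χ 2 (volume : Measure E3) := hχ.continuous.memLp_of_hasCompactSupport hc
    have mI : MemLp χ ⊤ (volume : Measure E3) := hχ.continuous.memLp_of_hasCompactSupport hc
    have hae : m2.toLp χ =ᵐ[volume] mI.toLp χ := m2.coeFn_toLp.trans mI.coeFn_toLp.symm
    refine ⟨mulInf (mI.toLp χ) ∘L resolventInt β μ a α V φ, fun u => ?_, ?_⟩
    · filter_upwards [coeFn_mulInf (mI.toLp χ) (resolventInt β μ a α V φ u), mI.coeFn_toLp]
        with x h1 h2
      rw [ContinuousLinearMap.comp_apply, h1, h2]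
    · rw [mulInf_comp_resolventInt hβ ha hα h hV φ hae]
      have e : ∫ x, χ x * (star y) x = ∫ x, m2.toLp χ x * (star y) x := by
        refine integral_congr_ae ?_
        filter_upwards [m2.coeFn_toLp] with x hx
        rw [hx]
      rw [e, hy]
      exact htr _
  · rw [inner_star_eq_integral]
    exact hy χ

end

theorem HasDensity.add {A B : L2 →L[ℂ] L2} {ρ σ : L2} (hA : HasDensity A ρ)
    (hB : HasDensity B σ) : HasDensity (A + B) (ρ + σ : L2) := by
  refine ⟨locallyIntegrable_L2 _, fun χ hχ hc => ?_⟩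
  obtain ⟨S, hS, hS'⟩ := hA.2 χ hχ hc
  obtain ⟨T, hT, hT'⟩ := hB.2 χ hχ hc
  have m2 : MemLp χ 2 (volume : Measure E3) := hχ.continuous.memLp_of_hasCompactSupport hc
  refine ⟨S + T, fun u => ?_, ?_⟩
  · filter_upwards [hS u, hT u, Lp.coeFn_add (S u) (T u), Lp.coeFn_add (A u) (B u)]
      with x h1 h2 h3 h4
    rw [add_apply, add_apply, h3, h4, Pi.add_apply, Pi.add_apply, h1, h2, mul_add]
  · have e : ∫ x, χ x * (ρ + σ : L2) x = (∫ x, χ x * ρ x) + ∫ x, χ x * σ x := by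
      have h1 : Integrable (fun x => χ x * ρ x) volume := m2.integrable_mul (Lp.memLp ρ)
      have h2 : Integrable (fun x => χ x * σ x) volume := m2.integrable_mul (Lp.memLp σ)
      rw [← integral_add h1 h2]
      refine integral_congr_ae ?_
      filter_upwards [Lp.coeFn_add ρ σ] with x hx
      rw [hx, Pi.add_apply, mul_add]
    rw [e]
    exact hS'.add hT'

/-- The localized operator is determined by its pointwise formula, hence so is its trace; equality
of integrals against real test functions then suffices. -/
theorem HasDensity.unique {A : L2 →L[ℂ] L2} {ρ σ : E3 → ℂ} (h1 : HasDensity A ρ)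
    (h2 : HasDensity A σ) : ρ =ᵐ[volume] σ := by
  refine ae_eq_of_integral_contDiff_smul_eq h1.1 h2.1 fun χ hχ hc => ?_
  have hc' : HasCompactSupport (Complex.ofRealCLM ∘ χ) := hc.comp_left rfl
  have hχ' : ContDiff ℝ ∞ (Complex.ofRealCLM ∘ χ) := by fun_prop
  obtain ⟨S, hS, hS'⟩ := h1.2 _ hχ' hc'
  obtain ⟨T, hT, hT'⟩ := h2.2 _ hχ' hc'
  have e : S = T := by
    ext1 u
    exact Lp.ext ((hS u).trans (hT u).symm)
  rw [e] at hS'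
  have := hS'.eq_opTrace.trans hT'.eq_opTrace.symm
  simpa using this

end

/-! ### Identification of the response operator and the derivative -/

section

open scoped ENNReal ComplexConjugate

variable {β μ a α : ℝ}

theorem memLp_responseSymbol (hβ : 0 < β) :
    MemLp (responseSymbol β μ) ⊤ (volume : Measure E3) := by
  refine memLp_top_of_bound (C := 1 / (4 * Real.pi ^ 2) * (occTail β μ 0).toReal) ?_
    (.of_forall fun ξ => ?_)
  · have h : Measurable fun ξ : E3 => symbol β μ (2 * Real.pi * ‖ξ‖) :=
      measurable_symbol.comp (by fun_prop)
    exact (Complex.measurable_ofReal.comp h).aestronglyMeasurable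
  · have hp : 0 ≤ 2 * Real.pi * ‖ξ‖ := by positivity
    rw [responseSymbol, Complex.norm_real, Real.norm_of_nonneg (symbol_nonneg hp)]
    exact symbol_le hβ hp

/-- The linear response operator. -/
def responseOp (μ : ℝ) (hβ : 0 < β) : L2 →L[ℂ] L2 :=
  multInf ((memLp_responseSymbol (μ := μ) hβ).toLp)

theorem fourier_responseOp (hβ : 0 < β) (φ : L2) :
    (𝓕 (responseOp μ hβ φ) : L2) =ᵐ[volume] fun ξ => responseSymbol β μ ξ * (𝓕 φ : L2) ξ := by
  filter_upwards [fourier_multInf ((memLp_responseSymbol (μ := μ) hβ).toLp) φ,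
    (memLp_responseSymbol (μ := μ) hβ).coeFn_toLp] with ξ h1 h2
  rw [← h2, ← h1]
  rfl

theorem isAdmissible_one : IsAdmissible a α (fun _ => (1 : L2 →L[ℂ] L2)) 1 where
  nonneg := zero_le_one
  norm_le _ _ := ContinuousLinearMap.norm_id_le
  cont := continuousOn_const

theorem hasDensity_responseOp (hβ : 0 < β) (ha : 0 < a) (hα : 0 < α) (h : α * β < Real.pi)
    (φ : L2) : HasDensity (resolventInt β μ a α (fun _ => 1) φ) (responseOp μ hβ φ) := by
  obtain ⟨ρ, -, hρ, hX⟩ := exists_density (μ := μ) hβ ha hα h isAdmissible_one φ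
  -- Pairing with an arbitrary `X ∈ L²` turns the traces into a Plancherel integral against the
  -- symbol, which is the pairing with the multiplier.
  have e : ρ = responseOp μ hβ φ := by
    refine ext_inner_left ℂ fun X => ?_
    have h1 := hX (star X)
    rw [star_star] at h1
    rw [h1, inner_eq_integral_fourier]
    refine (integral_weight_opTrace hβ ha hα h X φ).trans ?_
    refine integral_congr_ae ?_
    filter_upwards [fourier_responseOp (μ := μ) hβ φ] with l hl
    rw [hl]
  rw [← e]
  exact hρ

theorem two_pi_I_inv_ne_zero : (2 * Real.pi * Complex.I : ℂ)⁻¹ ≠ 0 :=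
  inv_ne_zero Complex.two_pi_I_ne_zero

theorem weight_smul {W : Type*} [NormedAddCommGroup W] [NormedSpace ℂ W] (G : W) (z : ℂ) :
    weight β μ α z • G = -(2 * Real.pi * Complex.I : ℂ)⁻¹ • (dir α z • (fermi β μ z • G)) := by
  rw [weight, mul_smul, mul_smul]

theorem hasContourIntegral_of_weight (hα : 0 < α) {G : ℂ → L2 →L[ℂ] L2}
    (hG : Integrable (fun z => weight β μ α z • G z) (contourMeasure a α)) :
    ∃ J, HasContourIntegral a α (fun z => fermi β μ z • G z) J ∧
      -((2 * Real.pi * Complex.I : ℂ)⁻¹ • J) =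
        ∫ z, weight β μ α z • G z ∂contourMeasure a α := by
  have e : (fun z => weight β μ α z • G z) =
      fun z => -(2 * Real.pi * Complex.I : ℂ)⁻¹ • (dir α z • (fermi β μ z • G z)) :=
    funext fun z => weight_smul (G z) z
  rw [e] at hG ⊢
  refine ⟨_, (hasContourIntegral_iff hα).2 ⟨?_, rfl⟩, ?_⟩
  · rw [← integrable_dir_smul_iff]
    exact (integrable_smul_iff (neg_ne_zero.2 two_pi_I_inv_ne_zero) _).1 hG
  · rw [← neg_smul]
    exact (integral_smul _ _).symm

theorem isLinearResponse_iff (hβ : 0 < β) (ha : 0 < a) (hα : 0 < α) (h : α * β < Real.pi)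
    (φ g : L2) : IsLinearResponse β μ a α φ g ↔ g = responseOp μ hβ φ := by
  have hδ : 0 < min a α := lt_min ha hα
  have hs : ∀ z ∈ contour a α, IsSandwich φ z (freeRes z ∘L mulMult φ (resTwo z)) :=
    fun z hz => (far_of_mem_contour hz).isSandwich hδ φ
  obtain ⟨J, hJ, hJ'⟩ := hasContourIntegral_of_weight hα
    (integrable_resolventInt (μ := μ) hβ ha hα h isAdmissible_one φ)
  have hden := hasDensity_responseOp (μ := μ) hβ ha hα h φ
  rw [resolventInt, ← hJ'] at hden
  constructor
  · rintro ⟨T, J₁, hT, hJ₁, hg⟩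
    have e : J₁ = J := by
      rw [((hasContourIntegral_iff hα).1 hJ₁).2, ((hasContourIntegral_iff hα).1 hJ).2]
      refine integral_congr_ae ?_
      filter_upwards [ae_mem_contour hα] with z hz
      rw [(hT z hz).unique (hs z hz)]
      rfl
    rw [e] at hg
    exact Lp.ext (hg.unique hden)
  · rintro rfl
    exact ⟨_, J, hs, hJ, hden⟩

theorem isFermiOperator_of_resolvent (hα : 0 < α) {H : L2 →ₗ.[ℂ] L2} {R : ℂ → L2 →L[ℂ] L2}
    (hR : ∀ z, Far (min a α) z → IsResolventAt H z (R z))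
    (hi : Integrable (fun z => weight β μ α z • R z) (contourMeasure a α)) :
    IsFermiOperator β μ a α H (-∫ z, weight β μ α z • R z ∂contourMeasure a α) := by
  refine ⟨fun z hz => ⟨_, hR z (far_of_notMem_halfStrip hz)⟩, ?_⟩
  have e : ∀ᵐ z ∂contourMeasure a α, R z = resolventOf H z := by
    filter_upwards [ae_far hα] with z hz
    exact ((hR z hz).resolventOf_eq).symm
  have e2 : (fun z => weight β μ α z • R z) =ᵐ[contourMeasure a α]
      fun z => weight β μ α z • resolventOf H z := by
    filter_upwards [e] with z hz
    rw [hz]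
  obtain ⟨J, hJ, hJ'⟩ := hasContourIntegral_of_weight hα (hi.congr e2)
  refine ⟨J, hJ, ?_⟩
  rw [integral_congr_ae e2, ← hJ', neg_neg]

theorem integrable_weight_of_bounded (hβ : 0 < β) (ha : 0 < a) (hα : 0 < α)
    (h : α * β < Real.pi) {R : ℂ → L2 →L[ℂ] L2} (hR : ContinuousOn R {z | Far (min a α) z})
    {c : ℝ} (hc : 0 ≤ c) (hb : ∀ z, Far (min a α) z → ‖R z‖ ≤ c) :
    Integrable (fun z => weight β μ α z • R z) (contourMeasure a α) := by
  refine integrable_weight_smul hβ ha hα h hR c fun z hz => (hb z hz).trans ?_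
  exact le_mul_of_one_le_right hc (one_le_pow₀ (one_le_growth (lt_min ha hα) z))

/-- The bound is linear in `‖Φ‖`; together with the factor `‖φ‖` from the density estimate it makes
the remainder quadratic. -/
theorem isAdmissible_second (ha : 0 < a) (hα : 0 < α) {Φ : Linf} (hΦ : ‖Φ‖ ≤ min a α / 2) :
    IsAdmissible a α (fun z => -(resFactor Φ z ∘L mulInf Φ ∘L freeRes z))
      (2 * (‖Φ‖ * (min a α)⁻¹)) where
  nonneg := by
    have : 0 < min a α := lt_min ha hα
    positivity
  norm_le z hz := by
    have hδ : 0 < min a α := lt_min ha hα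
    rw [norm_neg]
    refine (ContinuousLinearMap.opNorm_comp_le _ _).trans ?_
    exact mul_le_mul (hz.norm_resFactor_le hδ hΦ) (hz.norm_mulInf_comp_freeRes_le hδ Φ)
      (norm_nonneg _) zero_le_two
  cont := by
    have hδ : 0 < min a α := lt_min ha hα
    exact ((continuousOn_resFactor hδ hΦ).clm_comp
      (continuousOn_const.clm_comp (continuousOn_freeRes hδ))).neg

theorem resFactor_zero (z : ℂ) : resFactor 0 z = 1 := by
  rw [resFactor, map_zero, ContinuousLinearMap.zero_comp, add_zero, Ring.inverse_one]

/-- The increment of the Fermi operator is the sum of the linear response and a remainder that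
is quadratic in the potential. -/
theorem exists_increment (hβ : 0 < β) (ha : 0 < a) (hα : 0 < α) (h : α * β < Real.pi)
    {φ : L2} {Φ : Linf} (hφ : φ =ᵐ[volume] Φ) (hΦ : ‖Φ‖ ≤ min a α / 2) :
    ∃ (A A₀ : L2 →L[ℂ] L2) (ρ : L2), IsFermiOperator β μ a α (hamiltonian φ) A ∧
      IsFermiOperator β μ a α (hamiltonian 0) A₀ ∧ HasDensity (A - A₀) ρ ∧
      ‖ρ - responseOp μ hβ φ‖ ≤ ‖φ‖ * (2 * (‖Φ‖ * (min a α)⁻¹)) * traceMass β μ a α := by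
  have hδ : 0 < min a α := lt_min ha hα
  have hV := isAdmissible_second ha hα hΦ
  have hΦ0 : ‖(0 : Linf)‖ ≤ min a α / 2 := by rw [norm_zero]; positivity
  have h0 : ((0 : L2) : E3 → ℂ) =ᵐ[volume] (0 : Linf) :=
    (Lp.coeFn_zero ℂ 2 volume).trans (Lp.coeFn_zero ℂ ⊤ volume).symm
  obtain ⟨ρ₂, hn, hρ₂, -⟩ := exists_density (μ := μ) hβ ha hα h hV φ
  have hi : Integrable (fun z => weight β μ α z • (freeRes z ∘L resFactor Φ z))
      (contourMeasure a α) := by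
    refine integrable_weight_of_bounded hβ ha hα h ((continuousOn_freeRes hδ).clm_comp
      (continuousOn_resFactor hδ hΦ)) (c := (min a α)⁻¹ * 2) (by positivity) fun z hz => ?_
    refine (ContinuousLinearMap.opNorm_comp_le _ _).trans ?_
    exact mul_le_mul (hz.norm_freeRes_le hδ) (hz.norm_resFactor_le hδ hΦ) (norm_nonneg _)
      (by positivity)
  have hi0 : Integrable (fun z => weight β μ α z • freeRes z) (contourMeasure a α) :=
    integrable_weight_of_bounded hβ ha hα h (continuousOn_freeRes hδ) (c := (min a α)⁻¹)
      (by positivity) fun z hz => hz.norm_freeRes_le hδ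
  refine ⟨_, _, responseOp μ hβ φ + ρ₂, isFermiOperator_of_resolvent hα
    (fun z hz => hz.isResolventAt_hamiltonian hδ hφ hΦ) hi,
    isFermiOperator_of_resolvent hα (fun z hz => ?_) hi0, ?_, ?_⟩
  · have := hz.isResolventAt_hamiltonian hδ h0 hΦ0
    rw [resFactor_zero] at this
    exact this
  · have e : -(∫ z, weight β μ α z • (freeRes z ∘L resFactor Φ z) ∂contourMeasure a α) -
        -(∫ z, weight β μ α z • freeRes z ∂contourMeasure a α) =
        resolventInt β μ a α (fun _ => 1) φ + resolventInt β μ a α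
          (fun z => -(resFactor Φ z ∘L mulInf Φ ∘L freeRes z)) φ := by
      have h1 := integral_sub hi0 hi
      have h2 := integral_add (integrable_resolventInt (μ := μ) hβ ha hα h isAdmissible_one φ)
        (integrable_resolventInt (μ := μ) hβ ha hα h hV φ)
      refine (neg_sub_neg _ _).trans (h1.symm.trans (Eq.trans ?_ h2))
      refine integral_congr_ae ?_
      filter_upwards [ae_far hα] with z hz
      rw [← smul_sub, ← smul_add, hz.freeRes_comp_resFactor hδ hφ hΦ]
      congr 1
      change freeRes z - (freeRes z - freeRes z * mulMult φ (resTwo z) +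
        freeRes z * ((resFactor Φ z * (mulInf Φ * freeRes z)) * mulMult φ (resTwo z))) =
        freeRes z * (1 * mulMult φ (resTwo z)) + freeRes z *
          (-(resFactor Φ z * (mulInf Φ * freeRes z)) * mulMult φ (resTwo z))
      noncomm_ring
    rw [e]
    exact (hasDensity_responseOp (μ := μ) hβ ha hα h φ).add hρ₂
  · rwa [add_sub_cancel_left]

theorem isLinearization_responseOp (hβ : 0 < β) (ha : 0 < a) (hα : 0 < α)
    (h : α * β < Real.pi) : IsLinearization β μ a α (responseOp μ hβ) := by
  intro ε hε
  obtain ⟨C, hC, hex⟩ := exists_Linf_of_mem_domain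
  have hδ : 0 < min a α := lt_min ha hα
  have hK : 0 ≤ traceMass β μ a α :=
    mul_nonneg (integral_nonneg fun z => by positivity) (sq_nonneg _)
  set K := traceMass β μ a α
  set d := min a α
  set B := 2 * (C * d⁻¹) * K
  have hB : 0 ≤ B := by positivity
  -- The first bound forces `‖Φ‖ ≤ d / 2` through the Sobolev constant `C`; the second turns the
  -- remainder `B N²` into at most `ε N`. Adding `1` avoids dividing by zero.
  refine ⟨min (d / (2 * (C + 1))) (ε / (B + 1)), by positivity, fun φ hφ => ?_⟩
  set N := ‖(φ : L2)‖ + ‖laplace φ‖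
  have hN : 0 ≤ N := by positivity
  have hφN : ‖(φ : L2)‖ ≤ N := le_add_of_nonneg_right (norm_nonneg _)
  have hN1 : N * (2 * (C + 1)) ≤ d :=
    (le_div_iff₀ (by positivity)).1 (hφ.trans (min_le_left _ _))
  have hN2 : N * (B + 1) ≤ ε := (le_div_iff₀ (by positivity)).1 (hφ.trans (min_le_right _ _))
  obtain ⟨Φ, hae, hΦ⟩ := hex φ
  have hΦd : ‖Φ‖ ≤ d / 2 := hΦ.trans (by nlinarith)
  obtain ⟨A, A₀, ρ, hA, hA₀, hρ, hn⟩ := exists_increment (μ := μ) hβ ha hα h hae hΦd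
  refine ⟨A, A₀, ρ, hA, hA₀, hρ, hn.trans ?_⟩
  calc ‖(φ : L2)‖ * (2 * (‖Φ‖ * d⁻¹)) * K ≤ N * (2 * (C * N * d⁻¹)) * K := by gcongr
    _ = N * B * N := by ring
    _ ≤ ε * N := by
        gcongr
        linarith

end

end REHF

end

/-- The frequency variable `ξ` of Mathlib's Fourier transform `∫ f(x) e^{-2πi x·ξ} dx` corresponds
to the momentum `k = 2π ξ`, so `|∇|` is multiplication by `2π |ξ|`. -/
theorem mainTheorem6 (β μ : ℝ) (hβ : 0 < β) (hμ : 0 < μ) :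
    (∀ p : ℝ, 0 < p → IntegrableOn (REHF.symbolIntegrand β μ p) (Ioi 0)) ∧
    ∃ M : REHF.L2 →L[ℂ] REHF.L2,
      (∀ a α : ℝ, 0 < a → 0 < α → α * β < Real.pi →
        (∀ φ g : REHF.L2, REHF.IsLinearResponse β μ a α φ g ↔ g = M φ) ∧
        REHF.IsLinearization β μ a α M) ∧
      ∀ φ : REHF.L2,
        (𝓕 (M φ) : REHF.L2) =ᵐ[volume]
          fun ξ => (REHF.symbol β μ (2 * Real.pi * ‖ξ‖) : ℂ) * (𝓕 φ : REHF.L2) ξ :=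
  ⟨fun _ hp => REHF.integrableOn_symbolIntegrand hβ hp, REHF.responseOp μ hβ,
    fun _ _ ha hα h => ⟨REHF.isLinearResponse_iff hβ ha hα h,
      REHF.isLinearization_responseOp hβ ha hα h⟩,
    REHF.fourier_responseOp hβ⟩
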